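/- Digraphs are finite, with at least one vertex, without loops and without parallel arcs. A digraph is strong if for any two vertices $x,y$ it contains a directed path from $x$ to $y$; it is symmetric if for every arc $xy$ also $yx$ is an arc; it is semicomplete if for any two distinct vertices $x,y$ at least one of $xy,yx$ is an arc. For a digraph $D$ with vertices $u_1,\dots,u_t$ and digraphs $H_1,\dots,H_t$, the composition $D[H_1,\dots,H_t]$ has as vertex set the disjoint union of $V(H_1),\dots,V(H_t)$; its arcs are all arcs of the $H_i$ and all arcs $xy$ with $x\in V(H_i)$, $y\in V(H_p)$ and $u_iu_p\in A(D)$. For a set $S$ of vertices of a digraph $Q$, an $S$-strong subgraph of $Q$ is a strong subgraph $H$ of $Q$ with $S\subseteq V(H)$. Let $$\mathcal Q_0=\{\overrightarrow{C}_3[\overline{K_2},\overline{K_2},\overline{K_2}],\ \overrightarrow{C}_3[\overrightarrow{P_2},\overline{K_2},\overline{K_2}],\ \overrightarrow{C}_3[\overline{K_2},\overline{K_2},\overline{K_3}]\},$$ where $\overrightarrow{C}_3$ is the directed cycle on three vertices, $\overline{K_r}$ the digraph with $r$ vertices and no arcs, and $\overrightarrow{P_2}$ the directed path on two vertices; $Q\notin\mathcal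 Q_0$ means that $Q$ is isomorphic to none of these three digraphs. **Theorem.** Let $Q=D[H_1,\dots,H_t]$ with $t\ge 2$, let $n=|V(Q)|$ and $n_0=\min_{1\le i\le t}|V(H_i)|$, and suppose that (i) $D$ is strong and symmetric, or (ii) $D$ is strong and semicomplete, and $Q\notin\mathcal Q_0$. Then for every $S\subseteq V(Q)$ with $2\le|S|\le|V(Q)|$, $Q$ has at least $n_0$ pairwise arc-disjoint $S$-strong subgraphs. Moreover, $n_0$ such subgraphs can be found in time $O(n^4)$: there is a single algorithm which, given $D$, $H_1,\dots,H_t$ (by their adjacency matrices) and $S$ satisfying these conditions, outputs $n_0$ pairwise arc-disjoint $S$-strong subgraphs of $Q$ in at most $Cn^4$ steps of a word RAM with words of $O(\log n)$ bits, where $C$ is an absolute constant. -/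

import Mathlib

namespace StrongPacking

/-! ### Digraphs, strong subgraphs, compositions -/

section Digraphs

universe u v

variable {V : Type u}

/-- No arc from a vertex to itself. (Parallel arcs do not exist in a `Digraph`.) -/
def Loopless (D : Digraph V) : Prop := ∀ x, ¬ D.Adj x x

/-- For any two vertices `x`, `y` there is a directed path from `x` to `y`. -/
def Strong (D : Digraph V) : Prop := ∀ x y, Relation.ReflTransGen D.Adj x y

/-- Every arc has an opposite arc. -/
def Symmetric (D : Digraph V) : Prop := ∀ x y, D.Adj x y → D.Adj y x

/-- Any two distinct vertices are joined by at least one arc. -/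
def Semicomplete (D : Digraph V) : Prop := ∀ x y, x ≠ y → D.Adj x y ∨ D.Adj y x

/-- Isomorphism of digraphs. -/
def Isomorphic {W : Type v} (D : Digraph V) (E : Digraph W) : Prop :=
  Nonempty (D.Adj ≃r E.Adj)

/-- A subgraph of a digraph: a set of vertices and a set of arcs of the digraph between them. -/
structure Subdigraph (D : Digraph V) where
  verts : Set V
  Adj : V → V → Prop
  adj_sub : ∀ {x y}, Adj x y → D.Adj x y
  tail_mem : ∀ {x y}, Adj x y → x ∈ verts
  head_mem : ∀ {x y}, Adj x y → y ∈ verts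

/-- `H` is an `S`-strong subgraph of `D`: `H` is strong and contains all vertices of `S`. -/
def IsSStrong {D : Digraph V} (S : Set V) (H : Subdigraph D) : Prop :=
  S ⊆ H.verts ∧ ∀ x ∈ H.verts, ∀ y ∈ H.verts, Relation.ReflTransGen H.Adj x y

/-- Two subgraphs without a common arc. -/
def ArcDisjoint {D : Digraph V} (H K : Subdigraph D) : Prop :=
  ∀ x y, ¬ (H.Adj x y ∧ K.Adj x y)

/-- A family of pairwise arc-disjoint `S`-strong subgraphs. -/
def IsPacking {D : Digraph V} (S : Set V) {k : ℕ} (F : Fin k → Subdigraph D) : Prop :=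
  (∀ s, IsSStrong S (F s)) ∧ ∀ s s', s ≠ s' → ArcDisjoint (F s) (F s')

/-- The composition `D[H_1, …, H_t]`: the vertex `⟨i, a⟩` is the vertex `a` of `H i`. Its arcs are
the arcs of the `H i`, and all arcs from `H i` to `H j` whenever `D` has the arc from `i` to `j`. -/
def comp {W : V → Type v} (D : Digraph V) (H : ∀ i, Digraph (W i)) :
    Digraph (Σ i, W i) where
  Adj x y := (∃ i a b, x = ⟨i, a⟩ ∧ y = ⟨i, b⟩ ∧ (H i).Adj a b) ∨ D.Adj x.1 y.1

/-- The directed cycle on three vertices. -/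
def C3 : Digraph (Fin 3) := ⟨fun i j => j = i + 1⟩

/-- `C_3[E_2, E_2, E_2]`, where `E_r` is the digraph with `r` vertices and no arcs. -/
def exc₁ : Digraph (Σ i : Fin 3, Fin (![2, 2, 2] i)) :=
  comp C3 fun _ => ⟨fun _ _ => False⟩

/-- `C_3[P_2, E_2, E_2]`, where `P_2` is the directed path with two vertices. -/
def exc₂ : Digraph (Σ i : Fin 3, Fin (![2, 2, 2] i)) :=
  comp C3 fun i => ⟨fun a b => i = 0 ∧ a.val = 0 ∧ b.val = 1⟩

/-- `C_3[E_2, E_2, E_3]`. -/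
def exc₃ : Digraph (Σ i : Fin 3, Fin (![2, 2, 3] i)) :=
  comp C3 fun _ => ⟨fun _ _ => False⟩

/-- Membership in `𝒬₀`, up to isomorphism. -/
def InQ0 (Q : Digraph V) : Prop :=
  Isomorphic Q exc₁ ∨ Isomorphic Q exc₂ ∨ Isomorphic Q exc₃

end Digraphs

/-! ### A word RAM

A machine has registers and random access arrays, all holding natural numbers, and runs a fixed
structured program. A program mentions only finitely many registers and arrays. All the numbers
that occur in a run must be smaller than the word bound `W`; otherwise there is no run.
Every operation takes one unit of time. -/

/-- The word operations; comparisons return `0` or `1`. -/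
inductive Op
  | add | sub | mul | div | mod | lt | eq

/-- `sub` is truncated; `div` and `mod` by zero follow the conventions of `ℕ`. -/
def Op.eval : Op → ℕ → ℕ → ℕ
  | .add, x, y => x + y
  | .sub, x, y => x - y
  | .mul, x, y => x * y
  | .div, x, y => x / y
  | .mod, x, y => x % y
  | .lt, x, y => if x < y then 1 else 0
  | .eq, x, y => if x = y then 1 else 0

/-- A machine state: `reg r` is the content of register `r`, and `arr a i` that of cell `i` of
array `a`. -/
structure State where
  reg : ℕ → ℕ
  arr : ℕ → ℕ → ℕ

def State.setReg (σ : State) (r x : ℕ) : State :=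
  { σ with reg := Function.update σ.reg r x }

def State.setArr (σ : State) (a i x : ℕ) : State :=
  { σ with arr := Function.update σ.arr a (Function.update (σ.arr a) i x) }

/-- Expressions: constants, registers, cells `a[e]` of an array `a`, and operations. -/
inductive Expr
  | const (c : ℕ)
  | reg (r : ℕ)
  | read (a : ℕ) (e : Expr)
  | op (o : Op) (e₁ e₂ : Expr)

def Expr.eval (σ : State) : Expr → ℕ
  | .const c => c
  | .reg r => σ.reg r
  | .read a e => σ.arr a (e.eval σ)
  | .op o e₁ e₂ => o.eval (e₁.eval σ) (e₂.eval σ)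

/-- Time to evaluate an expression: one unit for each node. -/
def Expr.cost : Expr → ℕ
  | .const _ => 1
  | .reg _ => 1
  | .read _ e => e.cost + 1
  | .op _ e₁ e₂ => e₁.cost + e₂.cost + 1

/-- All values (in particular, all addresses) in the evaluation of the expression are below `W`. -/
def Expr.Fits (W : ℕ) (σ : State) : Expr → Prop
  | .const c => c < W
  | .reg r => σ.reg r < W
  | .read a e => e.Fits W σ ∧ σ.arr a (e.eval σ) < W
  | .op o e₁ e₂ => e₁.Fits W σ ∧ e₂.Fits W σ ∧ o.eval (e₁.eval σ) (e₂.eval σ) < W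

inductive Prog
  | skip
  | assign (r : ℕ) (e : Expr)
  | write (a : ℕ) (idx e : Expr)
  | seq (p q : Prog)
  | ite (e : Expr) (p q : Prog)
  | while (e : Expr) (p : Prog)

/-- `Exec W p σ T σ'`: with word bound `W`, the program `p` started in the state `σ` halts in the
state `σ'` after time `T`. A test succeeds when its value is not zero. -/
inductive Exec (W : ℕ) : Prog → State → ℕ → State → Prop
  | skip (σ : State) : Exec W .skip σ 1 σ
  | assign (σ : State) (r : ℕ) (e : Expr) :
      e.Fits W σ → Exec W (.assign r e) σ (e.cost + 1) (σ.setReg r (e.eval σ))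
  | write (σ : State) (a : ℕ) (idx e : Expr) :
      idx.Fits W σ → e.Fits W σ →
      Exec W (.write a idx e) σ (idx.cost + e.cost + 1) (σ.setArr a (idx.eval σ) (e.eval σ))
  | seq {p q : Prog} {σ σ₁ σ₂ : State} {T₁ T₂ : ℕ} :
      Exec W p σ T₁ σ₁ → Exec W q σ₁ T₂ σ₂ → Exec W (.seq p q) σ (T₁ + T₂) σ₂
  | ite_true {e : Expr} {p q : Prog} {σ σ' : State} {T : ℕ} :
      e.Fits W σ → e.eval σ ≠ 0 → Exec W p σ T σ' →
      Exec W (.ite e p q) σ (e.cost + 1 + T) σ'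
  | ite_false {e : Expr} {p q : Prog} {σ σ' : State} {T : ℕ} :
      e.Fits W σ → e.eval σ = 0 → Exec W q σ T σ' →
      Exec W (.ite e p q) σ (e.cost + 1 + T) σ'
  | while_true {e : Expr} {p : Prog} {σ σ₁ σ₂ : State} {T₁ T₂ : ℕ} :
      e.Fits W σ → e.eval σ ≠ 0 → Exec W p σ T₁ σ₁ → Exec W (.while e p) σ₁ T₂ σ₂ →
      Exec W (.while e p) σ (e.cost + 1 + T₁ + T₂) σ₂
  | while_false {e : Expr} {p : Prog} {σ : State} :
      e.Fits W σ → e.eval σ = 0 → Exec W (.while e p) σ (e.cost + 1) σ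

/-! ### Input and output of the packing problem -/

section Encoding

variable {t : ℕ} {n : Fin t → ℕ}

/-- The order of the composition. -/
def order (n : Fin t → ℕ) : ℕ := ∑ i, n i

/-- The vertices of the composition are numbered `0, 1, …` part by part:
`⟨i, a⟩` has the number `n 0 + ⋯ + n (i - 1) + a`. -/
def num (x : Σ i : Fin t, Fin (n i)) : ℕ := (finSigmaFinEquiv x : ℕ)

open Classical in
/-- The input `(D, H, S)`. Register `0` holds `t`, and
* array `0` holds the orders `n i` of the `H i`;
* array `1` holds the adjacency matrix of `D`, row by row;
* array `2` holds the adjacency matrix of the disjoint union of the `H i`, row by row;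
* array `3` holds the indicator of `S`.
All the other registers and cells are zero. -/
noncomputable def input (D : Digraph (Fin t)) (H : ∀ i, Digraph (Fin (n i)))
    (S : Finset (Σ i : Fin t, Fin (n i))) : State where
  reg r := if r = 0 then t else 0
  arr a m :=
    match a with
    | 0 => if h : m < t then n ⟨m, h⟩ else 0
    | 1 => if ∃ i j : Fin t, m = i * t + j ∧ D.Adj i j then 1 else 0
    | 2 => if ∃ (i : Fin t) (a b : Fin (n i)),
              m = num (⟨i, a⟩ : Σ i : Fin t, Fin (n i)) * order n +
                num (⟨i, b⟩ : Σ i : Fin t, Fin (n i)) ∧ (H i).Adj a b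
            then 1 else 0
    | 3 => if ∃ x ∈ S, m = num x then 1 else 0
    | _ => 0

/-- The state lists the subgraphs `F 0, …, F (k - 1)`: array `4` holds the indicators of their
vertex sets, and array `5` their adjacency matrices, one after the other. -/
def Outputs {Q : Digraph (Σ i : Fin t, Fin (n i))} {k : ℕ} (σ : State)
    (F : Fin k → Subdigraph Q) : Prop :=
  ∀ s : Fin k,
    (∀ x, σ.arr 4 (s * order n + num x) = 1 ↔ x ∈ (F s).verts) ∧
    ∀ x y, σ.arr 5 (s * order n ^ 2 + num x * order n + num y) = 1 ↔ (F s).Adj x y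

end Encoding

end StrongPacking

/-!
All subgraphs of the packing are spanning, so that they do not depend on `S`. Let `m` be the least
order of a part `H i`. The first `m` vertices of each part form the core. In the core, the arcs of
the composition between the parts `i` and `j`, for an arc `i → j` of `D`, form a complete bipartite
digraph `K_{m,m}`, which splits into `m` perfect matchings, one for each subgraph (`IsLatin`).

A subgraph is strong on the core as soon as the vertices of one part reach each other, because `D`
is strong and each vertex has a successor and a predecessor in the matching of each arc
(`IsLatin.link_of_part`). If `D` has a closed walk of length two or four of the right kind
(`IsEvenWalk`), then the matchings can be taken as cyclic shifts by `s` and `-s`, alternately along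
the walk, except that one of the latter is increased by `1`; then a tour along the walk shifts by
`1` (`link_evenRule`). The only digraph under consideration without such a walk is the 3-cycle
(`eq_three_of_not_isEvenWalk`). It is trivial for `m = 1`, and there is a separate system of
matchings if `2 < m` (`link_triangleRule`). A vertex outside the core is inserted between vertices
of the core in each subgraph, with different choices for different subgraphs (`LayerAdj`).

For the 3-cycle and `m = 2`, cyclic shifts make one of the two subgraphs connected, and the other
one consists on the core of two components. These are joined in both directions by connectors: an arc
inside a part, or a vertex outside the core, whose two neighbours may be interchanged. A composition
with at least eight vertices has two vertices outside the core; the smaller ones have enough arcs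
inside their parts unless they are isomorphic to one of the exceptional digraphs
(`exists_partArc`). The vertices are relabelled so that these arcs lead in the right directions
(`IsLabelling`), which yields `IsPlan.isPacking`.

For the running time, a language of programs with bounded loops (`LoopProg`) is compiled to the word
RAM. Its programs are total, so that correctness is a matter of evaluating a function, `run`;
`exec_compile` bounds time and word size from syntactic properties of the program. The program
searches an even closed walk among all quadruples of vertices of `D`, which takes time `O(n ^ 4)`,
and then writes the packing, entry by entry.
-/

namespace StrongPacking

open Relation

/-! ### Programs with bounded loops -/

/-- Structured programs in which every loop has a bound fixed on entry. The loop `loop i b e p`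
stores the value of `e` in register `b` and runs `p` with register `i` counting from `0` to that
value. -/
inductive LoopProg
  | skip
  | assign (r : ℕ) (e : Expr)
  | write (a : ℕ) (idx e : Expr)
  | seq (p q : LoopProg)
  | ite (e : Expr) (p q : LoopProg)
  | loop (i b : ℕ) (e : Expr) (p : LoopProg)

/-- The state after `k` rounds of a loop with counter register `i` and body `f`. -/
def State.rounds (f : State → State) (i : ℕ) (σ : State) : ℕ → State
  | 0 => σ.setReg i 0
  | k + 1 => (f (State.rounds f i σ k)).setReg i (k + 1)

namespace LoopProg

/-- The program of the word RAM that a bounded-loop program stands for. -/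
def compile : LoopProg → Prog
  | skip => .skip
  | assign r e => .assign r e
  | write a idx e => .write a idx e
  | seq p q => .seq p.compile q.compile
  | ite e p q => .ite e p.compile q.compile
  | loop i b e p => .seq (.assign b e) (.seq (.assign i (.const 0))
      (.while (.op .lt (.reg i) (.reg b))
        (.seq p.compile (.assign i (.op .add (.reg i) (.const 1))))))

/-- The effect of a program on the state, disregarding time and word size. -/
def run : LoopProg → State → State
  | skip, σ => σ
  | assign r e, σ => σ.setReg r (e.eval σ)
  | write a idx e, σ => σ.setArr a (idx.eval σ) (e.eval σ)
  | seq p q, σ => q.run (p.run σ)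
  | ite e p q, σ => if e.eval σ ≠ 0 then p.run σ else q.run σ
  | loop i b e p, σ => (σ.setReg b (e.eval σ)).rounds p.run i (e.eval σ)

/-- The registers a program may change. -/
def assigns : LoopProg → List ℕ
  | skip => []
  | assign r _ => [r]
  | write _ _ _ => []
  | seq p q => p.assigns ++ q.assigns
  | ite _ p q => p.assigns ++ q.assigns
  | loop i b _ p => i :: b :: p.assigns

/-- The arrays a program may change. -/
def writes : LoopProg → List ℕ
  | skip => []
  | assign _ _ => []
  | write a _ _ => [a]
  | seq p q => p.writes ++ q.writes
  | ite _ p q => p.writes ++ q.writes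
  | loop _ _ _ p => p.writes

end LoopProg

@[simp] theorem State.setReg_reg (σ : State) (r x r' : ℕ) :
    (σ.setReg r x).reg r' = if r' = r then x else σ.reg r' := by
  simp [State.setReg, Function.update_apply]

@[simp] theorem State.setReg_arr (σ : State) (r x : ℕ) : (σ.setReg r x).arr = σ.arr := rfl

@[simp] theorem State.setArr_reg (σ : State) (a i x : ℕ) : (σ.setArr a i x).reg = σ.reg := rfl

@[simp] theorem State.setArr_arr (σ : State) (a i x a' i' : ℕ) :
    (σ.setArr a i x).arr a' i' = if a' = a ∧ i' = i then x else σ.arr a' i' := by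
  by_cases h : a' = a
  · subst h
    simp [State.setArr, Function.update_apply]
  · simp [State.setArr, h]

namespace LoopProg

theorem run_reg_of_notMem (p : LoopProg) (r : ℕ) (h : r ∉ p.assigns) (σ : State) :
    (p.run σ).reg r = σ.reg r := by
  induction p generalizing σ with
  | skip => rfl
  | assign r' e => simp_all [assigns, run]
  | write a idx e => simp [run]
  | seq p q hp hq => simp_all [assigns, run]
  | ite e p q hp hq => simp only [run]; split_ifs <;> simp_all [assigns]
  | loop i b e p hp =>
    simp only [assigns, List.mem_cons, not_or] at h
    have : ∀ k, ((σ.setReg b (e.eval σ)).rounds p.run i k).reg r = σ.reg r := by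
      intro k
      induction k with
      | zero => simp [State.rounds, h]
      | succ k ih => simp [State.rounds, h, hp h.2.2, ih]
    exact this _

theorem run_arr_of_notMem (p : LoopProg) (a : ℕ) (h : a ∉ p.writes) (σ : State) :
    (p.run σ).arr a = σ.arr a := by
  induction p generalizing σ with
  | skip => rfl
  | assign r' e => simp [run]
  | write a idx e =>
    funext i
    simp_all [writes, run]
  | seq p q hp hq => simp_all [writes, run]
  | ite e p q hp hq => simp only [run]; split_ifs <;> simp_all [writes]
  | loop i b e p hp =>
    have : ∀ k, ((σ.setReg b (e.eval σ)).rounds p.run i k).arr a = σ.arr a := by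
      intro k
      induction k with
      | zero => simp [State.rounds]
      | succ k ih => simp [State.rounds, hp h, ih]
    exact this _

/-- Loop invariants: `P k` holds after `k` rounds. In each round, the registers and arrays that the
loop does not change have their initial contents. -/
theorem run_loop_induct {i b : ℕ} {e : Expr} {p : LoopProg} {σ : State} (P : ℕ → State → Prop)
    (h0 : P 0 ((σ.setReg b (e.eval σ)).setReg i 0))
    (hs : ∀ k τ, k < e.eval σ → τ.reg i = k → (∀ r ∉ (loop i b e p).assigns, τ.reg r = σ.reg r) →
      (∀ a ∉ p.writes, τ.arr a = σ.arr a) → P k τ → P (k + 1) ((p.run τ).setReg i (k + 1))) :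
    P (e.eval σ) ((loop i b e p).run σ) := by
  have : ∀ k, k ≤ e.eval σ → P k ((σ.setReg b (e.eval σ)).rounds p.run i k) ∧
      ((σ.setReg b (e.eval σ)).rounds p.run i k).reg i = k ∧
      (∀ r ∉ (loop i b e p).assigns,
        ((σ.setReg b (e.eval σ)).rounds p.run i k).reg r = σ.reg r) ∧
      ∀ a ∉ p.writes, ((σ.setReg b (e.eval σ)).rounds p.run i k).arr a = σ.arr a := by
    intro k
    induction k with
    | zero =>
      refine fun _ => ⟨h0, by simp [State.rounds], fun r hr => ?_, fun _ _ => rfl⟩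
      simp only [assigns, List.mem_cons, not_or] at hr
      simp [State.rounds, hr]
    | succ k ih =>
      intro hk
      obtain ⟨h1, h2, h3, h4⟩ := ih (by omega)
      refine ⟨hs k _ (by omega) h2 h3 h4 h1, by simp [State.rounds], fun r hr => ?_, fun a ha => ?_⟩
      · have hr' := hr
        simp only [assigns, List.mem_cons, not_or] at hr'
        simp [State.rounds, hr', run_reg_of_notMem p r hr'.2.2, h3 r hr]
      · simp [State.rounds, run_arr_of_notMem p a ha, h4 a ha]
  exact (this _ le_rfl).1

end LoopProg

/-! ### Time and word size of programs with bounded loops -/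

/-- The value of the expression is at most the power with this exponent of the largest number in the
state, by `Expr.eval_le`. -/
def Expr.weight : Expr → ℕ
  | .const c => c + 1
  | .reg _ => 1
  | .read _ e => e.weight + 1
  | .op _ e₁ e₂ => e₁.weight + e₂.weight + 1

/-- All the numbers in the state are at most `M`. -/
def State.Bounded (M : ℕ) (σ : State) : Prop := (∀ r, σ.reg r ≤ M) ∧ ∀ a i, σ.arr a i ≤ M

theorem State.Bounded.mono {M M' : ℕ} {σ : State} (h : σ.Bounded M) (hM : M ≤ M') :
    σ.Bounded M' :=
  ⟨fun r => (h.1 r).trans hM, fun a i => (h.2 a i).trans hM⟩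

theorem State.Bounded.setReg {M : ℕ} {σ : State} (h : σ.Bounded M) (r : ℕ) {x : ℕ} (hx : x ≤ M) :
    (σ.setReg r x).Bounded M := by
  refine ⟨fun r' => ?_, h.2⟩
  rw [State.setReg_reg]
  split_ifs
  exacts [hx, h.1 _]

theorem State.Bounded.setArr {M : ℕ} {σ : State} (h : σ.Bounded M) (a i : ℕ) {x : ℕ} (hx : x ≤ M) :
    (σ.setArr a i x).Bounded M := by
  refine ⟨h.1, fun a' i' => ?_⟩
  rw [State.setArr_arr]
  split_ifs
  exacts [hx, h.2 _ _]

theorem Op.eval_le {B a b x y : ℕ} (hB : 2 ≤ B) (o : Op) (hx : x ≤ B ^ a) (hy : y ≤ B ^ b) :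
    o.eval x y ≤ B ^ (a + b + 1) := by
  have ha : 1 ≤ B ^ a := Nat.one_le_pow _ _ (by omega)
  have hb : 1 ≤ B ^ b := Nat.one_le_pow _ _ (by omega)
  have hab : B ^ a * B ^ b * 2 ≤ B ^ (a + b + 1) := by
    rw [pow_succ, pow_add]
    exact Nat.mul_le_mul_left _ hB
  have h1 : B ^ a ≤ B ^ a * B ^ b := Nat.le_mul_of_pos_right _ hb
  have h2 : B ^ b ≤ B ^ a * B ^ b := Nat.le_mul_of_pos_left _ ha
  have h3 : x * y ≤ B ^ a * B ^ b := Nat.mul_le_mul hx hy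
  have h4 : x / y ≤ x := Nat.div_le_self _ _
  have h5 : x % y ≤ x := Nat.mod_le _ _
  cases o <;> simp only [Op.eval] <;> try split_ifs
  all_goals omega

theorem Expr.eval_le {M B : ℕ} {σ : State} (h : σ.Bounded M) (hMB : M ≤ B) (hB : 2 ≤ B)
    (e : Expr) : e.eval σ ≤ B ^ e.weight := by
  induction e with
  | const c =>
    have : c < 2 ^ c := Nat.lt_two_pow_self
    have h2 : 2 ^ c ≤ B ^ c := Nat.pow_le_pow_left hB c
    have h3 : B ^ c ≤ B ^ (c + 1) := Nat.pow_le_pow_right (by omega) (by omega)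
    simp only [Expr.eval, Expr.weight]
    omega
  | reg r => simpa [Expr.eval, Expr.weight] using (h.1 r).trans hMB
  | read a e ih =>
    have : B ^ 1 ≤ B ^ (e.weight + 1) := Nat.pow_le_pow_right (by omega) (by omega)
    have h2 := h.2 a (e.eval σ)
    rw [pow_one] at this
    simp only [Expr.eval, Expr.weight]
    omega
  | op o e₁ e₂ h₁ h₂ => exact o.eval_le hB h₁ h₂

theorem Expr.fits {M B W : ℕ} {σ : State} (h : σ.Bounded M) (hMB : M ≤ B) (hB : 2 ≤ B)
    (e : Expr) (hW : B ^ e.weight < W) : e.Fits W σ := by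
  induction e with
  | const c => exact (Expr.eval_le h hMB hB (.const c)).trans_lt hW
  | reg r => exact (Expr.eval_le h hMB hB (.reg r)).trans_lt hW
  | read a e ih =>
    exact ⟨ih (lt_of_le_of_lt (Nat.pow_le_pow_right (by omega) (by simp [Expr.weight])) hW),
      (Expr.eval_le h hMB hB (.read a e)).trans_lt hW⟩
  | op o e₁ e₂ h₁ h₂ =>
    exact ⟨h₁ (lt_of_le_of_lt (Nat.pow_le_pow_right (by omega) (by simp [Expr.weight]; omega)) hW),
      h₂ (lt_of_le_of_lt (Nat.pow_le_pow_right (by omega) (by simp [Expr.weight]; omega)) hW),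
      (Expr.eval_le h hMB hB (.op o e₁ e₂)).trans_lt hW⟩

/-- A syntactic condition on an expression which ensures that its value does not exceed the largest
number in the state (and `2`). -/
def Expr.tame : Expr → Bool
  | .const c => Nat.ble c 2
  | .reg _ => true
  | .read _ _ => true
  | .op .sub e _ => e.tame
  | .op .div e _ => e.tame
  | .op .mod e _ => e.tame
  | .op .lt _ _ => true
  | .op .eq _ _ => true
  | .op .add _ _ => false
  | .op .mul _ _ => false

/-- Expressions that may be stored: tame ones, and those that count up. -/
def Expr.storable : Expr → Bool
  | .op .add (.reg _) (.const 1) => true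
  | e => e.tame

theorem Expr.eval_le_of_tame {M : ℕ} {σ : State} (h : σ.Bounded M) (hM : 2 ≤ M) (e : Expr)
    (he : e.tame) : e.eval σ ≤ M := by
  induction e with
  | const c => exact (Nat.le_of_ble_eq_true he).trans hM
  | reg r => exact h.1 r
  | read a e ih => exact h.2 _ _
  | op o e₁ e₂ h₁ h₂ =>
    cases o <;> simp only [Expr.tame, Bool.false_eq_true] at he <;> simp only [Expr.eval, Op.eval]
    · exact (Nat.sub_le _ _).trans (h₁ he)
    · exact (Nat.div_le_self _ _).trans (h₁ he)
    · exact (Nat.mod_le _ _).trans (h₁ he)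
    · split_ifs <;> omega
    · split_ifs <;> omega

theorem Expr.eval_le_of_storable {M : ℕ} {σ : State} (h : σ.Bounded M) (hM : 2 ≤ M) (e : Expr)
    (he : e.storable) : e.eval σ ≤ M + 1 := by
  unfold Expr.storable at he
  split at he
  · rename_i r
    simpa [Expr.eval, Op.eval] using h.1 r
  · exact (e.eval_le_of_tame h hM he).trans (Nat.le_succ _)

/-- Loop bounds: products of registers in `R` and cells of array `0`. -/
def Expr.isBound (R : List ℕ) : Expr → Bool
  | .reg r => R.contains r
  | .read 0 _ => true
  | .op .mul e₁ e₂ => e₁.isBound R && e₂.isBound R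
  | _ => false

/-- The number of factors of a loop bound. -/
def Expr.degree : Expr → ℕ
  | .op .mul e₁ e₂ => e₁.degree + e₂.degree
  | _ => 1

theorem Expr.eval_le_of_isBound {R : List ℕ} {N : ℕ} {σ : State} (hR : ∀ r ∈ R, σ.reg r ≤ N)
    (h0 : ∀ i, σ.arr 0 i ≤ N) (e : Expr) (he : e.isBound R) : e.eval σ ≤ N ^ e.degree := by
  induction e with
  | const c => simp [Expr.isBound] at he
  | reg r => simpa [Expr.eval, Expr.degree] using hR r (by simpa [Expr.isBound] using he)
  | read a e ih =>
    cases a with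
    | zero => simpa [Expr.eval, Expr.degree] using h0 _
    | succ a => simp [Expr.isBound] at he
  | op o e₁ e₂ h₁ h₂ =>
    cases o <;> simp only [Expr.isBound, Bool.false_eq_true, Bool.and_eq_true] at he
    simp only [Expr.eval, Op.eval, Expr.degree, pow_add]
    exact Nat.mul_le_mul (h₁ he.1) (h₂ he.2)

namespace LoopProg

/-- Syntactic conditions for the analysis of time and word size: only storable values are stored,
loop bounds are built from the registers in `R` and array `0`, and loop bodies do not change the
counter and the bound. -/
def wellFormed (R : List ℕ) : LoopProg → Bool
  | skip => true
  | assign _ e => e.storable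
  | write _ _ e => e.storable
  | seq p q => p.wellFormed R && q.wellFormed R
  | ite _ p q => p.wellFormed R && q.wellFormed R
  | loop i b e p => e.isBound R && p.wellFormed R && !p.assigns.contains i &&
      !p.assigns.contains b && !(i == b)

/-- A bound for the running time if all loop bounds are products of numbers up to `N`. -/
def time (N : ℕ) : LoopProg → ℕ
  | skip => 1
  | assign _ e => e.cost + 1
  | write _ idx e => idx.cost + e.cost + 1
  | seq p q => p.time N + q.time N
  | ite e p q => e.cost + 1 + (p.time N + q.time N)
  | loop _ _ e p => e.cost + 7 + N ^ e.degree * (p.time N + 9)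

/-- The nesting depth of loops, a loop counting as often as its bound has factors. -/
def depth : LoopProg → ℕ
  | skip => 0
  | assign _ _ => 0
  | write _ _ _ => 0
  | seq p q => max p.depth q.depth
  | ite _ p q => max p.depth q.depth
  | loop _ _ e p => e.degree + p.depth

/-- The sum of the weights of the expressions of a program. -/
def weight : LoopProg → ℕ
  | skip => 0
  | assign _ e => e.weight
  | write _ idx e => idx.weight + e.weight
  | seq p q => p.weight + q.weight
  | ite e p q => e.weight + (p.weight + q.weight)
  | loop _ _ e p => e.weight + (p.weight + 4)

theorem time_le {N : ℕ} (hN : 1 ≤ N) (p : LoopProg) : p.time N ≤ p.time 1 * N ^ p.depth := by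
  have key : ∀ a b c : ℕ, a ≤ b → c * N ^ a ≤ c * N ^ b := fun a b c h =>
    Nat.mul_le_mul_left _ (Nat.pow_le_pow_right hN h)
  have one : ∀ a : ℕ, 1 ≤ N ^ a := fun a => Nat.one_le_pow _ _ hN
  induction p with
  | skip => simp [time, depth]
  | assign r e => simp [time, depth]
  | write a idx e => simp [time, depth]
  | seq p q hp hq =>
    simp only [time, depth, add_mul]
    exact Nat.add_le_add (hp.trans (key _ _ _ (le_max_left _ _)))
      (hq.trans (key _ _ _ (le_max_right _ _)))
  | ite e p q hp hq =>
    simp only [time, depth, add_mul _ _ (N ^ _)]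
    have h1 := hp.trans (key _ (max p.depth q.depth) _ (le_max_left _ _))
    have h2 := hq.trans (key _ (max p.depth q.depth) _ (le_max_right _ _))
    have h3 := Nat.mul_le_mul_left (e.cost) (one (max p.depth q.depth))
    have h4 := one (max p.depth q.depth)
    omega
  | loop i b e p hp =>
    simp only [time, depth, one_pow, one_mul]
    have h1 : N ^ e.degree * (p.time N + 9) ≤ (p.time 1 + 9) * N ^ (e.degree + p.depth) := by
      rw [pow_add, mul_comm (p.time 1 + 9), mul_assoc]
      refine Nat.mul_le_mul_left _ ?_
      have := one p.depth
      nlinarith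
    have h2 := Nat.mul_le_mul_left (e.cost + 7) (one (e.degree + p.depth))
    rw [add_mul]
    omega

/-- A well-formed program runs within its time bound, provided that the words can hold numbers that
exceed those of the initial state polynomially; each step enlarges the largest number by at most
one, apart from loop counters. -/
theorem exec_compile {R : List ℕ} {N W : ℕ} (hN : 2 ≤ N) (p : LoopProg) :
    ∀ (M : ℕ) (σ : State), p.wellFormed R → (∀ r ∈ R, r ∉ p.assigns) → 0 ∉ p.writes →
      (∀ r ∈ R, σ.reg r ≤ N) → (∀ i, σ.arr 0 i ≤ N) → σ.Bounded M → N ^ p.depth ≤ M → 2 ≤ M →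
      (M + p.time N) ^ p.weight < W →
      ∃ T ≤ p.time N, Exec W p.compile σ T (p.run σ) ∧ (p.run σ).Bounded (M + p.time N) := by
  have pw : ∀ {B a b : ℕ}, 2 ≤ B → a ≤ b → B ^ b < W → B ^ a < W := fun hB hab h =>
    (Nat.pow_le_pow_right (by omega) hab).trans_lt h
  have pl : ∀ {B B' a : ℕ}, B ≤ B' → B' ^ a < W → B ^ a < W := fun hB h =>
    (Nat.pow_le_pow_left hB _).trans_lt h
  induction p with
  | skip =>
    intro M σ _ _ _ _ _ hb _ _ _
    exact ⟨1, le_rfl, .skip σ, hb.mono (by omega)⟩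
  | assign r e =>
    intro M σ hwf _ _ _ _ hb _ h2 hW
    refine ⟨_, le_rfl, .assign σ r e (e.fits hb (Nat.le_add_right _ _) (by omega) hW), ?_⟩
    exact (hb.mono (Nat.le_add_right _ _)).setReg _
      ((e.eval_le_of_storable hb h2 hwf).trans (by simp only [time]; omega))
  | write a idx e =>
    intro M σ hwf _ _ _ _ hb _ h2 hW
    refine ⟨_, le_rfl, .write σ a idx e
      (idx.fits hb (Nat.le_add_right _ _) (by omega) (pw (by omega) (Nat.le_add_right _ _) hW))
      (e.fits hb (Nat.le_add_right _ _) (by omega) (pw (by omega) (Nat.le_add_left _ _) hW)), ?_⟩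
    exact (hb.mono (Nat.le_add_right _ _)).setArr _ _
      ((e.eval_le_of_storable hb h2 hwf).trans (by simp only [time]; omega))
  | seq p q hp hq =>
    intro M σ hwf hR h0 hr ha hb hM h2 hW
    simp only [wellFormed, Bool.and_eq_true] at hwf
    simp only [assigns, List.mem_append, not_or] at hR
    simp only [writes, List.mem_append, not_or] at h0
    simp only [depth] at hM
    simp only [time, weight] at hW ⊢
    obtain ⟨T₁, hT₁, e₁, b₁⟩ := hp M σ hwf.1 (fun r h => (hR r h).1) h0.1 hr ha hb
      ((Nat.pow_le_pow_right (by omega) (le_max_left _ _)).trans hM) h2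
      (pl (by omega) (pw (by omega) (Nat.le_add_right _ _) hW))
    obtain ⟨T₂, hT₂, e₂, b₂⟩ := hq (M + p.time N) (p.run σ) hwf.2 (fun r h => (hR r h).2) h0.2
      (fun r h => by rw [run_reg_of_notMem p r (hR r h).1]; exact hr r h)
      (fun i => by rw [run_arr_of_notMem p 0 h0.1]; exact ha i) b₁
      (((Nat.pow_le_pow_right (by omega) (le_max_right _ _)).trans hM).trans (by omega)) (by omega)
      (pl (by omega) (pw (by omega) (Nat.le_add_left _ _) hW))
    exact ⟨T₁ + T₂, by omega, .seq e₁ e₂, b₂.mono (by omega)⟩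
  | ite e p q hp hq =>
    intro M σ hwf hR h0 hr ha hb hM h2 hW
    simp only [wellFormed, Bool.and_eq_true] at hwf
    simp only [assigns, List.mem_append, not_or] at hR
    simp only [writes, List.mem_append, not_or] at h0
    simp only [depth] at hM
    simp only [time, weight] at hW ⊢
    have hf : e.Fits W σ := e.fits hb (Nat.le_add_right _ _) (by omega)
      (pw (by omega) (Nat.le_add_right _ _) hW)
    by_cases he : e.eval σ = 0
    · obtain ⟨T₂, hT₂, e₂, b₂⟩ := hq M σ hwf.2 (fun r h => (hR r h).2) h0.2 hr ha hb
        ((Nat.pow_le_pow_right (by omega) (le_max_right _ _)).trans hM) h2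
        (pl (by omega) (pw (by omega) (by omega) hW))
      have : (ite e p q).run σ = q.run σ := by simp [run, he]
      rw [this]
      exact ⟨_, by omega, .ite_false hf he e₂, b₂.mono (by omega)⟩
    · obtain ⟨T₁, hT₁, e₁, b₁⟩ := hp M σ hwf.1 (fun r h => (hR r h).1) h0.1 hr ha hb
        ((Nat.pow_le_pow_right (by omega) (le_max_left _ _)).trans hM) h2
        (pl (by omega) (pw (by omega) (by omega) hW))
      have : (ite e p q).run σ = p.run σ := by simp [run, he]
      rw [this]
      exact ⟨_, by omega, .ite_true hf he e₁, b₁.mono (by omega)⟩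
  | loop i b e p hp =>
    intro M σ hwf hR h0 hr ha hb hM h2 hW
    simp only [wellFormed, Bool.and_eq_true, Bool.not_eq_true', List.contains_eq_mem,
      decide_eq_false_iff_not, beq_eq_false_iff_ne] at hwf
    obtain ⟨⟨⟨⟨hbd, hwf⟩, hi⟩, hbb⟩, hib⟩ := hwf
    simp only [assigns, List.mem_cons, not_or] at hR
    simp only [writes] at h0
    simp only [depth] at hM
    simp only [time, weight] at hW ⊢
    have hn := e.eval_le_of_isBound hr ha hbd
    set n := e.eval σ with hn_def
    set σ₀ := σ.setReg b n with hσ₀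
    have hNp : ∀ a, 1 ≤ N ^ a := fun a => Nat.one_le_pow _ _ (by omega)
    have hdM : N ^ e.degree ≤ M :=
      (Nat.pow_le_pow_right (by omega) (Nat.le_add_right _ _)).trans hM
    have hpM : N ^ p.depth ≤ M :=
      (Nat.pow_le_pow_right (by omega) (Nat.le_add_left _ _)).trans hM
    have hnt : ∀ k, k ≤ n → k * p.time N + k * 9 ≤ N ^ e.degree * (p.time N + 9) := by
      intro k hk
      rw [← mul_add]
      exact Nat.mul_le_mul_right _ (hk.trans hn)
    have hB₀ : σ₀.Bounded M := hb.setReg _ (hn.trans hdM)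
    -- one round of the loop
    have hround : ∀ k, k < n → (σ₀.rounds p.run i k).Bounded (M + k * p.time N) →
        ∃ T ≤ p.time N, Exec W p.compile (σ₀.rounds p.run i k) T (p.run (σ₀.rounds p.run i k)) ∧
          (p.run (σ₀.rounds p.run i k)).Bounded (M + (k + 1) * p.time N) := by
      intro k hk hbk
      have hregs : ∀ k, (∀ r ∈ R, (σ₀.rounds p.run i k).reg r = σ.reg r) ∧
          (σ₀.rounds p.run i k).arr 0 = σ.arr 0 := by
        intro k
        induction k with
        | zero =>
          exact ⟨fun r h => by simp [State.rounds, hσ₀, hR r h], by simp [State.rounds, hσ₀]⟩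
        | succ k ih =>
          refine ⟨fun r h => ?_, ?_⟩
          · simp [State.rounds, hR r h, run_reg_of_notMem p r (hR r h).2.2, ih.1 r h]
          · simp [State.rounds, run_arr_of_notMem p 0 h0, ih.2]
      have hle := hnt (k + 1) hk
      have he : (k + 1) * p.time N = k * p.time N + p.time N := by ring
      obtain ⟨T, hT, h1, h3⟩ := hp (M + k * p.time N) _ hwf (fun r h => (hR r h).2.2) h0
        (fun r h => by rw [(hregs k).1 r h]; exact hr r h)
        (fun j => by rw [(hregs k).2]; exact ha j) hbk (hpM.trans (by omega)) (by omega)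
        (pl (B' := M + (e.cost + 7 + N ^ e.degree * (p.time N + 9))) (by omega)
          (pw (by omega) (by omega) hW))
      exact ⟨T, hT, h1, h3.mono (by omega)⟩
    have hbound : ∀ k, k ≤ n → (σ₀.rounds p.run i k).Bounded (M + k * p.time N) := by
      intro k
      induction k with
      | zero => exact fun _ => (hB₀.setReg _ (by omega)).mono (by omega)
      | succ k ih =>
        intro hk
        obtain ⟨_, _, _, h3⟩ := hround k (by omega) (ih (by omega))
        exact h3.setReg _ (by omega)
    have hreg : ∀ k, (σ₀.rounds p.run i k).reg i = k ∧ (σ₀.rounds p.run i k).reg b = n := by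
      intro k
      induction k with
      | zero => simp [State.rounds, hσ₀, Ne.symm hib]
      | succ k ih => simp [State.rounds, Ne.symm hib, run_reg_of_notMem p b hbb, ih.2]
    have hBtot : ∀ k, k ≤ n → (σ₀.rounds p.run i k).Bounded
        (M + (e.cost + 7 + N ^ e.degree * (p.time N + 9))) := fun k hk =>
      (hbound k hk).mono (by have := hnt k hk; omega)
    have hwhile : ∀ j k, k + j = n → ∃ T ≤ j * (p.time N + 8) + 4,
        Exec W (.while (.op .lt (.reg i) (.reg b))
          (.seq p.compile (.assign i (.op .add (.reg i) (.const 1)))))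
          (σ₀.rounds p.run i k) T (σ₀.rounds p.run i n) := by
      intro j
      induction j with
      | zero =>
        intro k hk
        rw [show k = n by omega]
        refine ⟨4, by omega, .while_false (Expr.fits (hBtot n le_rfl) le_rfl (by omega) _
          (pw (by omega) ?_ hW)) ?_⟩
        · simp only [Expr.weight]; omega
        · simp [Expr.eval, Op.eval, hreg]
      | succ j ih =>
        intro k hk
        obtain ⟨T', hT', h'⟩ := ih (k + 1) (by omega)
        obtain ⟨T, hT, h1, h3⟩ := hround k (by omega) (hbound k (by omega))
        have hinc : Exec W (.assign i (.op .add (.reg i) (.const 1)))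
            (p.run (σ₀.rounds p.run i k)) 4 (σ₀.rounds p.run i (k + 1)) := by
          have hx : Expr.Fits W (p.run (σ₀.rounds p.run i k)) (.op .add (.reg i) (.const 1)) := by
            refine Expr.fits (h3.mono ?_) le_rfl (by omega) _ (pw (by omega) ?_ hW)
            · have := hnt (k + 1) (by omega)
              omega
            · simp only [Expr.weight]; omega
          have := Exec.assign (p.run (σ₀.rounds p.run i k)) i _ hx
          simpa [Expr.eval, Op.eval, Expr.cost, State.rounds, run_reg_of_notMem p i hi, hreg]
            using this
        refine ⟨_, ?_, .while_true (Expr.fits (hBtot k (by omega)) le_rfl (by omega) _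
          (pw (by omega) ?_ hW)) ?_ (.seq h1 hinc) h'⟩
        · simp only [Expr.cost]
          rw [add_mul]
          omega
        · simp only [Expr.weight]; omega
        · simp [Expr.eval, Op.eval, hreg]; omega
    obtain ⟨T, hT, hw⟩ := hwhile n 0 (by omega)
    have e₁ : Exec W (.assign b e) σ (e.cost + 1) σ₀ :=
      .assign σ b e (e.fits hb (Nat.le_add_right _ (e.cost + 7 + N ^ e.degree * (p.time N + 9)))
        (by omega) (pw (by omega) (by omega) hW))
    have e₂ : Exec W (.assign i (.const 0)) σ₀ 2 (σ₀.rounds p.run i 0) :=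
      .assign σ₀ i (.const 0) (Expr.fits hB₀ (Nat.le_add_right _
        (e.cost + 7 + N ^ e.degree * (p.time N + 9))) (by omega) _
        (pw (by omega) (by simp only [Expr.weight]; omega) hW))
    refine ⟨_, ?_, .seq e₁ (.seq e₂ hw), hBtot n le_rfl⟩
    have := hnt n le_rfl
    rw [mul_add] at hT
    omega

end LoopProg

/-! ### Closed walks of even length in strong semicomplete digraphs -/

section EvenWalk

universe u
variable {V : Type u} {D : Digraph V}

/-- Either `w → p → w` is a closed walk and `q = r = w`, or `p → q → r → w → p` is a closed walk
and `q ≠ w`. -/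
def IsEvenWalk (D : Digraph V) (p q r w : V) : Prop :=
  D.Adj w p ∧ D.Adj p q ∧ ((q = r ∧ r = w) ∨ (q ≠ w ∧ D.Adj q r ∧ D.Adj r w))

theorem Strong.eq_univ_of_closed (hD : Strong D) (A : Set V) {x : V} (hx : x ∈ A)
    (hA : ∀ a b, a ∈ A → D.Adj a b → b ∈ A) (y : V) : y ∈ A := by
  induction hD x y with
  | refl => exact hx
  | tail _ h ih => exact hA _ _ ih h

theorem Strong.exists_out [Nontrivial V] (hD : Strong D) (x : V) : ∃ y, D.Adj x y := by
  by_contra! h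
  obtain ⟨y, hy⟩ := exists_ne x
  exact hy (hD.eq_univ_of_closed {x} rfl (fun a b ha hab => by
    rw [Set.mem_singleton_iff] at ha
    exact absurd (ha ▸ hab) (h b)) y)

theorem Strong.exists_in [Nontrivial V] (hD : Strong D) (y : V) : ∃ x, D.Adj x y := by
  by_contra! h
  obtain ⟨x, hx⟩ := exists_ne y
  exact (hD.eq_univ_of_closed {z | z ≠ y} hx (fun a b _ hab hb => h a (hb ▸ hab)) y) rfl

/-- In a strong semicomplete digraph without opposite arcs, every vertex lies on a 3-cycle. -/
theorem Strong.exists_triangle [Nontrivial V] (hD : Strong D) (hs : Semicomplete D)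
    (h2 : ∀ x y, D.Adj x y → ¬ D.Adj y x) (x : V) :
    ∃ y z, D.Adj x y ∧ D.Adj y z ∧ D.Adj z x := by
  by_contra! h
  obtain ⟨y, hy⟩ := hD.exists_out x
  have := hD.eq_univ_of_closed {z | D.Adj x z} hy (fun a b ha hab => by
    have hb := h a b ha hab
    rcases eq_or_ne x b with rfl | hne
    · exact absurd hab (h2 _ _ ha)
    · exact (hs x b hne).resolve_right hb) x
  exact h2 x x this this

/-- If each vertex outside a 3-cycle `x → y → z → x` dominates it or is dominated by it, then
strong connectivity yields an arc from a dominated vertex to a dominating one, and thus a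
4-cycle. -/
theorem exists_isEvenWalk_of_four {x y z w : V} (hD : Strong D) (hs : Semicomplete D)
    (h2 : ∀ x y, D.Adj x y → ¬ D.Adj y x) (hxy : D.Adj x y) (hyz : D.Adj y z) (hzx : D.Adj z x)
    (hwx : w ≠ x) (hwy : w ≠ y) (hwz : w ≠ z) : ∃ p q r w : V, IsEvenWalk D p q r w := by
  by_contra! h
  have hne : ∀ {a b}, D.Adj a b → a ≠ b := fun {a b} hab e => by subst e; exact h2 _ _ hab hab
  -- no vertex can be inserted into a 3-cycle
  have hins : ∀ {x y z w}, D.Adj x y → D.Adj y z → D.Adj z x → w ≠ y → D.Adj x w → D.Adj y w := by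
    intro x y z w hxy hyz hzx hwy hxw
    refine (hs y w hwy.symm).resolve_right fun hwy' => ?_
    exact h x w y z ⟨hzx, hxw, .inr ⟨fun e => h2 _ _ hzx (e ▸ hxw), hwy', hyz⟩⟩
  have hall : ∀ v, v ≠ x → v ≠ y → v ≠ z →
      (D.Adj x v ∧ D.Adj y v ∧ D.Adj z v) ∨ (D.Adj v x ∧ D.Adj v y ∧ D.Adj v z) := by
    intro v hx hy hz
    have h1 := @hins x y z v hxy hyz hzx hy
    have h3 := @hins y z x v hyz hzx hxy hz
    have h4 := @hins z x y v hzx hxy hyz hx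
    have := hs x v hx.symm
    have := hs y v hy.symm
    have := hs z v hz.symm
    tauto
  -- no arc leads from a dominated vertex to a dominating one
  have hcross : ∀ a b, a ≠ z → D.Adj x b → D.Adj b a → D.Adj a z → False := by
    intro a b _ hxb hba haz
    exact h x b a z ⟨hzx, hxb, .inr ⟨fun e => h2 _ _ hzx (e ▸ hxb), hba, haz⟩⟩
  by_cases hB : ∃ b, b ≠ x ∧ b ≠ y ∧ b ≠ z ∧ D.Adj x b
  · obtain ⟨b, hbx, hby, hbz, hxb⟩ := hB
    have := hD.eq_univ_of_closed {v | v ≠ x ∧ v ≠ y ∧ v ≠ z ∧ D.Adj x v} ⟨hbx, hby, hbz, hxb⟩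
      (fun a c ⟨hax, hay, haz, hxa⟩ hac => by
        have hdom := (hall a hax hay haz).resolve_right fun h' => h2 _ _ hxa h'.1
        have hcx : c ≠ x := fun e => h2 _ _ hac (e ▸ hdom.1)
        have hcy : c ≠ y := fun e => h2 _ _ hac (e ▸ hdom.2.1)
        have hcz : c ≠ z := fun e => h2 _ _ hac (e ▸ hdom.2.2)
        refine ⟨hcx, hcy, hcz, ?_⟩
        rcases hall c hcx hcy hcz with h' | h'
        · exact h'.1
        · exact (hcross c a hcz hxa hac h'.2.2).elim) x
    exact this.1 rfl
  · push Not at hB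
    have := hD.eq_univ_of_closed {v | v = x ∨ v = y ∨ v = z} (Or.inl rfl)
      (fun a c ha hac => by
        by_contra hc
        simp only [Set.mem_ofPred_eq, not_or] at hc
        rcases hall c hc.1 hc.2.1 hc.2.2 with h' | h'
        · exact hB c hc.1 hc.2.1 hc.2.2 h'.1
        · rcases ha with rfl | rfl | rfl
          · exact h2 _ _ hac h'.1
          · exact h2 _ _ hac h'.2.1
          · exact h2 _ _ hac h'.2.2) w
    simp only [Set.mem_ofPred_eq] at this
    tauto

end EvenWalk

/-- Among the digraphs of the theorem, only the 3-cycle has no even closed walk of the kind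
considered. -/
theorem eq_three_of_not_isEvenWalk {t : ℕ} {D : Digraph (Fin t)} (ht : 2 ≤ t) (hD : Strong D)
    (h : Symmetric D ∨ Semicomplete D) (hw : ∀ p q r w, ¬ IsEvenWalk D p q r w) :
    t = 3 ∧ (∀ x y, D.Adj x y → ¬ D.Adj y x) ∧ Semicomplete D := by
  have : Nontrivial (Fin t) := Fin.nontrivial_iff_two_le.mpr ht
  have h2 : ∀ x y, D.Adj x y → ¬ D.Adj y x := fun x y h h' => hw y x x x ⟨h, h', .inl ⟨rfl, rfl⟩⟩
  have hs : Semicomplete D := by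
    rcases h with h | h
    · obtain ⟨y, hy⟩ := hD.exists_out ⟨0, by omega⟩
      exact absurd (h _ _ hy) (h2 _ _ hy)
    · exact h
  refine ⟨?_, h2, hs⟩
  obtain ⟨y, z, hxy, hyz, hzx⟩ := hD.exists_triangle hs h2 ⟨0, by omega⟩
  have hne : ∀ {a b}, D.Adj a b → a ≠ b := fun {a b} hab e => by subst e; exact h2 _ _ hab hab
  have hcard : ({⟨0, by omega⟩, y, z} : Finset (Fin t)).card = 3 :=
    Finset.card_eq_three.mpr ⟨_, _, _, hne hxy, (hne hzx).symm, hne hyz, rfl⟩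
  by_contra h3
  have : ∃ w, w ∉ ({⟨0, by omega⟩, y, z} : Finset (Fin t)) := by
    by_contra! hall
    have := Finset.card_eq_of_equiv_fin (s := ({⟨0, by omega⟩, y, z} : Finset (Fin t)))
      (Equiv.subtypeUnivEquiv hall)
    omega
  obtain ⟨w, hw'⟩ := this
  simp only [Finset.mem_insert, Finset.mem_singleton, not_or] at hw'
  obtain ⟨p, q, r, w, h⟩ := exists_isEvenWalk_of_four hD hs h2 hxy hyz hzx hw'.1 hw'.2.1 hw'.2.2
  exact hw p q r w h

/-! ### Systems of perfect matchings between the parts -/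

section Matchings

variable {t : ℕ}

/-- For each arc `i → j` of `D` and each `s`, the relation `rule s i j` on `{0, …, m - 1}` relates
every number to some number, and some number to every number. These relations, perfect matchings in
all applications, are disjoint for different `s`. -/
structure IsLatin (D : Digraph (Fin t)) (m : ℕ) (rule : ℕ → ℕ → ℕ → ℕ → ℕ → Prop) : Prop where
  total : ∀ s < m, ∀ i j, D.Adj i j → ∀ a < m, ∃ b < m, rule s i j a b
  surj : ∀ s < m, ∀ i j, D.Adj i j → ∀ b < m, ∃ a < m, rule s i j a b
  inj : ∀ s < m, ∀ s' < m, ∀ i j, D.Adj i j → ∀ a < m, ∀ b < m,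
    rule s i j a b → rule s' i j a b → s = s'

/-- The digraph of the matchings with index `s`; the pair `(i, a)` stands for vertex `a` of part
`i`. -/
def Link (D : Digraph (Fin t)) (m : ℕ) (rule : ℕ → ℕ → ℕ → ℕ → ℕ → Prop) (s : ℕ)
    (x y : Fin t × ℕ) : Prop :=
  D.Adj x.1 y.1 ∧ x.2 < m ∧ y.2 < m ∧ rule s x.1 y.1 x.2 y.2

variable {D : Digraph (Fin t)} {m : ℕ} {rule : ℕ → ℕ → ℕ → ℕ → ℕ → Prop}

/-- Every closed walk of `D` permutes the vertices of a part; if those of one part are joined to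
each other, then so are all vertices. -/
theorem IsLatin.link_of_part (h : IsLatin D m rule) (hD : Strong D) {s : ℕ} (hs : s < m)
    (i₀ : Fin t) (h₀ : ∀ a < m, ∀ b < m, ReflTransGen (Link D m rule s) (i₀, a) (i₀, b))
    (i j : Fin t) {a b : ℕ} (ha : a < m) (hb : b < m) :
    ReflTransGen (Link D m rule s) (i, a) (j, b) := by
  have hfwd : ∃ c < m, ReflTransGen (Link D m rule s) (i, a) (i₀, c) := by
    clear h₀
    induction hD i i₀ with
    | refl => exact ⟨a, ha, .refl⟩
    | tail _ hadj ih =>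
      obtain ⟨c, hc, hr⟩ := ih
      obtain ⟨d, hd, hcd⟩ := h.total s hs _ _ hadj c hc
      exact ⟨d, hd, hr.tail ⟨hadj, hc, hd, hcd⟩⟩
  have hbwd : ∃ c < m, ReflTransGen (Link D m rule s) (i₀, c) (j, b) := by
    clear h₀ hfwd
    induction hD i₀ j using ReflTransGen.head_induction_on with
    | refl => exact ⟨b, hb, .refl⟩
    | head hadj _ ih =>
      obtain ⟨c, hc, hr⟩ := ih
      obtain ⟨d, hd, hcd⟩ := h.surj s hs _ _ hadj c hc
      exact ⟨d, hd, hr.head ⟨hadj, hd, hc, hcd⟩⟩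
  obtain ⟨c, hc, h1⟩ := hfwd
  obtain ⟨d, hd, h3⟩ := hbwd
  exact (h1.trans (h₀ c hc d hd)).trans h3

theorem zmod_connected {m : ℕ} [NeZero m] {R : ZMod m → ZMod m → Prop} {g : ZMod m}
    (hg : IsUnit g) (hR : ∀ x, R x (x + g)) (x y : ZMod m) : ReflTransGen R x y := by
  have key : ∀ k : ℕ, ReflTransGen R x (x + k * g) := by
    intro k
    induction k with
    | zero => simpa using ReflTransGen.refl
    | succ k ih =>
      have := hR (x + k * g)
      rw [add_assoc, ← add_one_mul] at this
      exact_mod_cast ih.tail this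
  obtain ⟨u, rfl⟩ := hg
  have := key ((y - x) * ↑u⁻¹ : ZMod m).val
  rwa [ZMod.natCast_zmod_val, mul_assoc, Units.inv_mul, mul_one, add_sub_cancel] at this

theorem val_add_mod_iff {m : ℕ} [NeZero m] (x y : ZMod m) (u v : ℕ) :
    (x.val + u) % m = (y.val + v) % m ↔ x + u = y + v := by
  rw [← ZMod.natCast_eq_natCast_iff']
  simp

theorem mod_eq_iff_dvd (m a b : ℕ) : a % m = b % m ↔ (m : ℤ) ∣ b - a :=
  Nat.modEq_iff_dvd

theorem exists_add_mod_eq {m : ℕ} (hm : 0 < m) (u v : ℕ) : ∃ b < m, (b + u) % m = v % m := by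
  have : NeZero m := ⟨hm.ne'⟩
  refine ⟨((v : ZMod m) - u).val, ZMod.val_lt _, ?_⟩
  rw [← ZMod.natCast_eq_natCast_iff']
  simp

theorem eq_zero_of_dvd {m : ℕ} {z : ℤ} (h : (m : ℤ) ∣ z) (h1 : -(m : ℤ) < z) (h2 : z < m) :
    z = 0 :=
  Int.eq_zero_of_abs_lt_dvd h (abs_lt.mpr ⟨h1, h2⟩)

end Matchings

section Rules

variable {t : ℕ} {D : Digraph (Fin t)} {m : ℕ}

/-! ### Cyclic shifts along an even closed walk -/

/-- Vertex `a` of part `i` is matched with vertex `a + f` of part `j` modulo `m`, where `f` is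
`1 - s` for the arc `w → p` of the walk, `-s` for the arc `q → r`, and `s` for all other arcs. The
shifts along the walk add up to `1`. -/
def evenRule (p q r w m s i j a b : ℕ) : Prop :=
  if i = w ∧ j = p then (b + s) % m = (a + 1) % m
  else if i = q ∧ j = r then (b + s) % m = a % m
  else b % m = (a + s) % m

/-- Vertex `a` of one part is matched with vertex `a + s` of the next one, modulo `m`. -/
def shiftRule (m s _i _j a b : ℕ) : Prop := b % m = (a + s) % m

theorem isLatin_shiftRule (hm : 0 < m) : IsLatin D m (shiftRule m) where
  total s _ _ _ _ a _ := by simpa [shiftRule] using exists_add_mod_eq hm 0 (a + s)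
  surj s _ _ _ _ b _ := by
    obtain ⟨a, ha, h⟩ := exists_add_mod_eq hm s b
    exact ⟨a, ha, h.symm⟩
  inj s hs s' hs' _ _ _ a _ b _ h h' := by
    simp only [shiftRule, mod_eq_iff_dvd] at h h'
    have := eq_zero_of_dvd (dvd_sub h h') (by push_cast; omega) (by push_cast; omega)
    push_cast at this
    omega

theorem isLatin_evenRule (hm : 0 < m) (p q r w : ℕ) : IsLatin D m (evenRule p q r w m) where
  total s _ i j _ a _ := by
    unfold evenRule
    split_ifs
    · exact exists_add_mod_eq hm s (a + 1)
    · exact exists_add_mod_eq hm s a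
    · simpa using exists_add_mod_eq hm 0 (a + s)
  surj s _ i j _ b _ := by
    unfold evenRule
    split_ifs
    · obtain ⟨a, ha, h⟩ := exists_add_mod_eq hm 1 (b + s)
      exact ⟨a, ha, h.symm⟩
    · obtain ⟨a, ha, h⟩ := exists_add_mod_eq hm 0 (b + s)
      exact ⟨a, ha, by simpa using h.symm⟩
    · obtain ⟨a, ha, h⟩ := exists_add_mod_eq hm s b
      exact ⟨a, ha, h.symm⟩
  inj s hs s' hs' i j _ a _ b _ h h' := by
    unfold evenRule at h h'
    split_ifs at h h' <;> rw [mod_eq_iff_dvd] at h h' <;>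
    · have := eq_zero_of_dvd (dvd_sub h h') (by push_cast; omega) (by push_cast; omega)
      push_cast at this
      omega

/-- Labels of the link digraph as elements of `ZMod m`. -/
theorem Link.of_zmod [NeZero m] {rule : ℕ → ℕ → ℕ → ℕ → ℕ → Prop} {s : ℕ} {i j : Fin t}
    (hD : D.Adj i j) {x y : ZMod m} (h : rule s i j x.val y.val) :
    Link D m rule s (i, x.val) (j, y.val) :=
  ⟨hD, ZMod.val_lt x, ZMod.val_lt y, h⟩

theorem link_part_of_zmod [NeZero m] {rule : ℕ → ℕ → ℕ → ℕ → ℕ → Prop} {s : ℕ} {i : Fin t}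
    (h : ∀ x y : ZMod m, ReflTransGen (Link D m rule s) (i, x.val) (i, y.val)) :
    ∀ a < m, ∀ b < m, ReflTransGen (Link D m rule s) (i, a) (i, b) := by
  intro a ha b hb
  have := h a b
  rwa [ZMod.val_natCast_of_lt ha, ZMod.val_natCast_of_lt hb] at this

theorem reflTransGen_zmod [NeZero m] {g : ZMod m} (hg : IsUnit g) {L : Fin t × ℕ → Fin t × ℕ → Prop}
    {i : Fin t} (h : ∀ x : ZMod m, ReflTransGen L (i, x.val) (i, (x + g).val)) (x y : ZMod m) :
    ReflTransGen L (i, x.val) (i, y.val) := by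
  have := zmod_connected (R := fun x y => ReflTransGen L (i, x.val) (i, y.val)) hg h x y
  induction this with
  | refl => exact .refl
  | tail _ h1 ih => exact ih.trans h1

theorem link_evenRule (hm : 0 < m) (hD : Strong D) (hl : Loopless D) {p q r w : Fin t}
    (h : IsEvenWalk D p q r w) {s : ℕ} (hs : s < m) (i j : Fin t) {a b : ℕ} (ha : a < m)
    (hb : b < m) : ReflTransGen (Link D m (evenRule p q r w m) s) (i, a) (j, b) := by
  have : NeZero m := ⟨hm.ne'⟩
  refine (isLatin_evenRule hm _ _ _ _).link_of_part hD hs p (link_part_of_zmod ?_) i j ha hb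
  refine reflTransGen_zmod isUnit_one fun x => ?_
  have hne : ∀ {a b : Fin t}, D.Adj a b → (a : ℕ) ≠ b := fun {a b} hab e => by
    rw [Fin.val_inj] at e
    subst e
    exact hl _ hab
  have key : ∀ (i j : Fin t) (y z : ZMod m), D.Adj i j →
      (if (i : ℕ) = w ∧ (j : ℕ) = p then z + (s : ZMod m) = y + 1
        else if (i : ℕ) = q ∧ (j : ℕ) = r then z + (s : ZMod m) = y else z = y + s) →
      Link D m (evenRule p q r w m) s (i, y.val) (j, z.val) := by
    intro i j y z hij h
    refine Link.of_zmod hij ?_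
    unfold evenRule
    split_ifs at h ⊢
    · exact (val_add_mod_iff z y s 1).mpr (by simpa using h)
    · exact (val_add_mod_iff z y s 0).mpr (by simpa using h)
    · exact (val_add_mod_iff z y 0 s).mpr (by simpa using h)
  obtain ⟨hwp, hpq, ⟨rfl, rfl⟩ | ⟨hqw, hqr, hrw⟩⟩ := h
  · refine ReflTransGen.tail (.single (key p q x (x + s) hpq ?_)) (key q p _ _ hwp ?_)
    · simp [hne hpq]
    · simp
      ring
  · have hqw' : (q : ℕ) ≠ w := fun e => hqw (Fin.val_inj.mp e)
    refine (((ReflTransGen.single (key p q x (x + s) hpq ?_)).tail (key q r _ x hqr ?_)).tail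
      (key r w _ (x + s) hrw ?_)).tail (key w p _ _ hwp ?_)
    · simp [(hne hwp).symm, hne hpq]
    · simp [hqw']
    · simp [hne hrw, (hne hqr).symm]
    · simp
      ring

/-! ### Matchings for the 3-cycle -/

/-- A rule for the 3-cycle through part `0`. All matchings are cyclic shifts if `m` is odd or
divisible by `4`, and then the shifts of the three parts add up to `1`, except for `s = m - 1` and
`4 ∣ m`, where they add up to `m / 2 + 1`.

If `m = 2 q` with `q` odd, no such choice of shifts exists. There the shifts `s`, `s`, `1 - 2 s`
(for even `s`) and `s`, `s`, `2 - 2 s` (for odd `s`) are modified in two ways: for even `s` the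
targets of the vertices `0` and `2` of part `0` are exchanged, and between the two other parts the
matchings `s` and `s + q` exchange the targets of the vertices congruent to `s + 1` modulo `q`. -/
def triangleRule (m s i j a b : ℕ) : Prop :=
  if j = 0 then
    if m % 2 = 1 then (b + 2 * s) % m = (a + 1) % m
    else if m % 4 = 0 then
      if s < m / 2 then (b + 2 * s) % m = (a + 1) % m else (b + 2 * s) % m = a % m
    else if s % 2 = 0 then (b + 2 * s) % m = (a + 1) % m else (b + 2 * s) % m = (a + 2) % m
  else if i = 0 then
    if m % 4 = 2 ∧ s % 2 = 0 ∧ (a = 0 ∨ a = 2) then (b + a) % m = (s + 2) % m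
    else b % m = (a + s) % m
  else if m % 4 = 0 then
    if s < m / 2 then b % m = (a + s) % m
    else if s + 1 < m then b % m = (a + (s + 1)) % m else b % m = (a + m / 2) % m
  else if m % 4 = 2 ∧ a % (m / 2) = (s + 1) % (m / 2) then b % m = (a + (s + m / 2)) % m
  else b % m = (a + s) % m

theorem exists_add_mod_eq' {m : ℕ} (hm : 0 < m) (u v : ℕ) : ∃ a < m, v % m = (a + u) % m := by
  obtain ⟨a, ha, h⟩ := exists_add_mod_eq hm u v
  exact ⟨a, ha, h.symm⟩

theorem eq_of_two_mul_dvd {m : ℕ} {s s' : ℕ} (hs : s < m) (hs' : s' < m) (hm : m % 4 ≠ 0)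
    (hp : m % 2 = 1 ∨ s % 2 = s' % 2) (h : (m : ℤ) ∣ 2 * s - 2 * s') : s = s' := by
  suffices (m : ℤ) ∣ s - s' by
    have := eq_zero_of_dvd this (by omega) (by omega)
    omega
  rcases Nat.mod_two_eq_zero_or_one m with h0 | h1
  · -- `m / 2` is odd and divides the even number `s - s'`
    obtain ⟨k, hk⟩ : ∃ k : ℤ, (s : ℤ) - s' = 2 * k := ⟨((s : ℤ) - s') / 2, by omega⟩
    obtain ⟨q, hq⟩ : ∃ q : ℤ, (m : ℤ) = 2 * q := ⟨(m : ℤ) / 2, by omega⟩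
    have hcop : IsCoprime q 2 := ⟨1, -((q - 1) / 2), by omega⟩
    have h1 : q ∣ 2 * k := by
      rw [hq, ← mul_sub, hk] at h
      exact Int.dvd_of_mul_dvd_mul_left (by norm_num) h
    rw [hq, hk]
    exact mul_dvd_mul_left 2 (hcop.dvd_of_dvd_mul_left h1)
  · have hcop : IsCoprime (m : ℤ) 2 := ⟨1, -(((m : ℤ) - 1) / 2), by omega⟩
    rw [← mul_sub] at h
    exact hcop.dvd_of_dvd_mul_left h

theorem not_dvd_of_odd {m : ℕ} {z : ℤ} (hm : m % 2 = 0) (hz : z % 2 = 1) : ¬ (m : ℤ) ∣ z := by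
  rintro ⟨k, hk⟩
  obtain ⟨q, hq⟩ : ∃ q : ℤ, (m : ℤ) = 2 * q := ⟨(m : ℤ) / 2, by omega⟩
  rw [hq, mul_assoc] at hk
  omega

theorem isLatin_triangleRule (hm : 2 < m) : IsLatin D m (triangleRule m) where
  total s _ i j _ a _ := by
    have h0 : 0 < m := by omega
    unfold triangleRule
    split_ifs <;> first | exact exists_add_mod_eq h0 _ _ | simpa using exists_add_mod_eq h0 0 _
  surj s _ i j _ b _ := by
    have h0 : 0 < m := by omega
    unfold triangleRule
    by_cases hj : j = (0 : ℕ)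
    · simp only [hj, if_true]
      split_ifs <;>
        first | exact exists_add_mod_eq' h0 _ _ | simpa using exists_add_mod_eq' h0 0 (b + 2 * s)
    by_cases hi : i = (0 : ℕ)
    · simp only [hi, hj, if_true, if_false]
      by_cases hms : m % 4 = 2 ∧ s % 2 = 0
      · simp only [hms.1, hms.2, true_and]
        by_cases hb2 : b % m = s % m
        · exact ⟨2, hm, by
            rw [if_pos (Or.inr rfl)]
            exact Nat.ModEq.add_right 2 hb2⟩
        by_cases hb0 : b % m = (s + 2) % m
        · exact ⟨0, h0, by simpa using hb0⟩
        obtain ⟨a, ha, h⟩ := exists_add_mod_eq' h0 s b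
        refine ⟨a, ha, ?_⟩
        rw [if_neg]
        · exact h
        · rintro (rfl | rfl)
          · exact hb2 (by simpa using h)
          · exact hb0 (by rwa [add_comm s 2])
      · obtain ⟨a, ha, h⟩ := exists_add_mod_eq' h0 s b
        refine ⟨a, ha, ?_⟩
        rw [if_neg (fun h' => hms ⟨h'.1, h'.2.1⟩)]
        exact h
    simp only [hi, hj, if_false]
    split_ifs
    · exact exists_add_mod_eq' h0 _ _
    · exact exists_add_mod_eq' h0 _ _
    · exact exists_add_mod_eq' h0 _ _
    · obtain ⟨a, ha, h⟩ := exists_add_mod_eq' h0 s b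
      by_cases hq : m % 4 = 2 ∧ a % (m / 2) = (s + 1) % (m / 2)
      · have hm2 : m = 2 * (m / 2) := by omega
        refine ⟨(a + m / 2) % m, Nat.mod_lt _ h0, ?_⟩
        rw [if_pos]
        · rw [h, Nat.mod_add_mod, show a + m / 2 + (s + m / 2) = a + s + m by omega,
            Nat.add_mod_right]
        · refine ⟨hq.1, ?_⟩
          rw [Nat.mod_mod_of_dvd _ (Dvd.intro_left 2 hm2.symm), Nat.add_mod_right, hq.2]
      · exact ⟨a, ha, by rwa [if_neg hq]⟩
  inj s hs s' hs' i j _ a ha b hb h h' := by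
    unfold triangleRule at h h'
    by_cases hj : j = (0 : ℕ)
    · simp only [hj, if_true] at h h'
      rcases Nat.mod_two_eq_zero_or_one m with h0 | h1
      · simp only [h0, zero_ne_one, if_false] at h h'
        by_cases h4 : m % 4 = 0
        · simp only [h4, if_true] at h h'
          split_ifs at h h' with hc hc' <;> rw [mod_eq_iff_dvd] at h h'
          · have := eq_zero_of_dvd (dvd_sub h h') (by push_cast; omega) (by push_cast; omega)
            push_cast at this
            omega
          · exact absurd (dvd_sub h h') (not_dvd_of_odd h0 (by push_cast; omega))
          · exact absurd (dvd_sub h h') (not_dvd_of_odd h0 (by push_cast; omega))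
          · have := eq_zero_of_dvd (dvd_sub h h') (by push_cast; omega) (by push_cast; omega)
            push_cast at this
            omega
        · simp only [h4, if_false] at h h'
          split_ifs at h h' with hc hc' <;> rw [mod_eq_iff_dvd] at h h'
          · refine eq_of_two_mul_dvd hs hs' h4 (by omega) ?_
            obtain ⟨k, hk⟩ := dvd_sub h' h
            push_cast at hk
            exact ⟨k, by linarith⟩
          · exact absurd (dvd_sub h h') (not_dvd_of_odd h0 (by push_cast; omega))
          · exact absurd (dvd_sub h h') (not_dvd_of_odd h0 (by push_cast; omega))
          · refine eq_of_two_mul_dvd hs hs' h4 (by omega) ?_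
            obtain ⟨k, hk⟩ := dvd_sub h' h
            push_cast at hk
            exact ⟨k, by linarith⟩
      · simp only [h1, if_true] at h h'
        rw [mod_eq_iff_dvd] at h h'
        refine eq_of_two_mul_dvd hs hs' (by omega) (.inl h1) ?_
        obtain ⟨k, hk⟩ := dvd_sub h' h
        push_cast at hk
        exact ⟨k, by linarith⟩
    have hshift : b % m = (a + s) % m → b % m = (a + s') % m → s = s' := fun h h' =>
      (isLatin_shiftRule (D := D) (by omega)).inj s hs s' hs' i j (by assumption) a ha b hb h h'
    by_cases hi : i = (0 : ℕ)
    · simp only [hi, hj, if_true, if_false] at h h'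
      by_cases hc : m % 4 = 2 ∧ (a = 0 ∨ a = 2)
      · have ha2 : a % 2 = 0 := by omega
        simp only [hc.1, hc.2, true_and, and_true] at h h'
        split_ifs at h h' with h1 h2 <;> try rw [mod_eq_iff_dvd] at h h'
        · have := eq_zero_of_dvd (dvd_sub h h') (by push_cast; omega) (by push_cast; omega)
          push_cast at this
          omega
        · exact absurd (dvd_sub h h') (not_dvd_of_odd (by omega) (by push_cast; omega))
        · exact absurd (dvd_sub h h') (not_dvd_of_odd (by omega) (by push_cast; omega))
        · rw [← mod_eq_iff_dvd] at h h'
          exact hshift h h'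
      · rw [if_neg (fun h' => hc ⟨h'.1, h'.2.2⟩)] at h h'
        exact hshift h h'
    simp only [hi, hj, if_false] at h h'
    by_cases h4 : m % 4 = 0
    · simp only [h4, if_true] at h h'
      split_ifs at h h' <;> rw [mod_eq_iff_dvd] at h h' <;>
      · have := eq_zero_of_dvd (dvd_sub h h') (by push_cast; omega) (by push_cast; omega)
        push_cast at this
        omega
    simp only [h4, if_false] at h h'
    by_cases h2 : m % 4 = 2
    swap
    · simp only [h2, false_and, if_false] at h h'
      exact hshift h h'
    simp only [h2, true_and] at h h'
    -- matchings with indices differing by `m / 2` are modified at the same vertices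
    have hmix : ∀ s s', a % (m / 2) = (s + 1) % (m / 2) → b % m = (a + (s + m / 2)) % m →
        b % m = (a + s') % m → a % (m / 2) = (s' + 1) % (m / 2) := by
      intro s s' hs h h'
      rw [hs]
      have hd : m / 2 ∣ m := Dvd.intro_left 2 (by omega)
      have h3 : (s + m / 2) % m = s' % m := Nat.ModEq.add_left_cancel' a (h.symm.trans h')
      have h4 := congrArg (· % (m / 2)) h3
      simp only [Nat.mod_mod_of_dvd _ hd, Nat.add_mod_right] at h4
      exact Nat.ModEq.add_right 1 (show s ≡ s' [MOD m / 2] from h4)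
    split_ifs at h h' with h5 h6 h6
    · rw [mod_eq_iff_dvd] at h h'
      have := eq_zero_of_dvd (dvd_sub h h') (by push_cast; omega) (by push_cast; omega)
      push_cast at this
      omega
    · exact absurd (hmix _ _ h5 h h') h6
    · exact absurd (hmix _ _ h6 h' h) h5
    · exact hshift h h'

end Rules

section Triangle

variable {t : ℕ} {D : Digraph (Fin t)} {m : ℕ}

/-- The matchings of the triangle rule in the case of cyclic shifts. -/
theorem link_triangleRule_of_shift (hm : 2 < m) {i u v : Fin t} (hi : (i : ℕ) = 0)
    (hu : (u : ℕ) ≠ 0) (hv : (v : ℕ) ≠ 0) (hiu : D.Adj i u) (huv : D.Adj u v) (hvi : D.Adj v i)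
    {s : ℕ} (hs : s < m) (h4 : m % 4 ≠ 2) :
    ∀ a < m, ∀ b < m, ReflTransGen (Link D m (triangleRule m) s) (i, a) (i, b) := by
  have : NeZero m := ⟨by omega⟩
  refine link_part_of_zmod ?_
  have key : ∀ x y z w : ZMod m, triangleRule m s 0 u x.val y.val →
      triangleRule m s u v y.val z.val → triangleRule m s v 0 z.val w.val →
      ReflTransGen (Link D m (triangleRule m) s) (i, x.val) (i, w.val) := fun x y z w h1 h2 h3 =>
    ((ReflTransGen.single (Link.of_zmod hiu (by rwa [hi]))).tail (Link.of_zmod huv h2)).tail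
      (Link.of_zmod hvi (by rwa [hi]))
  have shift : ∀ (x y : ZMod m) (k : ℕ), y = x + k → y.val % m = (x.val + k) % m := fun x y k h =>
    (val_add_mod_iff y x 0 k).mpr (by simpa using h)
  by_cases hodd : m % 2 = 1
  · refine reflTransGen_zmod isUnit_one fun x => key x (x + s) (x + s + s) _ ?_ ?_ ?_
    · simpa [triangleRule, hu, h4] using shift x _ s rfl
    · simpa [triangleRule, hu, hv, h4, show m % 4 ≠ 0 by omega] using shift (x + s) _ s rfl
    · simp only [triangleRule, hodd, if_true]
      refine (val_add_mod_iff _ _ _ _).mpr ?_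
      push_cast
      ring
  have h40 : m % 4 = 0 := by omega
  by_cases hlow : s < m / 2
  · refine reflTransGen_zmod isUnit_one fun x => key x (x + s) (x + s + s) _ ?_ ?_ ?_
    · simpa [triangleRule, hu, h4] using shift x _ s rfl
    · simpa [triangleRule, hu, hv, h40, hlow] using shift (x + s) _ s rfl
    · simp only [triangleRule, hodd, h40, hlow, if_true, if_false]
      refine (val_add_mod_iff _ _ _ _).mpr ?_
      push_cast
      ring
  by_cases hlast : s + 1 < m
  · refine reflTransGen_zmod isUnit_one fun x => key x (x + s) (x + s + (s + 1 : ℕ)) _ ?_ ?_ ?_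
    · simpa [triangleRule, hu, h4] using shift x _ s rfl
    · simpa [triangleRule, hu, hv, h40, hlow, hlast] using shift (x + s) _ (s + 1) rfl
    · simp only [triangleRule, hodd, h40, hlow, if_true, if_false]
      refine (val_add_mod_iff _ _ _ 0).mpr ?_
      push_cast
      ring
  · have hunit : IsUnit ((m / 2 + 1 : ℕ) : ZMod m) := by
      rw [ZMod.isUnit_iff_coprime]
      have h1 : Nat.Coprime (m / 2 + 1) (m / 2) := by simp
      have h2 : Nat.Coprime (m / 2 + 1) 2 := by
        rw [Nat.coprime_two_right]
        exact Nat.odd_iff.mpr (by omega)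
      have := h1.mul_right h2
      rwa [show m / 2 * 2 = m by omega] at this
    refine reflTransGen_zmod hunit fun x => key x (x + s) (x + s + (m / 2 : ℕ)) _ ?_ ?_ ?_
    · simpa [triangleRule, hu, h4] using shift x _ s rfl
    · simpa [triangleRule, hu, hv, h40, hlow, hlast] using shift (x + s) _ (m / 2) rfl
    · simp only [triangleRule, hodd, h40, hlow, if_true, if_false]
      refine (val_add_mod_iff _ _ _ 0).mpr ?_
      have hsm : ((s : ZMod m) + 1) = 0 := by
        have := ZMod.natCast_self m
        rw [show m = s + 1 by omega] at this ⊢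
        exact_mod_cast this
      push_cast
      linear_combination hsm

theorem chain_of_succ {R : ℕ → ℕ → Prop} {d a k : ℕ} (hr : ∀ x, R x x)
    (ht : ∀ x y z, R x y → R y z → R x z) (h : ∀ j < k, R (a + d * j) (a + d * (j + 1))) :
    R a (a + d * k) := by
  induction k with
  | zero => exact hr a
  | succ k ih => exact ht _ _ _ (ih fun j hj => h j (by omega)) (h k (by omega))

/-- The matchings of the triangle rule if `m = 2 q` with `q` odd. For odd `s`, one turn around the
3-cycle takes vertex `x` of part `0` to `x + 2`, or to `x + 2 + q` if `x ≡ 1` modulo `q`; thus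
the even and the odd vertices are traversed alternately. For even `s` the vertices are traversed
in the order `0, 3, 4, …, q + 1, 2, 1, q + 2, …, 2 q - 1`. -/
theorem link_triangleRule_of_two_mul_odd (hm : 2 < m) {i u v : Fin t} (hi : (i : ℕ) = 0)
    (hu : (u : ℕ) ≠ 0) (hv : (v : ℕ) ≠ 0) (hiu : D.Adj i u) (huv : D.Adj u v) (hvi : D.Adj v i)
    {s : ℕ} (h4 : m % 4 = 2) :
    ∀ a < m, ∀ b < m, ReflTransGen (Link D m (triangleRule m) s) (i, a) (i, b) := by
  have h0 : 0 < m := by omega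
  obtain ⟨q, hq⟩ : ∃ q, q = m / 2 := ⟨_, rfl⟩
  have hmq : m = 2 * q := by omega
  have hq3 : 3 ≤ q := by omega
  have hqm : q ∣ m := Dvd.intro_left 2 hmq.symm
  obtain ⟨R, hR⟩ : ∃ R : ℕ → ℕ → Prop, R = fun x y =>
    ReflTransGen (Link D m (triangleRule m) s) (i, x % m) (i, y % m) := ⟨_, rfl⟩
  have rfl' : ∀ x, R x x := fun x => by rw [hR]
  have trans' : ∀ x y z, R x y → R y z → R x z := fun x y z h h' => by
    rw [hR] at h h' ⊢
    exact h.trans h'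
  -- one turn around the 3-cycle, `x'` being the image of `x` under the exchange of `0` and `2`
  have turn : ∀ x x' d e z : ℕ,
      (if s % 2 = 0 ∧ (x % m = 0 ∨ x % m = 2) then x' + x % m = 2 else x' = x) →
      d = (if x' % q = 1 then q else 0) → e = (if s % 2 = 0 then 1 else 2) →
      z % m = (x' + d + e) % m → R x z := by
    intro x x' d e z hx hd he hz
    rw [hR]
    have hy : triangleRule m s 0 u (x % m) ((x' + s) % m) := by
      unfold triangleRule
      rw [if_neg hu, if_pos rfl]
      simp only [h4, true_and]
      split_ifs at hx ⊢
      · rw [Nat.mod_add_mod, show x' + s + x % m = s + 2 by omega]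
      · rw [hx, Nat.mod_mod, Nat.mod_add_mod]
    have hyq : ((x' + s) % m % (m / 2) = (s + 1) % (m / 2)) ↔ x' % q = 1 := by
      rw [← hq, Nat.mod_mod_of_dvd _ hqm]
      constructor
      · intro h
        have : x' % q = 1 % q :=
          Nat.ModEq.add_right_cancel' s (show x' + s ≡ 1 + s [MOD q] by rwa [add_comm 1 s])
        rwa [Nat.mod_eq_of_lt (by omega : 1 < q)] at this
      · intro h
        have : x' ≡ 1 [MOD q] := by rw [Nat.ModEq, h, Nat.mod_eq_of_lt (by omega)]
        rw [add_comm s 1]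
        exact this.add_right s
    have hz1 : triangleRule m s u v ((x' + s) % m) ((x' + s + s + d) % m) := by
      unfold triangleRule
      rw [if_neg hv, if_neg hu, if_neg (by omega)]
      simp only [h4, true_and, hyq]
      split_ifs at hd ⊢
      · rw [hd, ← hq, Nat.mod_mod, Nat.mod_add_mod]
        congr 1
        ring
      · rw [hd, Nat.mod_mod, Nat.mod_add_mod, add_zero]
    have hw : triangleRule m s v 0 ((x' + s + s + d) % m) (z % m) := by
      unfold triangleRule
      rw [if_pos rfl, if_neg (by omega), if_neg (by omega)]
      split_ifs at he ⊢ <;>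
      · rw [hz, Nat.mod_add_mod, Nat.mod_add_mod, he]
        congr 1
        ring
    rw [← hi] at hy hw
    have l₁ : Link D m (triangleRule m) s (i, x % m) (u, (x' + s) % m) :=
      ⟨hiu, Nat.mod_lt _ h0, Nat.mod_lt _ h0, hy⟩
    have l₂ : Link D m (triangleRule m) s (u, (x' + s) % m) (v, (x' + s + s + d) % m) :=
      ⟨huv, Nat.mod_lt _ h0, Nat.mod_lt _ h0, hz1⟩
    have l₃ : Link D m (triangleRule m) s (v, (x' + s + s + d) % m) (i, z % m) :=
      ⟨hvi, Nat.mod_lt _ h0, Nat.mod_lt _ h0, hw⟩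
    exact ((ReflTransGen.single l₁).tail l₂).tail l₃
  have congr' : ∀ x y k, y = x + m * k → R x y := fun x y k h => by
    rw [hR, h]
    simp only [Nat.add_mul_mod_self_left, ReflTransGen.refl]
  have congr'' : ∀ x y k, x = y + m * k → R x y := fun x y k h => by
    rw [hR, h]
    simp only [Nat.add_mul_mod_self_left, ReflTransGen.refl]
  have hmod1 : ∀ x, x % q = 1 → ∃ k, x = q * k + 1 := fun x h => ⟨x / q, by
    have := Nat.div_add_mod x q
    omega⟩
  suffices ∃ c, ∀ x < m, R c x ∧ R x c by
    obtain ⟨c, hc⟩ := this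
    intro a ha b hb
    have := trans' _ _ _ (hc a ha).2 (hc b hb).1
    rw [hR] at this
    simpa only [Nat.mod_eq_of_lt ha, Nat.mod_eq_of_lt hb] using this
  rcases Nat.mod_two_eq_zero_or_one s with hs | hs
  · have step : ∀ x < m, x ≠ 0 → x ≠ 1 → x ≠ 2 → x ≠ q + 1 → R x (x + 1) := by
      intro x hx h1 h2 h3 h5
      refine turn x x 0 1 (x + 1) ?_ ?_ (by simp [hs]) rfl
      · rw [Nat.mod_eq_of_lt hx, if_neg (by omega)]
      · rw [if_neg]
        intro h
        obtain ⟨k, hk⟩ := hmod1 x h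
        have : k < 2 := by
          by_contra hk2
          have := Nat.mul_le_mul_left q (not_lt.mp hk2)
          omega
        interval_cases k <;> omega
    have s0 : R 0 3 := by
      refine turn 0 2 0 1 3 (by simp [hs]) ?_ (by simp [hs]) rfl
      rw [if_neg]
      rw [Nat.mod_eq_of_lt (by omega)]
      omega
    have s1 : R 1 (q + 2) := by
      refine turn 1 1 q 1 (q + 2) ?_ ?_ (by simp [hs]) (by congr 1; omega)
      · rw [Nat.mod_eq_of_lt (by omega : 1 < m), if_neg (by omega)]
      · rw [if_pos (Nat.mod_eq_of_lt (by omega))]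
    have s2 : R 2 1 := by
      refine turn 2 0 0 1 1 ?_ (by simp) (by simp [hs]) rfl
      rw [Nat.mod_eq_of_lt hm, if_pos ⟨hs, .inr rfl⟩]
    have s3 : R (q + 1) 2 := by
      refine turn (q + 1) (q + 1) q 1 2 ?_ ?_ (by simp [hs]) ?_
      · rw [Nat.mod_eq_of_lt (by omega : q + 1 < m), if_neg (by omega)]
      · rw [if_pos (by rw [Nat.add_mod_left, Nat.mod_eq_of_lt (by omega)])]
      · rw [show q + 1 + q + 1 = 2 + m by omega, Nat.add_mod_right]
    have c1 : ∀ a k, 3 ≤ a → a + k ≤ q + 1 → R a (a + k) := by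
      intro a k ha hk
      have := chain_of_succ (d := 1) (a := a) (k := k) rfl' trans' fun j hj => by
        simpa [add_assoc] using step (a + j) (by omega) (by omega) (by omega) (by omega) (by omega)
      simpa using this
    have c2 : ∀ a k, q + 2 ≤ a → a + k ≤ m → R a (a + k) := by
      intro a k ha hk
      have := chain_of_succ (d := 1) (a := a) (k := k) rfl' trans' fun j hj => by
        simpa [add_assoc] using step (a + j) (by omega) (by omega) (by omega) (by omega) (by omega)
      simpa using this
    have sm : R m 0 := congr'' m 0 1 (by omega)
    have to1 : R 2 (q + 2) := trans' _ _ _ s2 s1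
    refine ⟨0, fun x hx => ?_⟩
    have up1 : R 0 (q + 1) := trans' _ _ _ s0 (by
      simpa [show 3 + (q - 2) = q + 1 by omega] using c1 3 (q - 2) le_rfl (by omega))
    have up2 : R 0 2 := trans' _ _ _ up1 s3
    have up3 : R 0 (q + 2) := trans' _ _ _ up2 to1
    have dn3 : R (q + 2) 0 := by
      have := c2 (q + 2) (q - 2) le_rfl (by omega)
      rw [show q + 2 + (q - 2) = m by omega] at this
      exact trans' _ _ _ this sm
    have dn2 : R 2 0 := trans' _ _ _ to1 dn3
    rcases Nat.eq_zero_or_pos x with rfl | hx0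
    · exact ⟨rfl' 0, rfl' 0⟩
    by_cases hx1 : x = 1
    · subst hx1
      exact ⟨trans' _ _ _ up2 s2, trans' _ _ _ s1 dn3⟩
    by_cases hx2 : x = 2
    · subst hx2
      exact ⟨up2, dn2⟩
    by_cases hxq : x ≤ q + 1
    · have e1 := c1 3 (x - 3) le_rfl (by omega)
      have e2 := c1 x (q + 1 - x) (by omega) (by omega)
      rw [show 3 + (x - 3) = x by omega] at e1
      rw [show x + (q + 1 - x) = q + 1 by omega] at e2
      exact ⟨trans' _ _ _ s0 e1, trans' _ _ _ e2 (trans' _ _ _ s3 dn2)⟩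
    · have e1 := c2 (q + 2) (x - (q + 2)) le_rfl (by omega)
      have e2 := c2 x (m - x) (by omega) (by omega)
      rw [show q + 2 + (x - (q + 2)) = x by omega] at e1
      rw [show x + (m - x) = m by omega] at e2
      exact ⟨trans' _ _ _ up3 e1, trans' _ _ _ e2 sm⟩
  · have step : ∀ x, x % q ≠ 1 → R x (x + 2) := fun x hx =>
      turn x x 0 2 (x + 2) (by simp [hs]) (by simp [hx]) (by simp [hs]) rfl
    have jump : ∀ x, x % q = 1 → R x (x + q + 2) := fun x hx =>
      turn x x q 2 (x + q + 2) (by simp [hs]) (by simp [hx]) (by simp [hs]) rfl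
    have c1 : ∀ a k, a % 2 = 1 → 3 ≤ a → a + 2 * k ≤ 2 * q + 1 → R a (a + 2 * k) := by
      intro a k ha ha3 hk
      refine chain_of_succ rfl' trans' fun j hj => ?_
      have := step (a + 2 * j) fun h => by
        obtain ⟨l, hl⟩ := hmod1 _ h
        have : l < 2 := by
          by_contra hk2
          have := Nat.mul_le_mul_left q (not_lt.mp hk2)
          omega
        interval_cases l <;> omega
      rwa [show a + 2 * (j + 1) = a + 2 * j + 2 by ring]
    have c2 : ∀ a k, a % 2 = 0 → q + 3 ≤ a → a + 2 * k ≤ 3 * q + 1 → R a (a + 2 * k) := by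
      intro a k ha ha3 hk
      refine chain_of_succ rfl' trans' fun j hj => ?_
      have := step (a + 2 * j) fun h => by
        obtain ⟨l, hl⟩ := hmod1 _ h
        have : l < 3 := by
          by_contra hk2
          have := Nat.mul_le_mul_left q (not_lt.mp hk2)
          omega
        interval_cases l <;> omega
      rwa [show a + 2 * (j + 1) = a + 2 * j + 2 by ring]
    have j1 : R (2 * q + 1) (q + 3) := trans' _ _ _
      (jump (2 * q + 1) (by rw [Nat.mul_add_mod_self_right, Nat.mod_eq_of_lt (by omega)]))
      (congr'' _ _ 1 (by omega))
    have j2 : R (3 * q + 1) 3 := trans' _ _ _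
      (jump (3 * q + 1) (by rw [Nat.mul_add_mod_self_right, Nat.mod_eq_of_lt (by omega)]))
      (congr'' _ _ 2 (by omega))
    have d1 : R 3 (q + 3) := trans' _ _ _ (by
      simpa [show 3 + 2 * (q - 1) = 2 * q + 1 by omega] using
        c1 3 (q - 1) rfl le_rfl (by omega)) j1
    have d2 : R (q + 3) 3 := trans' _ _ _ (by
      simpa [show q + 3 + 2 * (q - 1) = 3 * q + 1 by omega] using
        c2 (q + 3) (q - 1) (by omega) le_rfl (by omega)) j2
    -- odd and even vertices, represented between `3` and `2 q + 1`, and `q + 3` and `3 q + 1`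
    have o1 : ∀ a, a % 2 = 1 → 3 ≤ a → a ≤ 2 * q + 1 → R 3 a ∧ R a 3 := by
      intro a h1 h2 h3
      have e1 := c1 3 ((a - 3) / 2) rfl le_rfl (by omega)
      have e2 := c1 a ((2 * q + 1 - a) / 2) h1 h2 (by omega)
      rw [show 3 + 2 * ((a - 3) / 2) = a by omega] at e1
      rw [show a + 2 * ((2 * q + 1 - a) / 2) = 2 * q + 1 by omega] at e2
      exact ⟨e1, trans' _ _ _ e2 (trans' _ _ _ j1 d2)⟩
    have o2 : ∀ a, a % 2 = 0 → q + 3 ≤ a → a ≤ 3 * q + 1 → R 3 a ∧ R a 3 := by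
      intro a h1 h2 h3
      have e1 := c2 (q + 3) ((a - (q + 3)) / 2) (by omega) le_rfl (by omega)
      have e2 := c2 a ((3 * q + 1 - a) / 2) h1 h2 (by omega)
      rw [show q + 3 + 2 * ((a - (q + 3)) / 2) = a by omega] at e1
      rw [show a + 2 * ((3 * q + 1 - a) / 2) = 3 * q + 1 by omega] at e2
      exact ⟨trans' _ _ _ d1 e1, trans' _ _ _ e2 j2⟩
    have wrap : ∀ x, R 3 (x + m) ∧ R (x + m) 3 → R 3 x ∧ R x 3 := fun x h =>
      ⟨trans' _ _ _ h.1 (congr'' _ _ 1 (by omega)), trans' _ _ _ (congr' _ _ 1 (by omega)) h.2⟩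
    refine ⟨3, fun x hx => ?_⟩
    rcases Nat.mod_two_eq_zero_or_one x with h | h
    · by_cases hxq : q + 3 ≤ x
      · exact o2 x h hxq (by omega)
      · exact wrap x (o2 (x + m) (by omega) (by omega) (by omega))
    · by_cases hx3 : 3 ≤ x
      · exact o1 x h hx3 (by omega)
      · exact wrap x (o1 (x + m) (by omega) (by omega) (by omega))

theorem link_triangleRule (hm : 2 < m) (hD : Strong D) {i u v : Fin t} (hi : (i : ℕ) = 0)
    (hu : (u : ℕ) ≠ 0) (hv : (v : ℕ) ≠ 0) (hiu : D.Adj i u) (huv : D.Adj u v) (hvi : D.Adj v i)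
    {s : ℕ} (hs : s < m) (j k : Fin t) {a b : ℕ} (ha : a < m) (hb : b < m) :
    ReflTransGen (Link D m (triangleRule m) s) (j, a) (k, b) := by
  refine (isLatin_triangleRule hm).link_of_part hD hs i ?_ j k ha hb
  by_cases h4 : m % 4 = 2
  · exact link_triangleRule_of_two_mul_odd hm hi hu hv hiu huv hvi h4
  · exact link_triangleRule_of_shift hm hi hu hv hiu huv hvi hs h4

end Triangle

section Layers

variable {t : ℕ} {n : Fin t → ℕ} {D : Digraph (Fin t)} {H : ∀ i, Digraph (Fin (n i))} {m : ℕ}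
  {rule : ℕ → ℕ → ℕ → ℕ → ℕ → Prop} {lab τ : (Σ i : Fin t, Fin (n i)) → ℕ}

/-! ### Spanning subgraphs of a composition from matchings between the parts -/

/-- The arcs of the composition inside the parts. -/
def PartArc (H : ∀ i, Digraph (Fin (n i))) (x y : Σ i : Fin t, Fin (n i)) : Prop :=
  ∃ i a b, x = ⟨i, a⟩ ∧ y = ⟨i, b⟩ ∧ (H i).Adj a b

/-- The arcs of the `s`-th subgraph of the packing. Vertices with a label below `m` form the core,
whose arcs between different parts are given by `rule`. Every other vertex `x` receives arcs from
the core vertices with label `s + τ x`, and sends arcs to those with label `s + τ x + 1`, modulo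
`m`. All arcs inside the parts belong to the subgraph with index `0`. -/
def LayerAdj (D : Digraph (Fin t)) (H : ∀ i, Digraph (Fin (n i))) (m : ℕ)
    (rule : ℕ → ℕ → ℕ → ℕ → ℕ → Prop) (lab τ : (Σ i : Fin t, Fin (n i)) → ℕ) (s : ℕ)
    (x y : Σ i : Fin t, Fin (n i)) : Prop :=
  (s = 0 ∧ PartArc H x y) ∨ (D.Adj x.1 y.1 ∧
    ((lab x < m ∧ lab y < m ∧ rule s x.1 y.1 (lab x) (lab y)) ∨
      (m ≤ lab x ∧ lab y = (s + τ x + 1) % m) ∨ (m ≤ lab y ∧ lab x = (s + τ y) % m)))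

/-- The `s`-th subgraph of the packing. It contains all vertices. -/
def layer (D : Digraph (Fin t)) (H : ∀ i, Digraph (Fin (n i))) (m : ℕ)
    (rule : ℕ → ℕ → ℕ → ℕ → ℕ → Prop) (lab τ : (Σ i : Fin t, Fin (n i)) → ℕ) (s : ℕ) :
    Subdigraph (comp D H) where
  verts := Set.univ
  Adj := LayerAdj D H m rule lab τ s
  adj_sub h := h.imp (·.2) (·.1)
  tail_mem _ := trivial
  head_mem _ := trivial

theorem isPacking_layer (hl : Loopless D) (hr : IsLatin D m rule)
    (h : ∀ s < m, ∀ x y, ReflTransGen (LayerAdj D H m rule lab τ s) x y)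
    (S : Set (Σ i : Fin t, Fin (n i))) :
    IsPacking S (fun s : Fin m => layer D H m rule lab τ s) := by
  refine ⟨fun s => ⟨Set.subset_univ S, fun x _ y _ => h s s.2 x y⟩, ?_⟩
  rintro s s' hne x y ⟨h1, h2⟩
  refine hne (Fin.ext ?_)
  have hs := s.2
  have hs' := s'.2
  have hpart : ∀ {x y}, PartArc H x y → ¬ D.Adj x.1 y.1 := by
    rintro _ _ ⟨i, a, b, rfl, rfl, -⟩
    exact hl i
  have hcancel : ∀ u, ((s : ℕ) + u) % m = (s' + u) % m → (s : ℕ) = s' := fun u h => by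
    have := Nat.ModEq.add_right_cancel' u h
    rwa [Nat.ModEq, Nat.mod_eq_of_lt hs, Nat.mod_eq_of_lt hs'] at this
  have hlt : ∀ u, u % m < m := fun u => Nat.mod_lt _ (by omega)
  rcases h1 with ⟨h0, hp⟩ | ⟨hD, h1⟩ <;> rcases h2 with ⟨h0', hp'⟩ | ⟨hD', h2⟩
  · omega
  · exact (hpart hp hD').elim
  · exact (hpart hp' hD).elim
  · rcases h1 with ⟨hx, hy, h1⟩ | ⟨hx, h1⟩ | ⟨hy, h1⟩ <;>
      rcases h2 with ⟨hx', hy', h2⟩ | ⟨hx', h2⟩ | ⟨hy', h2⟩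
    · exact hr.inj s hs s' hs' _ _ hD _ hx _ hy h1 h2
    · omega
    · omega
    · omega
    · refine hcancel (τ x + 1) ?_
      rw [← add_assoc, ← add_assoc, ← h1, ← h2]
    · have := hlt (s + τ x + 1)
      omega
    · omega
    · have := hlt (s + τ y)
      omega
    · exact hcancel (τ y) (by rw [← h1, ← h2])

theorem exists_reach_of_link (hlab : ∀ i, ∀ c < m, ∃ a, lab ⟨i, a⟩ = c) {s : ℕ}
    {p : Fin t × ℕ} {x : Σ i : Fin t, Fin (n i)}
    (h : ReflTransGen (Link D m rule s) (x.1, lab x) p) :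
    ∃ y, y.1 = p.1 ∧ lab y = p.2 ∧ ReflTransGen (LayerAdj D H m rule lab τ s) x y := by
  induction h with
  | refl => exact ⟨x, rfl, rfl, .refl⟩
  | @tail p q _ hpq ih =>
    obtain ⟨y, hy1, hy2, hxy⟩ := ih
    obtain ⟨hD, hp, hq, hr⟩ := hpq
    obtain ⟨b, hb⟩ := hlab q.1 q.2 hq
    refine ⟨⟨q.1, b⟩, rfl, hb, hxy.tail (.inr ⟨by rwa [hy1], .inl ⟨?_, ?_, ?_⟩⟩)⟩
    · rwa [hy2]
    · rwa [hb]
    · rwa [hy1, hy2, hb]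

/-- The label of a vertex need not determine it within its part, but all vertices with the same
label are reached through any of their common in-neighbours. -/
theorem reach_of_link [Nontrivial (Fin t)] (hD : Strong D) (hr : IsLatin D m rule)
    (hlab : ∀ i, ∀ c < m, ∃ a, lab ⟨i, a⟩ = c) {s : ℕ} (hs : s < m)
    {x y : Σ i : Fin t, Fin (n i)} (hy : lab y < m)
    (h : ∀ j c, c < m → Link D m rule s (j, c) (y.1, lab y) →
      ReflTransGen (Link D m rule s) (x.1, lab x) (j, c)) :
    ReflTransGen (LayerAdj D H m rule lab τ s) x y := by
  obtain ⟨j, hj⟩ := hD.exists_in y.1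
  obtain ⟨c, hc, hrc⟩ := hr.surj s hs _ _ hj (lab y) hy
  obtain ⟨z, hz1, hz2, hxz⟩ := exists_reach_of_link (H := H) (τ := τ) hlab
    (h j c hc ⟨hj, hc, hy, hrc⟩)
  exact hxz.tail (.inr ⟨by rwa [hz1], .inl ⟨by rwa [hz2], hy, by rwa [hz1, hz2]⟩⟩)

theorem reach_of_core [Nontrivial (Fin t)] (hD : Strong D) (hm : 0 < m)
    (hlab : ∀ i, ∀ c < m, ∃ a, lab ⟨i, a⟩ = c) {s : ℕ}
    (h : ∀ x y, lab x < m → lab y < m → ReflTransGen (LayerAdj D H m rule lab τ s) x y)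
    (x y : Σ i : Fin t, Fin (n i)) : ReflTransGen (LayerAdj D H m rule lab τ s) x y := by
  have hx : ∃ x', lab x' < m ∧ ReflTransGen (LayerAdj D H m rule lab τ s) x x' := by
    by_cases hx : lab x < m
    · exact ⟨x, hx, .refl⟩
    obtain ⟨j, hj⟩ := hD.exists_out x.1
    obtain ⟨b, hb⟩ := hlab j _ (Nat.mod_lt (s + τ x + 1) hm)
    exact ⟨⟨j, b⟩, hb ▸ Nat.mod_lt _ hm, .single (.inr ⟨hj, .inr (.inl ⟨by omega, hb⟩)⟩)⟩
  have hy : ∃ y', lab y' < m ∧ ReflTransGen (LayerAdj D H m rule lab τ s) y' y := by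
    by_cases hy : lab y < m
    · exact ⟨y, hy, .refl⟩
    obtain ⟨j, hj⟩ := hD.exists_in y.1
    obtain ⟨b, hb⟩ := hlab j _ (Nat.mod_lt (s + τ y) hm)
    exact ⟨⟨j, b⟩, hb ▸ Nat.mod_lt _ hm, .single (.inr ⟨hj, .inr (.inr ⟨by omega, hb⟩)⟩)⟩
  obtain ⟨x', hx', h1⟩ := hx
  obtain ⟨y', hy', h2⟩ := hy
  exact (h1.trans (h x' y' hx' hy')).trans h2

/-- A layer whose matchings connect all core vertices is strong. -/
theorem reach_of_forall_link [Nontrivial (Fin t)] (hD : Strong D) (hr : IsLatin D m rule)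
    (hlab : ∀ i, ∀ c < m, ∃ a, lab ⟨i, a⟩ = c) {s : ℕ} (hs : s < m)
    (h : ∀ i j, ∀ a < m, ∀ b < m, ReflTransGen (Link D m rule s) (i, a) (j, b))
    (x y : Σ i : Fin t, Fin (n i)) : ReflTransGen (LayerAdj D H m rule lab τ s) x y :=
  reach_of_core hD (by omega) hlab (fun x y hx hy =>
    reach_of_link hD hr hlab hs hy fun j c hc _ => h _ _ _ hx _ hc) x y

/-! ### Two subgraphs for the 3-cycle -/

theorem link_shiftRule_last (hm : m ≤ 2) (hD : Strong D) {i u v : Fin t} (hiu : D.Adj i u)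
    (huv : D.Adj u v) (hvi : D.Adj v i) {s : ℕ} (hs : s + 1 = m) (j k : Fin t) {a b : ℕ}
    (ha : a < m) (hb : b < m) :
    ReflTransGen (Link D m (shiftRule m) s) (j, a) (k, b) := by
  refine (isLatin_shiftRule (by omega)).link_of_part hD (by omega) i ?_ j k ha hb
  intro a ha b hb
  by_cases hab : a = b
  · rw [hab]
  have l₁ : Link D m (shiftRule m) s (i, a) (u, b) := ⟨hiu, ha, hb, by
    obtain rfl : m = 2 := by omega
    simp only [shiftRule]; omega⟩
  have l₂ : Link D m (shiftRule m) s (u, b) (v, a) := ⟨huv, hb, ha, by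
    obtain rfl : m = 2 := by omega
    simp only [shiftRule]; omega⟩
  have l₃ : Link D m (shiftRule m) s (v, a) (i, b) := ⟨hvi, ha, hb, by
    obtain rfl : m = 2 := by omega
    simp only [shiftRule]; omega⟩
  exact ((ReflTransGen.single l₁).tail l₂).tail l₃

/-- For two subgraphs and cyclic shifts, the core of the subgraph with index `0` has two strong
components, the vertices with label `0` and those with label `1`. A vertex `v` outside the core, or
an arc inside a part, may lead from one to the other. -/
theorem reach_of_connectors [Nontrivial (Fin t)] (hD : Strong D)
    (hlab : ∀ i, ∀ c < 2, ∃ a, lab ⟨i, a⟩ = c)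
    (h01 : (∃ v, 2 ≤ lab v ∧ τ v = 0) ∨ ∃ x y, PartArc H x y ∧ lab x = 0 ∧ lab y = 1)
    (h10 : (∃ v, 2 ≤ lab v ∧ τ v = 1) ∨ ∃ x y, PartArc H x y ∧ lab x = 1 ∧ lab y = 0)
    (x y : Σ i : Fin t, Fin (n i)) :
    ReflTransGen (LayerAdj D H 2 (shiftRule 2) lab τ 0) x y := by
  have hlink : ∀ i j, ∀ c < 2, ReflTransGen (Link D 2 (shiftRule 2) 0) (i, c) (j, c) := by
    intro i j c hc
    induction hD i j with
    | refl => exact .refl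
    | tail _ hadj ih => exact ih.tail ⟨hadj, hc, hc, rfl⟩
  have hsame : ∀ x y, lab x < 2 → lab x = lab y →
      ReflTransGen (LayerAdj D H 2 (shiftRule 2) lab τ 0) x y := by
    intro x y hx hxy
    refine reach_of_link hD (isLatin_shiftRule (by omega)) hlab (by omega) (by omega) ?_
    rintro j c hc ⟨-, -, -, h⟩
    have : c = lab x := by
      simp only [shiftRule] at h
      omega
    rw [this]
    exact hlink _ _ _ hx
  have hextra : ∀ v, 2 ≤ lab v → ∃ x y, lab x = τ v % 2 ∧ lab y = (τ v + 1) % 2 ∧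
      ReflTransGen (LayerAdj D H 2 (shiftRule 2) lab τ 0) x y := by
    intro v hv
    obtain ⟨i, hi⟩ := hD.exists_in v.1
    obtain ⟨j, hj⟩ := hD.exists_out v.1
    obtain ⟨a, ha⟩ := hlab i (τ v % 2) (Nat.mod_lt _ (by omega))
    obtain ⟨b, hb⟩ := hlab j ((τ v + 1) % 2) (Nat.mod_lt _ (by omega))
    refine ⟨_, _, ha, hb, (ReflTransGen.single ?_).tail
      (.inr ⟨hj, .inr (.inl ⟨hv, by rw [hb, zero_add]⟩)⟩)⟩
    exact .inr ⟨hi, .inr (.inr ⟨hv, by rw [ha, zero_add]⟩)⟩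
  have c01 : ∃ x y, lab x = 0 ∧ lab y = 1 ∧
      ReflTransGen (LayerAdj D H 2 (shiftRule 2) lab τ 0) x y := by
    rcases h01 with ⟨v, hv, hτ⟩ | ⟨x, y, h, hx, hy⟩
    · simpa [hτ] using hextra v hv
    · exact ⟨x, y, hx, hy, .single (.inl ⟨rfl, h⟩)⟩
  have c10 : ∃ x y, lab x = 1 ∧ lab y = 0 ∧
      ReflTransGen (LayerAdj D H 2 (shiftRule 2) lab τ 0) x y := by
    rcases h10 with ⟨v, hv, hτ⟩ | ⟨x, y, h, hx, hy⟩
    · simpa [hτ] using hextra v hv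
    · exact ⟨x, y, hx, hy, .single (.inl ⟨rfl, h⟩)⟩
  refine reach_of_core hD (by omega) hlab (fun x y hx hy => ?_) x y
  by_cases hxy : lab x = lab y
  · exact hsame x y hx hxy
  obtain ⟨p, q, hp, hq, h⟩ : ∃ p q, lab p = lab x ∧ lab q = lab y ∧
      ReflTransGen (LayerAdj D H 2 (shiftRule 2) lab τ 0) p q := by
    rcases (by omega : lab x = 0 ∨ lab x = 1) with h0 | h1
    · rw [h0, show lab y = 1 by omega]
      exact c01
    · rw [h1, show lab y = 0 by omega]
      exact c10
  exact ((hsame x p hx hp.symm).trans h).trans (hsame q y (by omega) hq)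

/-! ### The exceptional compositions -/

theorem isomorphic_comp {A A' : Type} {W : A → Type} {W' : A' → Type} {D : Digraph A}
    {D' : Digraph A'} {H : ∀ i, Digraph (W i)} {H' : ∀ i, Digraph (W' i)} (e : A' ≃ A)
    (φ : ∀ k, W' k ≃ W (e k)) (hD : ∀ k l, D'.Adj k l ↔ D.Adj (e k) (e l))
    (hH : ∀ k a b, (H' k).Adj a b ↔ (H (e k)).Adj (φ k a) (φ k b)) :
    Isomorphic (comp D H) (comp D' H') := by
  refine ⟨RelIso.symm ⟨Equiv.sigmaCongr e φ, ?_⟩⟩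
  rintro ⟨k, a⟩ ⟨l, b⟩
  have happ : ∀ k a, Equiv.sigmaCongr e φ ⟨k, a⟩ = ⟨e k, φ k a⟩ := fun _ _ => rfl
  simp only [comp, happ]
  refine or_congr ⟨?_, ?_⟩ (hD k l).symm
  · rintro ⟨i, x, y, hx, hy, hxy⟩
    obtain rfl : e k = i := congrArg Sigma.fst hx
    obtain rfl : l = k := e.injective (congrArg Sigma.fst hy)
    refine ⟨l, a, b, rfl, rfl, (hH l a b).mpr ?_⟩
    simp only [Sigma.mk.injEq, heq_eq_eq, true_and] at hx hy
    rwa [hx, hy]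
  · rintro ⟨i, x, y, hx, hy, hxy⟩
    cases hx
    cases hy
    exact ⟨_, _, _, rfl, rfl, (hH _ _ _).mp hxy⟩

theorem exists_equiv_C3 (ht : t = 3) (hD : Strong D) (hs : Semicomplete D)
    (h2 : ∀ x y, D.Adj x y → ¬ D.Adj y x) (k : Fin 3) (i : Fin t) :
    ∃ e : Fin 3 ≃ Fin t, e k = i ∧ ∀ a b, C3.Adj a b ↔ D.Adj (e a) (e b) := by
  subst ht
  obtain ⟨u, v, hiu, huv, hvi⟩ := hD.exists_triangle hs h2 i
  have hne : ∀ {a b}, D.Adj a b → a ≠ b := fun {a b} hab e => by subst e; exact h2 _ _ hab hab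
  obtain ⟨f, hf⟩ : ∃ f : Fin 3 → Fin 3, f = ![i, u, v] := ⟨_, rfl⟩
  have hadj : ∀ a b, b = a + 1 ↔ D.Adj (f a) (f b) := by
    have := hne hiu
    have := hne huv
    have := hne hvi
    have := h2 _ _ hiu
    have := h2 _ _ huv
    have := h2 _ _ hvi
    have hloop : ∀ x, ¬ D.Adj x x := fun x h => h2 x x h h
    intro a b
    rw [hf]
    fin_cases a <;> fin_cases b <;> simp [*]
  have hinj : Function.Injective f := by
    rw [hf]
    have h1 := hne hiu
    have h3 := hne huv
    have h4 := hne hvi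
    intro a b
    fin_cases a <;> fin_cases b <;> simp [h1, h3, h4, h1.symm, h3.symm, h4.symm]
  let e := Equiv.ofBijective f (Finite.injective_iff_bijective.mp hinj)
  refine ⟨(Equiv.subRight k).trans e, by simp [e, hf], fun a b => ?_⟩
  refine Iff.trans ?_ (hadj (a - k) (b - k))
  simp only [C3]
  rw [sub_add_eq_add_sub, sub_left_inj]

theorem order_eq_of_equiv (e : Fin 3 ≃ Fin t) : order n = n (e 0) + n (e 1) + n (e 2) := by
  rw [order, ← Equiv.sum_comp e, Fin.sum_univ_three]

theorem exists_equiv_fin_two {k l : ℕ} (hk : k = 2) (hl : l = 2) {a b : Fin l} (hab : a ≠ b) :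
    ∃ φ : Fin k ≃ Fin l, ∀ x y : Fin k, (x.val = 0 ∧ y.val = 1) ↔ (φ x = a ∧ φ y = b) := by
  subst hk
  subst hl
  rcases Fin.exists_fin_two.mp ⟨a, rfl⟩ with rfl | rfl
  · refine ⟨Equiv.refl _, fun x y => ?_⟩
    simp only [Equiv.refl_apply]
    omega
  · refine ⟨Equiv.swap 0 1, fun x y => ?_⟩
    fin_cases x <;> fin_cases y <;> simp <;> omega

/-- A composition of a 3-cycle which does not belong to `𝒬₀`, has at least two vertices in each
part, and at most `7` vertices, has an arc inside a part, and two such arcs if it has `6`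
vertices. -/
theorem exists_partArc (ht : t = 3) (hD : Strong D) (hs : Semicomplete D)
    (h2 : ∀ x y, D.Adj x y → ¬ D.Adj y x) (hl : ∀ i, Loopless (H i)) (hn : ∀ i, 2 ≤ n i)
    (hQ : ¬ InQ0 (comp D H)) (hN : order n ≤ 7) :
    ∃ x y, PartArc H x y ∧
      (order n = 6 → ∃ x' y', PartArc H x' y' ∧ ¬ (x' = x ∧ y' = y)) := by
  have hex : ∃ i, ∀ j ≠ i, n j = 2 := by
    obtain ⟨e, -, -⟩ := exists_equiv_C3 ht hD hs h2 0 ⟨0, by omega⟩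
    have he := order_eq_of_equiv (n := n) e
    have h0 := hn (e 0)
    have h1 := hn (e 1)
    have h3 := hn (e 2)
    have hall : ∀ k l, k ≠ l → (n (e k) = 2 ∨ n (e l) = 2) := by
      intro k l hkl
      fin_cases k <;> fin_cases l <;> simp at hkl ⊢ <;> omega
    by_contra! hcon
    obtain ⟨j, -, hj⟩ := hcon ⟨0, by omega⟩
    obtain ⟨l, hlj, hl2⟩ := hcon j
    have := hall (e.symm j) (e.symm l) (fun h => hlj (e.symm.injective h).symm)
    simp only [Equiv.apply_symm_apply] at this
    omega
  obtain ⟨i, hi⟩ := hex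
  obtain ⟨e, hek, he⟩ := exists_equiv_C3 ht hD hs h2 2 i
  have hord := order_eq_of_equiv (n := n) e
  have hne : ∀ k, k ≠ 2 → n (e k) = 2 := fun k hk =>
    hi _ fun h => hk (e.injective (h.trans hek.symm))
  have e0 := hne 0 (by decide)
  have e1 := hne 1 (by decide)
  have e2 := hn (e 2)
  have hsome : ∃ x y, PartArc H x y := by
    by_contra! hno
    have hno' : ∀ i a b, ¬ (H i).Adj a b := fun i a b h => hno _ _ ⟨i, a, b, rfl, rfl, h⟩
    rcases (by omega : n (e 2) = 2 ∨ n (e 2) = 3) with e2 | e2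
    · refine hQ (.inl (isomorphic_comp e (fun k => finCongr ?_) he fun k a b => ?_))
      · fin_cases k
        exacts [e0.symm, e1.symm, e2.symm]
      · simp [hno']
    · refine hQ (.inr (.inr (isomorphic_comp e (fun k => finCongr ?_) he fun k a b => ?_)))
      · fin_cases k
        exacts [e0.symm, e1.symm, e2.symm]
      · simp [hno']
  obtain ⟨x, y, hxy⟩ := hsome
  refine ⟨x, y, hxy, fun h6 => ?_⟩
  by_contra! hno
  obtain ⟨j, a, b, rfl, rfl, hab⟩ := hxy
  obtain ⟨e, hek, he⟩ := exists_equiv_C3 ht hD hs h2 0 j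
  have hord := order_eq_of_equiv (n := n) e
  have h0 := hn (e 0)
  have h1 := hn (e 1)
  have h3 := hn (e 2)
  have hall : ∀ k, ![2, 2, 2] k = n (e k) := by
    intro k
    fin_cases k <;> simp <;> omega
  have hφ : ∀ k, ∃ φ : Fin (![2, 2, 2] k) ≃ Fin (n (e k)), ∀ x y : Fin (![2, 2, 2] k),
      (k = 0 ∧ x.val = 0 ∧ y.val = 1) ↔ (H (e k)).Adj (φ x) (φ y) := by
    intro k
    by_cases hk : k = 0
    · subst hk
      subst hek
      have hne : a ≠ b := fun h => hl _ _ (h ▸ hab)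
      obtain ⟨φ, hφ⟩ := exists_equiv_fin_two (k := ![2, 2, 2] 0) rfl (by omega) hne
      refine ⟨φ, fun x y => ?_⟩
      rw [hφ x y]
      refine ⟨?_, fun h => ⟨rfl, ?_⟩⟩
      · rintro ⟨-, h1, h2⟩
        rwa [h1, h2]
      · have := hno _ _ ⟨_, _, _, rfl, rfl, h⟩
        simpa using this
    · refine ⟨finCongr (hall k), fun x y => iff_of_false (fun h => hk h.1) fun h => ?_⟩
      have := (hno _ _ ⟨_, _, _, rfl, rfl, h⟩).1
      exact hk (e.injective ((congrArg Sigma.fst this).trans hek.symm))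
  choose φ hφ using hφ
  exact hQ (.inr (.inl (isomorphic_comp e φ he hφ)))

end Layers

section Labels

variable {t : ℕ} {n : Fin t → ℕ} {D : Digraph (Fin t)} {H : ∀ i, Digraph (Fin (n i))} {m : ℕ}
  {lab τ : (Σ i : Fin t, Fin (n i)) → ℕ}

/-! ### Labels and connectors for two subgraphs -/

/-- The label of `z` after the part of `x` has been relabelled such that `x` has label `1`, `y` has
label `0`, and a third vertex has label `2`. -/
def arcLabel (x y z : Σ i : Fin t, Fin (n i)) : ℕ :=
  if z = x then 1 else if z = y then 0 else if z.1 = x.1 then 2 else z.2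

/-- Labels for which a composition of a 3-cycle outside `𝒬₀` with at least two vertices in each part
has two connectors in opposite directions: two vertices outside the core; or one such vertex and
an arc inside a part; or two arcs inside parts. -/
def IsLabelling (H : ∀ i, Digraph (Fin (n i))) (lab : (Σ i : Fin t, Fin (n i)) → ℕ) : Prop :=
  (8 ≤ order n ∧ ∀ z, lab z = z.2) ∨
  (order n = 7 ∧ ∃ x y, PartArc H x y ∧ ∀ z, lab z = arcLabel x y z) ∨
  (order n = 6 ∧ ∃ x y x' y', PartArc H x y ∧ PartArc H x' y' ∧ ¬ (x' = x ∧ y' = y) ∧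
    ∀ z, lab z = if z = x' then 0 else if z = y' then 1 else arcLabel x y z)

/-- The values of `τ` are `1`, except that one vertex outside the core, if there is any, has value
`0`. -/
def IsMarking (m : ℕ) (lab τ : (Σ i : Fin t, Fin (n i)) → ℕ) : Prop :=
  (∃ v, m ≤ lab v) → ∃ v, m ≤ lab v ∧ τ v = 0 ∧ ∀ z ≠ v, τ z = 1

theorem PartArc.ne {x y : Σ i : Fin t, Fin (n i)} (hl : ∀ i, Loopless (H i))
    (h : PartArc H x y) : x ≠ y := by
  obtain ⟨i, a, b, rfl, rfl, hab⟩ := h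
  intro e
  obtain rfl : a = b := by simpa using e
  exact hl _ _ hab

theorem order_eq_of_three (ht : t = 3) :
    ∃ i j k : Fin t, i ≠ j ∧ i ≠ k ∧ j ≠ k ∧ order n = n i + n j + n k ∧
      ∀ l, l = i ∨ l = j ∨ l = k := by
  subst ht
  refine ⟨0, 1, 2, by decide, by decide, by decide, order_eq_of_equiv (Equiv.refl _), fun l => ?_⟩
  fin_cases l <;> simp

theorem eq_two_of_order_eq_six (ht : t = 3) (hn : ∀ i, 2 ≤ n i) (h6 : order n = 6) (i : Fin t) :
    n i = 2 := by
  obtain ⟨i₀, j₀, k₀, -, -, -, hord, hall⟩ := order_eq_of_three (n := n) ht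
  have h1 := hn i₀
  have h2 := hn j₀
  have h3 := hn k₀
  rcases hall i with rfl | rfl | rfl <;> omega

theorem IsLabelling.exists_label (h : IsLabelling H lab) (hl : ∀ i, Loopless (H i))
    (hn : ∀ i, 2 ≤ n i) (i : Fin t) (c : ℕ) (hc : c < 2) : ∃ a, lab ⟨i, a⟩ = c := by
  have hni := hn i
  have harc : ∀ x y, PartArc H x y → ∃ a, arcLabel x y ⟨i, a⟩ = c := by
    intro x y hxy
    have hne := hxy.ne hl
    obtain ⟨j, a, b, rfl, rfl, -⟩ := hxy
    by_cases hij : i = j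
    · subst hij
      rcases (by omega : c = 0 ∨ c = 1) with rfl | rfl
      · exact ⟨b, by simp [arcLabel, hne.symm]⟩
      · exact ⟨a, by simp [arcLabel]⟩
    · refine ⟨⟨c, by omega⟩, ?_⟩
      rw [arcLabel, if_neg (fun h => hij (congrArg Sigma.fst h)),
        if_neg (fun h => hij (congrArg Sigma.fst h)), if_neg hij]
  rcases h with ⟨-, h⟩ | ⟨-, x, y, hxy, h⟩ | ⟨-, x, y, x', y', hxy, hxy', -, h⟩
  · exact ⟨⟨c, by omega⟩, h _⟩
  · obtain ⟨a, ha⟩ := harc x y hxy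
    exact ⟨a, (h _).trans ha⟩
  · have hne := hxy'.ne hl
    obtain ⟨j, a', b', rfl, rfl, -⟩ := hxy'
    by_cases hij : i = j
    · subst hij
      rcases (by omega : c = 0 ∨ c = 1) with rfl | rfl
      · exact ⟨a', by simp [h]⟩
      · exact ⟨b', by rw [h, if_neg hne.symm, if_pos rfl]⟩
    · obtain ⟨a, ha⟩ := harc x y hxy
      refine ⟨a, ?_⟩
      rw [h, if_neg (fun h => hij (congrArg Sigma.fst h)),
        if_neg (fun h => hij (congrArg Sigma.fst h)), ha]

theorem exists_two_large (ht : t = 3) (hn : ∀ i, 2 ≤ n i) (h8 : 8 ≤ order n) :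
    ∃ v w : Σ i : Fin t, Fin (n i), v ≠ w ∧ 2 ≤ v.2.val ∧ 2 ≤ w.2.val := by
  obtain ⟨i, j, k, hij, hik, hjk, hord, -⟩ := order_eq_of_three (n := n) ht
  have h1 := hn i
  have h2 := hn j
  have h3 := hn k
  have hone : ∀ i, 4 ≤ n i →
      ∃ v w : Σ i : Fin t, Fin (n i), v ≠ w ∧ 2 ≤ v.2.val ∧ 2 ≤ w.2.val := fun i hi =>
    ⟨⟨i, ⟨2, by omega⟩⟩, ⟨i, ⟨3, by omega⟩⟩, by simp, le_rfl, by simp⟩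
  have htwo : ∀ i j, i ≠ j → 3 ≤ n i → 3 ≤ n j →
      ∃ v w : Σ i : Fin t, Fin (n i), v ≠ w ∧ 2 ≤ v.2.val ∧ 2 ≤ w.2.val := fun i j hij hi hj =>
    ⟨⟨i, ⟨2, by omega⟩⟩, ⟨j, ⟨2, by omega⟩⟩, fun h => hij (congrArg Sigma.fst h), le_rfl, le_rfl⟩
  by_cases hi4 : 4 ≤ n i
  · exact hone i hi4
  by_cases hj4 : 4 ≤ n j
  · exact hone j hj4
  by_cases hk4 : 4 ≤ n k
  · exact hone k hk4
  by_cases hi3 : n i = 2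
  · exact htwo j k hjk (by omega) (by omega)
  by_cases hj3 : n j = 2
  · exact htwo i k hik (by omega) (by omega)
  · exact htwo i j hij (by omega) (by omega)

theorem exists_arcLabel_eq_two (ht : t = 3) (h7 : order n = 7)
    {x y : Σ i : Fin t, Fin (n i)} (hxy : PartArc H x y) : ∃ v, arcLabel x y v = 2 := by
  obtain ⟨i, hi⟩ : ∃ i, 2 < n i := by
    obtain ⟨i, j, k, -, -, -, hord, -⟩ := order_eq_of_three (n := n) ht
    by_contra! h
    have h1 := h i
    have h2 := h j
    have h3 := h k
    omega
  obtain ⟨j, a, b, rfl, rfl, -⟩ := hxy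
  by_cases hij : i = j
  · subst hij
    obtain ⟨c, hca, hcb⟩ := Fin.exists_ne_and_ne_of_two_lt a b hi
    exact ⟨⟨i, c⟩, by simp [arcLabel, hca, hcb]⟩
  · refine ⟨⟨i, ⟨2, hi⟩⟩, ?_⟩
    rw [arcLabel, if_neg (fun h => hij (congrArg Sigma.fst h)),
      if_neg (fun h => hij (congrArg Sigma.fst h)), if_neg hij]

theorem IsLabelling.reach [Nontrivial (Fin t)] (h : IsLabelling H lab) (hτ : IsMarking 2 lab τ)
    (ht : t = 3) (hD : Strong D) (hl : ∀ i, Loopless (H i)) (hn : ∀ i, 2 ≤ n i)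
    (x y : Σ i : Fin t, Fin (n i)) :
    ReflTransGen (LayerAdj D H 2 (shiftRule 2) lab τ 0) x y := by
  have hlab := h.exists_label hl hn
  have harc : ∀ x y, PartArc H x y → arcLabel x y x = 1 ∧ arcLabel x y y = 0 := fun x y hxy => by
    simp [arcLabel, (hxy.ne hl).symm]
  rcases h with ⟨h8, h⟩ | ⟨h7, x', y', hxy, h⟩ | ⟨h6, x', y', x'', y'', hxy, hxy', hne, h⟩
  · obtain ⟨v, w, hvw, hv, hw⟩ := exists_two_large ht hn h8
    obtain ⟨z, hz, hz0, hz1⟩ := hτ ⟨v, by rwa [h]⟩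
    refine reach_of_connectors hD hlab (.inl ⟨z, hz, hz0⟩) (.inl ?_) x y
    by_cases hvz : v = z
    · exact ⟨w, by rwa [h], hz1 w fun e => hvw (hvz.trans e.symm)⟩
    · exact ⟨v, by rwa [h], hz1 v hvz⟩
  · obtain ⟨v, hv⟩ := exists_arcLabel_eq_two ht h7 hxy
    obtain ⟨z, hz, hz0, -⟩ := hτ ⟨v, by rw [h, hv]⟩
    refine reach_of_connectors hD hlab (.inl ⟨z, hz, hz0⟩) (.inr ⟨x', y', hxy, ?_⟩) x y
    rw [h, h]
    exact harc _ _ hxy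
  · have h2 := eq_two_of_order_eq_six ht hn h6
    have hxx : x' ≠ x'' := by
      rintro rfl
      have e1 := hxy.ne hl
      have e2 := hxy'.ne hl
      obtain ⟨i, a, b, rfl, rfl, -⟩ := hxy
      obtain ⟨j, a', b', hx, rfl, -⟩ := hxy'
      obtain rfl : i = j := congrArg Sigma.fst hx
      have := h2 i
      have := a.2
      have := b.2
      have := b'.2
      simp only [ne_eq, Sigma.mk.injEq, heq_eq_eq, true_and, Fin.ext_iff] at *
      omega
    have hyy : y' ≠ y'' := by
      rintro rfl
      have e1 := hxy.ne hl
      have e2 := hxy'.ne hl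
      obtain ⟨i, a, b, rfl, rfl, -⟩ := hxy
      obtain ⟨j, a', b', rfl, hy, -⟩ := hxy'
      obtain rfl : i = j := congrArg Sigma.fst hy
      have := h2 i
      have := a.2
      have := b.2
      have := a'.2
      simp only [ne_eq, Sigma.mk.injEq, heq_eq_eq, true_and, Fin.ext_iff] at *
      omega
    refine reach_of_connectors hD hlab (.inr ⟨x'', y'', hxy', ?_, ?_⟩)
      (.inr ⟨x', y', hxy, ?_, ?_⟩) x y
    · simp [h]
    · rw [h, if_neg (hxy'.ne hl).symm, if_pos rfl]
    · rw [h, if_neg hxx]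
      split_ifs
      exacts [rfl, (harc _ _ hxy).1]
    · rw [h]
      split_ifs
      exacts [rfl, (harc _ _ hxy).2]

/-! ### The packing -/

/-- The rules and labels that yield packings of `m` subgraphs. -/
def IsPlan (D : Digraph (Fin t)) (H : ∀ i, Digraph (Fin (n i))) (m : ℕ)
    (rule : ℕ → ℕ → ℕ → ℕ → ℕ → Prop) (lab : (Σ i : Fin t, Fin (n i)) → ℕ) : Prop :=
  (∃ p q r w, IsEvenWalk D p q r w ∧ rule = evenRule p q r w m ∧ ∀ z, lab z = z.2) ∨
  ((∀ p q r w, ¬ IsEvenWalk D p q r w) ∧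
    ((2 < m ∧ rule = triangleRule m ∧ ∀ z, lab z = z.2) ∨
      (m = 1 ∧ rule = shiftRule m ∧ ∀ z, lab z = z.2) ∨
      (m = 2 ∧ rule = shiftRule m ∧ IsLabelling H lab)))

theorem IsPlan.isPacking {rule : ℕ → ℕ → ℕ → ℕ → ℕ → Prop} (h : IsPlan D H m rule lab)
    (hτ : IsMarking m lab τ) (ht : 2 ≤ t) (hm : 0 < m) (hn : ∀ i, m ≤ n i) (hD : Strong D)
    (hlD : Loopless D) (hl : ∀ i, Loopless (H i)) (hs : Symmetric D ∨ Semicomplete D)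
    (S : Set (Σ i : Fin t, Fin (n i))) :
    IsPacking S (fun s : Fin m => layer D H m rule lab τ s) := by
  have : Nontrivial (Fin t) := Fin.nontrivial_iff_two_le.mpr ht
  have hid : (∀ z, lab z = z.2) → ∀ i, ∀ c < m, ∃ a, lab ⟨i, a⟩ = c := fun h i c hc =>
    ⟨⟨c, hc.trans_le (hn i)⟩, h _⟩
  rcases h with ⟨p, q, r, w, hw, rfl, hlab⟩ | ⟨hw, h⟩
  · exact isPacking_layer hlD (isLatin_evenRule hm _ _ _ _) (fun s hs' =>
      reach_of_forall_link hD (isLatin_evenRule hm _ _ _ _) (hid hlab) hs'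
        fun i j a ha b hb => link_evenRule hm hD hlD hw hs' i j ha hb) S
  obtain ⟨ht3, h2, hsc⟩ := eq_three_of_not_isEvenWalk ht hD hs hw
  obtain ⟨u, v, hiu, huv, hvi⟩ := hD.exists_triangle hsc h2 ⟨0, by omega⟩
  rcases h with ⟨hm2, rfl, hlab⟩ | ⟨rfl, rfl, hlab⟩ | ⟨rfl, rfl, hlab⟩
  · have hu : (u : ℕ) ≠ 0 := fun h => hlD u (by
      convert hiu)
    have hv : (v : ℕ) ≠ 0 := fun h => hlD v (by
      convert hvi)
    exact isPacking_layer hlD (isLatin_triangleRule hm2) (fun s hs' =>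
      reach_of_forall_link hD (isLatin_triangleRule hm2) (hid hlab) hs'
        fun i j a ha b hb => link_triangleRule hm2 hD rfl hu hv hiu huv hvi hs' i j ha hb) S
  · exact isPacking_layer hlD (isLatin_shiftRule hm) (fun s hs' =>
      reach_of_forall_link hD (isLatin_shiftRule hm) (hid hlab) hs'
        fun i j a ha b hb => link_shiftRule_last (by omega) hD hiu huv hvi (by omega) i j ha hb) S
  · refine isPacking_layer hlD (isLatin_shiftRule hm) (fun s hs' => ?_) S
    rcases (by omega : s = 0 ∨ s = 1) with rfl | rfl
    · exact hlab.reach hτ ht3 hD hl hn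
    · exact reach_of_forall_link hD (isLatin_shiftRule hm) (hlab.exists_label hl hn) hs'
        fun i j a ha b hb => link_shiftRule_last (by omega) hD hiu huv hvi (by omega) i j ha hb

end Labels

/-! ### The program -/

section Program

open StrongPacking.Expr StrongPacking.LoopProg

local infixl:65 " +ₑ " => Expr.op Op.add
local infixl:65 " -ₑ " => Expr.op Op.sub
local infixl:70 " *ₑ " => Expr.op Op.mul
local infixl:70 " /ₑ " => Expr.op Op.div
local infixl:70 " %ₑ " => Expr.op Op.mod
local infix:50 " =ₑ " => Expr.op Op.eq
local infix:50 " <ₑ " => Expr.op Op.lt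
local infixr:30 " ;; " => LoopProg.seq

/-! Registers `0`, `1`, `2` hold `t`, the order of the composition, and the number `m` of subgraphs;
register `3` tells whether an even closed walk has been found, and registers `4` to `7` hold this
walk. Register `8` holds the number of the marked vertex, registers `9` to `12` the ends of two arcs
inside parts. Registers `13` to `16` are loop counters and bounds. Array `6` holds the part of
each vertex, and array `7` its label. -/

/-- Computes the order of the composition, and the part of each vertex and its number there. -/
def fillParts : LoopProg :=
  loop 13 14 (reg 0) (loop 15 16 (read 0 (reg 13))
    (write 6 (reg 1) (reg 13) ;; write 7 (reg 1) (reg 15) ;; assign 1 (reg 1 +ₑ const 1)))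

/-- Computes the least order of a part. -/
def leastPart : LoopProg :=
  assign 2 (read 0 (const 0)) ;;
  loop 13 14 (reg 0) (ite (read 0 (reg 13) <ₑ reg 2) (assign 2 (read 0 (reg 13))) skip)

/-- The entry of the adjacency matrix of `D` at the positions given by two registers. -/
def arcEntry (r r' : ℕ) : Expr := read 1 (reg r *ₑ reg 0 +ₑ reg r')

/-- The test whether registers `17` to `20` hold an even closed walk. -/
def walkTest : Expr :=
  arcEntry 20 17 *ₑ arcEntry 17 18 *ₑ
    ((reg 18 =ₑ reg 19) *ₑ (reg 19 =ₑ reg 20) +ₑ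
      (const 1 -ₑ (reg 18 =ₑ reg 20)) *ₑ arcEntry 18 19 *ₑ arcEntry 19 20)

/-- Computes the four vertices of `D` encoded by the loop counter. -/
def decodeWalk : LoopProg :=
  assign 17 (reg 13 /ₑ reg 0 /ₑ reg 0 /ₑ reg 0) ;;
  assign 18 (reg 13 /ₑ reg 0 /ₑ reg 0 %ₑ reg 0) ;;
  assign 19 (reg 13 /ₑ reg 0 %ₑ reg 0) ;; assign 20 (reg 13 %ₑ reg 0)

/-- Stores an even closed walk. -/
def storeWalk : LoopProg :=
  assign 3 (const 1) ;; assign 4 (reg 17) ;; assign 5 (reg 18) ;; assign 6 (reg 19) ;;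
  assign 7 (reg 20)

/-- Searches an even closed walk among all quadruples of vertices of `D`. -/
def findWalk : LoopProg :=
  loop 13 14 (reg 0 *ₑ reg 0 *ₑ reg 0 *ₑ reg 0) (decodeWalk ;; ite walkTest storeWalk skip)

/-- Searches a pair of vertices of the composition that passes a test, which refers to it by its
position in the adjacency matrix, and stores it in the registers `r` and `r'`. -/
def findPair (test : Expr) (r r' : ℕ) : LoopProg :=
  loop 13 14 (reg 1 *ₑ reg 1)
    (ite test (assign r (reg 13 /ₑ reg 1) ;; assign r' (reg 13 %ₑ reg 1)) skip)

/-- Gives label `2` to all vertices of the part of the vertex in register `9`. -/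
def clearLabels : LoopProg :=
  loop 13 14 (reg 1)
    (ite (read 6 (reg 13) =ₑ read 6 (reg 9)) (write 7 (reg 13) (const 2)) skip)

/-- The labels for two subgraphs and the 3-cycle. -/
def relabel : LoopProg :=
  findPair (read 2 (reg 13)) 9 10 ;;
  findPair (read 2 (reg 13) *ₑ (const 1 -ₑ (reg 13 =ₑ reg 9 *ₑ reg 1 +ₑ reg 10))) 11 12 ;;
  clearLabels ;; write 7 (reg 10) (const 0) ;; write 7 (reg 9) (const 1) ;;
  ite (reg 1 =ₑ const 6) (write 7 (reg 12) (const 1) ;; write 7 (reg 11) (const 0)) skip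

/-- Changes the labels if there are two subgraphs, no even closed walk, and at most seven
vertices. -/
def adjustLabels : LoopProg :=
  ite ((reg 3 =ₑ const 0) *ₑ (reg 2 =ₑ const 2) *ₑ (reg 1 <ₑ const 8)) relabel skip

/-- Finds the last vertex outside the core. -/
def markVertex : LoopProg :=
  loop 13 14 (reg 1) (ite (read 7 (reg 13) <ₑ reg 2) skip (assign 8 (reg 13)))

/-- Stores in register `24` whether two numbers are congruent modulo `m`. -/
def assignCongr (e e' : Expr) : LoopProg := assign 24 (e %ₑ reg 2 =ₑ e' %ₑ reg 2)

/-- Stores in register `24` whether vertex `a` of part `i` and vertex `b` of part `j` are matched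
by the rule with index `s`, for `s`, `i`, `j`, `a`, `b` in the registers `17`, `20` to `23`. -/
def ruleProg : LoopProg :=
  ite (reg 3)
    (ite ((reg 20 =ₑ reg 7) *ₑ (reg 21 =ₑ reg 4))
      (assignCongr (reg 23 +ₑ reg 17) (reg 22 +ₑ const 1))
      (ite ((reg 20 =ₑ reg 5) *ₑ (reg 21 =ₑ reg 6))
        (assignCongr (reg 23 +ₑ reg 17) (reg 22))
        (assignCongr (reg 23) (reg 22 +ₑ reg 17))))
    (ite (reg 2 <ₑ const 3)
      (assignCongr (reg 23) (reg 22 +ₑ reg 17))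
      (ite (reg 21 =ₑ const 0)
        (ite (reg 2 %ₑ const 2 =ₑ const 1)
          (assignCongr (reg 23 +ₑ const 2 *ₑ reg 17) (reg 22 +ₑ const 1))
          (ite (reg 2 %ₑ const 4 =ₑ const 0)
            (ite (reg 17 <ₑ reg 2 /ₑ const 2)
              (assignCongr (reg 23 +ₑ const 2 *ₑ reg 17) (reg 22 +ₑ const 1))
              (assignCongr (reg 23 +ₑ const 2 *ₑ reg 17) (reg 22)))
            (ite (reg 17 %ₑ const 2 =ₑ const 0)
              (assignCongr (reg 23 +ₑ const 2 *ₑ reg 17) (reg 22 +ₑ const 1))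
              (assignCongr (reg 23 +ₑ const 2 *ₑ reg 17) (reg 22 +ₑ const 2)))))
        (ite (reg 20 =ₑ const 0)
          (ite ((reg 2 %ₑ const 4 =ₑ const 2) *ₑ (reg 17 %ₑ const 2 =ₑ const 0) *ₑ
              ((reg 22 =ₑ const 0) +ₑ (reg 22 =ₑ const 2)))
            (assignCongr (reg 23 +ₑ reg 22) (reg 17 +ₑ const 2))
            (assignCongr (reg 23) (reg 22 +ₑ reg 17)))
          (ite (reg 2 %ₑ const 4 =ₑ const 0)
            (ite (reg 17 <ₑ reg 2 /ₑ const 2)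
              (assignCongr (reg 23) (reg 22 +ₑ reg 17))
              (ite (reg 17 +ₑ const 1 <ₑ reg 2)
                (assignCongr (reg 23) (reg 22 +ₑ (reg 17 +ₑ const 1)))
                (assignCongr (reg 23) (reg 22 +ₑ reg 2 /ₑ const 2))))
            (ite ((reg 2 %ₑ const 4 =ₑ const 2) *ₑ
                (reg 22 %ₑ (reg 2 /ₑ const 2) =ₑ (reg 17 +ₑ const 1) %ₑ (reg 2 /ₑ const 2)))
              (assignCongr (reg 23) (reg 22 +ₑ (reg 17 +ₑ reg 2 /ₑ const 2)))
              (assignCongr (reg 23) (reg 22 +ₑ reg 17)))))))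

/-- Computes the index of the subgraph and the two vertices encoded by the loop counter, their parts
and their labels. -/
def decodeEntry : LoopProg :=
  assign 17 (reg 13 /ₑ reg 1 /ₑ reg 1) ;; assign 18 (reg 13 /ₑ reg 1 %ₑ reg 1) ;;
  assign 19 (reg 13 %ₑ reg 1) ;; assign 20 (read 6 (reg 18)) ;; assign 21 (read 6 (reg 19)) ;;
  assign 22 (read 7 (reg 18)) ;; assign 23 (read 7 (reg 19))

/-- Stores in register `24` whether there is an arc between the two vertices, which belong to
different parts. -/
def crossEntry : LoopProg :=
  ite (arcEntry 20 21)
    (ite (reg 22 <ₑ reg 2)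
      (ite (reg 23 <ₑ reg 2) ruleProg
        (assign 24 (reg 22 =ₑ (reg 17 +ₑ (const 1 -ₑ (reg 19 =ₑ reg 8))) %ₑ reg 2)))
      (assign 24 (reg 23 =ₑ (reg 17 +ₑ (const 1 -ₑ (reg 18 =ₑ reg 8)) +ₑ const 1) %ₑ reg 2)))
    (assign 24 (const 0))

/-- Computes one entry of the adjacency matrices of the packing, at the position in register
`13`. -/
def entryProg : LoopProg :=
  decodeEntry ;; crossEntry ;;
  ite ((reg 17 =ₑ const 0) *ₑ read 2 (reg 18 *ₑ reg 1 +ₑ reg 19)) (assign 24 (const 1)) skip ;;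
  write 5 (reg 13) (reg 24)

/-- Writes the packing. -/
def writePacking : LoopProg :=
  loop 13 14 (reg 2 *ₑ reg 1) (write 4 (reg 13) (const 1)) ;;
  loop 13 14 (reg 2 *ₑ reg 1 *ₑ reg 1) entryProg

/-- The first part of the program reads the orders of the parts. -/
def readOrders : LoopProg := fillParts ;; leastPart

/-- The second part of the program, for which `t`, the order of the composition, and the number of
subgraphs are known. -/
def findPacking : LoopProg :=
  findWalk ;; adjustLabels ;; markVertex ;; writePacking

/-- The constants used exceed `2` only in tests. -/
theorem wellFormed_readOrders : readOrders.wellFormed [0] = true := by decide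

theorem wellFormed_findPacking : findPacking.wellFormed [0, 1, 2] = true := by decide

theorem depth_readOrders : readOrders.depth = 2 := rfl

theorem depth_findPacking : findPacking.depth = 4 := rfl

theorem notMem_readOrders : (∀ r ∈ [0], r ∉ readOrders.assigns) ∧ 0 ∉ readOrders.writes := by
  decide

theorem notMem_findPacking :
    (∀ r ∈ [0, 1, 2], r ∉ findPacking.assigns) ∧ 0 ∉ findPacking.writes := by
  decide

/-! ### Evaluation of expressions -/

section Eval

variable (σ : State) (e e' : Expr)

@[simp] theorem eval_const (c : ℕ) : (const c).eval σ = c := rfl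

@[simp] theorem eval_reg (r : ℕ) : (reg r).eval σ = σ.reg r := rfl

@[simp] theorem eval_read (a : ℕ) : (read a e).eval σ = σ.arr a (e.eval σ) := rfl

@[simp] theorem eval_add : (e +ₑ e').eval σ = e.eval σ + e'.eval σ := rfl

@[simp] theorem eval_sub : (e -ₑ e').eval σ = e.eval σ - e'.eval σ := rfl

@[simp] theorem eval_mul : (e *ₑ e').eval σ = e.eval σ * e'.eval σ := rfl

@[simp] theorem eval_div : (e /ₑ e').eval σ = e.eval σ / e'.eval σ := rfl

@[simp] theorem eval_mod : (e %ₑ e').eval σ = e.eval σ % e'.eval σ := rfl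

theorem eval_eq : (e =ₑ e').eval σ = if e.eval σ = e'.eval σ then 1 else 0 := rfl

@[simp] theorem eval_eq_eq_zero : (e =ₑ e').eval σ = 0 ↔ e.eval σ ≠ e'.eval σ := by
  rw [eval_eq]
  split_ifs <;> simp_all

@[simp] theorem eval_lt_eq_zero : (e <ₑ e').eval σ = 0 ↔ ¬ e.eval σ < e'.eval σ := by
  change (if e.eval σ < e'.eval σ then 1 else 0) = 0 ↔ _
  split_ifs <;> simp_all

@[simp] theorem one_sub_eval_eq_eq_zero : 1 - (e =ₑ e').eval σ = 0 ↔ e.eval σ = e'.eval σ := by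
  rw [eval_eq]
  split_ifs <;> simp_all

end Eval

/-! ### The program for the rules -/

/-- The rule computed by the program. -/
def planRule (f p q r w m : ℕ) : ℕ → ℕ → ℕ → ℕ → ℕ → Prop :=
  if f ≠ 0 then evenRule p q r w m else if m < 3 then shiftRule m else triangleRule m

/-- The number `x` is the truth value of `P`. -/
def IsBit (x : ℕ) (P : Prop) : Prop := (P → x = 1) ∧ (¬ P → x = 0)

theorem isBit_run_ruleProg (σ : State) :
    IsBit ((ruleProg.run σ).reg 24) (planRule (σ.reg 3) (σ.reg 4) (σ.reg 5) (σ.reg 6) (σ.reg 7)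
      (σ.reg 2) (σ.reg 17) (σ.reg 20) (σ.reg 21) (σ.reg 22) (σ.reg 23)) := by
  have key : ∀ e e' : Expr, IsBit (((assignCongr e e').run σ).reg 24)
      (e.eval σ % σ.reg 2 = e'.eval σ % σ.reg 2) := fun e e' => by
    simp only [assignCongr, LoopProg.run, Expr.eval, Op.eval, State.setReg_reg, if_true]
    exact ⟨fun h => if_pos h, fun h => if_neg h⟩
  have ite' : ∀ (e : Expr) (p q : LoopProg) (c a b : Prop) [Decidable c], (e.eval σ ≠ 0 ↔ c) →
      IsBit ((p.run σ).reg 24) a → IsBit ((q.run σ).reg 24) b →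
      IsBit (((LoopProg.ite e p q).run σ).reg 24) (if c then a else b) := by
    intro e p q c a b _ he hp hq
    simp only [LoopProg.run, he]
    by_cases hc : c <;> simpa [hc]
  unfold planRule
  simp only [ite_apply]
  refine ite' _ _ _ _ _ _ Iff.rfl ?_ ?_
  · refine ite' _ _ _ _ _ _ ?_ (key _ _) (ite' _ _ _ _ _ _ ?_ (key _ _) (key _ _)) <;>
      simp
  refine ite' _ _ _ _ _ _ (by simp) (key _ _) ?_
  unfold triangleRule
  refine ite' _ _ _ _ _ _ (by simp) ?_ ?_
  · refine ite' _ _ _ _ _ _ (by simp) (key _ _) ?_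
    refine ite' _ _ _ _ _ _ (by simp) ?_ ?_
    · exact ite' _ _ _ _ _ _ (by simp) (key _ _) (key _ _)
    · exact ite' _ _ _ _ _ _ (by simp) (key _ _) (key _ _)
  · refine ite' _ _ _ _ _ _ (by simp) ?_ ?_
    · refine ite' _ _ _ _ _ _ ?_ (key _ _) (key _ _)
      simp
      tauto
    · refine ite' _ _ _ _ _ _ (by simp) ?_ ?_
      · refine ite' _ _ _ _ _ _ (by simp) (key _ _) ?_
        exact ite' _ _ _ _ _ _ (by simp) (key _ _) (key _ _)
      · refine ite' _ _ _ _ _ _ (by simp) (key _ _) (key _ _)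

end Program

/-! ### Correctness of the program -/

section Correctness

open StrongPacking.Expr StrongPacking.LoopProg

variable {t : ℕ} {n : Fin t → ℕ} {D : Digraph (Fin t)} {H : ∀ i, Digraph (Fin (n i))} {m : ℕ}
  {S : Finset (Σ i : Fin t, Fin (n i))}

theorem IsBit.eq_zero_iff {x : ℕ} {P : Prop} (h : IsBit x P) : x = 0 ↔ ¬ P :=
  ⟨fun h0 hP => by rw [h.1 hP] at h0; exact one_ne_zero h0, h.2⟩

theorem IsBit.eq_one_iff {x : ℕ} {P : Prop} (h : IsBit x P) : x = 1 ↔ P :=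
  ⟨fun h1 => by_contra fun hP => by rw [h.2 hP] at h1; exact zero_ne_one h1, h.1⟩

theorem num_lt (x : Σ i : Fin t, Fin (n i)) : num x < order n := (finSigmaFinEquiv x).2

theorem num_injective : Function.Injective (num : (Σ i : Fin t, Fin (n i)) → ℕ) :=
  Fin.val_injective.comp finSigmaFinEquiv.injective

theorem exists_num_eq {k : ℕ} (hk : k < order n) : ∃ x : Σ i : Fin t, Fin (n i), num x = k :=
  ⟨finSigmaFinEquiv.symm ⟨k, hk⟩, by simp [num]⟩

theorem mul_add_div {a b c : ℕ} (hb : b < c) : (a * c + b) / c = a := by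
  rw [mul_comm, Nat.mul_add_div (by omega), Nat.div_eq_of_lt hb, add_zero]

theorem mul_add_mod {a b c : ℕ} (hb : b < c) : (a * c + b) % c = b := by
  rw [Nat.mul_add_mod_self_right, Nat.mod_eq_of_lt hb]

theorem div_mul_add_mod (k c : ℕ) : k / c * c + k % c = k := Nat.div_add_mod' k c

/-! ### The input -/

theorem input_arr_zero (i : Fin t) : (input D H S).arr 0 i = n i := by simp [input]

theorem input_arr_one (i j : Fin t) : IsBit ((input D H S).arr 1 (i * t + j)) (D.Adj i j) := by
  constructor
  · intro h
    exact if_pos ⟨i, j, rfl, h⟩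
  · intro h
    refine if_neg ?_
    rintro ⟨i', j', he, h'⟩
    have h1 := congrArg (· / t) he
    have h2 := congrArg (· % t) he
    simp only [mul_add_div j.2, mul_add_div j'.2, mul_add_mod j.2, mul_add_mod j'.2] at h1 h2
    rw [Fin.ext h1, Fin.ext h2] at h
    exact h h'

theorem input_arr_two (x y : Σ i : Fin t, Fin (n i)) :
    IsBit ((input D H S).arr 2 (num x * order n + num y)) (PartArc H x y) := by
  constructor
  · rintro ⟨i, a, b, rfl, rfl, h⟩
    exact if_pos ⟨i, a, b, rfl, h⟩
  · intro h
    refine if_neg ?_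
    rintro ⟨i, a, b, he, hab⟩
    have h1 := congrArg (· / order n) he
    have h2 := congrArg (· % order n) he
    simp only [mul_add_div (num_lt _), mul_add_mod (num_lt _)] at h1 h2
    exact h ⟨i, a, b, num_injective h1, num_injective h2, hab⟩

theorem bounded_input (ht : 2 ≤ t) (hn : ∀ i, 1 ≤ n i) :
    t ≤ order n ∧ (∀ i, (input D H S).arr 0 i ≤ order n) ∧
      (input D H S).Bounded (order n) := by
  have hto : t ≤ order n := by
    calc t = ∑ _i : Fin t, 1 := by simp
      _ ≤ order n := Finset.sum_le_sum fun i _ => hn i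
  have h0 : ∀ i, (input D H S).arr 0 i ≤ order n := by
    intro i
    simp only [input]
    split_ifs
    · exact Finset.single_le_sum (f := n) (fun _ _ => Nat.zero_le _) (Finset.mem_univ _)
    · exact Nat.zero_le _
  refine ⟨hto, h0, fun r => ?_, fun a i => ?_⟩
  · simp only [input]
    split_ifs <;> omega
  · match a with
    | 0 => exact h0 i
    | 1 | 2 | 3 =>
      simp only [input]
      split_ifs <;> omega
    | a + 4 => simp [input]

/-! ### The orders of the parts -/

/-- The number of vertices in the first `k` parts. -/
def partOffset (n : Fin t → ℕ) (k : ℕ) : ℕ :=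
  ∑ i ∈ Finset.range k, if h : i < t then n ⟨i, h⟩ else 0

theorem num_eq_partOffset_add (x : Σ i : Fin t, Fin (n i)) : num x = partOffset n x.1 + x.2 := by
  rw [num, finSigmaFinEquiv_apply, partOffset, Finset.sum_range]
  congr 1
  refine Finset.sum_congr rfl fun i _ => ?_
  rw [dif_pos (i.2.trans x.1.2)]
  rfl

theorem partOffset_eq_order : partOffset n t = order n := by
  rw [partOffset, Finset.sum_range, order]
  exact Finset.sum_congr rfl fun i _ => dif_pos i.2

theorem partOffset_succ (i : Fin t) : partOffset n (i + 1) = partOffset n i + n i := by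
  rw [partOffset, Finset.sum_range_succ, dif_pos i.2]
  rfl

theorem run_fillParts {σ : State} (h0 : ∀ i : Fin t, σ.arr 0 i = n i) (ht : σ.reg 0 = t)
    (h1 : σ.reg 1 = 0) :
    (fillParts.run σ).reg 1 = order n ∧
      ∀ x : Σ i : Fin t, Fin (n i), (fillParts.run σ).arr 6 (num x) = x.1 ∧
        (fillParts.run σ).arr 7 (num x) = x.2 := by
  have := run_loop_induct (i := 13) (b := 14) (e := reg 0) (σ := σ)
    (p := loop 15 16 (read 0 (reg 13))
      (.seq (write 6 (reg 1) (reg 13)) (.seq (write 7 (reg 1) (reg 15))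
        (assign 1 (.op .add (reg 1) (const 1))))))
    (fun k τ => τ.reg 1 = partOffset n k ∧ ∀ x : Σ i : Fin t, Fin (n i), x.1 < k →
      τ.arr 6 (num x) = x.1 ∧ τ.arr 7 (num x) = x.2) ?_ ?_
  · simp only [eval_reg, ht, partOffset_eq_order] at this
    exact ⟨this.1, fun x => this.2 x x.1.2⟩
  · simp [h1, partOffset]
  · rintro k τ hk hτ - harr ⟨hτ1, hτ2⟩
    simp only [eval_reg, ht] at hk
    have hn : (read 0 (reg 13)).eval τ = n ⟨k, hk⟩ := by
      rw [eval_read, eval_reg, hτ, harr 0 (by decide), ← h0 ⟨k, hk⟩]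
    have := run_loop_induct (i := 15) (b := 16) (e := read 0 (reg 13)) (σ := τ)
      (p := .seq (write 6 (reg 1) (reg 13)) (.seq (write 7 (reg 1) (reg 15))
        (assign 1 (.op .add (reg 1) (const 1)))))
      (fun l ρ => ρ.reg 1 = partOffset n k + l ∧ ∀ x : Σ i : Fin t, Fin (n i),
        (x.1 < k ∨ (x.1 = k ∧ x.2 < l)) → ρ.arr 6 (num x) = x.1 ∧ ρ.arr 7 (num x) = x.2) ?_ ?_
    · rw [hn] at this
      refine ⟨?_, fun x hx => ?_⟩
      · simp only [State.setReg_reg]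
        rw [if_neg (by decide), this.1]
        exact (partOffset_succ ⟨k, hk⟩).symm
      · refine this.2 x ?_
        by_cases hxk : x.1 < k
        · exact .inl hxk
        · obtain ⟨i, a⟩ := x
          obtain rfl : i = ⟨k, hk⟩ := Fin.ext (by simp only at hx hxk ⊢; omega)
          exact .inr ⟨rfl, a.2⟩
    · simp only [State.setReg_reg, State.setReg_arr]
      refine ⟨by simp [hτ1], fun x hx => hτ2 x (by omega)⟩
    · rintro l ρ hl hρ hreg - ⟨hρ1, hρ2⟩
      have hρ13 : ρ.reg 13 = k := by rw [hreg 13 (by decide), hτ]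
      rw [hn] at hl
      have hnum : partOffset n k + l = num (⟨⟨k, hk⟩, ⟨l, hl⟩⟩ : Σ i : Fin t, Fin (n i)) := by
        rw [num_eq_partOffset_add]
      refine ⟨by simp [LoopProg.run, hρ1, add_assoc], fun x hx => ?_⟩
      by_cases hxe : x = ⟨⟨k, hk⟩, ⟨l, hl⟩⟩
      · subst hxe
        simp [LoopProg.run, hρ1, hρ, hρ13, hnum]
      · have hne : ¬ num x = partOffset n k + l := fun h => hxe (num_injective (h.trans hnum))
        have := hρ2 x (by
          rcases hx with hx | ⟨hx, hxl⟩
          · exact .inl hx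
          · refine .inr ⟨hx, ?_⟩
            obtain ⟨i, a⟩ := x
            obtain rfl : i = ⟨k, hk⟩ := Fin.ext hx
            have : a.val ≠ l := fun h => hxe (by
              congr
              exact Fin.ext h)
            simp only at hxl ⊢
            omega)
        simpa [LoopProg.run, hρ1, hne] using this

theorem run_leastPart {σ : State} (h0 : ∀ i : Fin t, σ.arr 0 i = n i) (ht : σ.reg 0 = t)
    (h2 : 2 ≤ t) : (leastPart.run σ).reg 2 = ⨅ i, n i := by
  have : Nonempty (Fin t) := ⟨⟨0, by omega⟩⟩
  have := run_loop_induct (i := 13) (b := 14) (e := reg 0) (σ := σ.setReg 2 (σ.arr 0 0))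
    (p := .ite (.op .lt (read 0 (reg 13)) (reg 2)) (assign 2 (read 0 (reg 13))) skip)
    (fun k τ => (∀ i : Fin t, i < k → τ.reg 2 ≤ n i) ∧ ∃ i, τ.reg 2 = n i) ?_ ?_
  · simp only [eval_reg, State.setReg_reg] at this
    rw [if_neg (by decide), ht] at this
    obtain ⟨h1, i, hi⟩ := this
    refine le_antisymm (le_ciInf fun i => h1 i i.2) ?_
    refine (ciInf_le (OrderBot.bddBelow _) i).trans ?_
    exact hi.symm.le
  · exact ⟨fun i hi => absurd hi (by omega), ⟨0, by omega⟩, by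
      simpa using h0 ⟨0, by omega⟩⟩
  · rintro k τ hk hτ - harr ⟨h1, j, hj⟩
    simp only [eval_reg, State.setReg_reg] at hk
    rw [if_neg (by decide), ht] at hk
    have hk0 : τ.arr 0 k = n ⟨k, hk⟩ := by
      rw [harr 0 (by decide), State.setReg_arr, ← h0 ⟨k, hk⟩]
    simp only [LoopProg.run, ne_eq, eval_lt_eq_zero, eval_read, eval_reg, hτ, hk0, not_not]
    have hsplit : ∀ i : Fin t, i < k + 1 → i < k ∨ i = ⟨k, hk⟩ := fun i hi => by
      rcases Nat.lt_succ_iff_lt_or_eq.mp hi with h | h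
      · exact .inl h
      · exact .inr (Fin.ext h)
    split_ifs with hlt
    · refine ⟨fun i hi => ?_, ⟨k, hk⟩, by simp⟩
      simp only [State.setReg_reg]
      rcases hsplit i hi with h | rfl
      · have := h1 i h
        simp
        omega
      · simp
    · refine ⟨fun i hi => ?_, j, by simpa using hj⟩
      simp only [State.setReg_reg]
      rcases hsplit i hi with h | rfl
      · simpa using h1 i h
      · simpa using hlt

/-! ### The search for an even closed walk -/

theorem walkTest_iff {σ : State} (ht : σ.reg 0 = t)
    (hD : ∀ i j : Fin t, IsBit (σ.arr 1 (i * t + j)) (D.Adj i j)) {p q r w : Fin t}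
    (hp : σ.reg 17 = p) (hq : σ.reg 18 = q) (hr : σ.reg 19 = r) (hw : σ.reg 20 = w) :
    walkTest.eval σ ≠ 0 ↔ IsEvenWalk D p q r w := by
  simp only [walkTest, arcEntry, eval_mul, eval_add, eval_read, eval_reg, eval_sub, eval_const,
    ht, hp, hq, hr, hw, ne_eq, Nat.mul_eq_zero, Nat.add_eq_zero_iff, (hD _ _).eq_zero_iff,
    eval_eq_eq_zero, one_sub_eval_eq_eq_zero, IsEvenWalk, Fin.val_inj]
  tauto

theorem run_findWalk {σ : State} (ht : σ.reg 0 = t) (h3 : σ.reg 3 = 0)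
    (hD : ∀ i j : Fin t, IsBit (σ.arr 1 (i * t + j)) (D.Adj i j)) :
    ((findWalk.run σ).reg 3 ≠ 0 ∧ ∃ p q r w : Fin t, IsEvenWalk D p q r w ∧
      (findWalk.run σ).reg 4 = p ∧ (findWalk.run σ).reg 5 = q ∧ (findWalk.run σ).reg 6 = r ∧
      (findWalk.run σ).reg 7 = w) ∨
    ((findWalk.run σ).reg 3 = 0 ∧ ∀ p q r w, ¬ IsEvenWalk D p q r w) := by
  have := run_loop_induct (i := 13) (b := 14) (σ := σ)
    (p := .seq decodeWalk (.ite walkTest storeWalk skip))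
    (e := .op .mul (.op .mul (.op .mul (reg 0) (reg 0)) (reg 0)) (reg 0))
    (fun k τ => (τ.reg 3 ≠ 0 ∧ ∃ p q r w : Fin t, IsEvenWalk D p q r w ∧
      τ.reg 4 = p ∧ τ.reg 5 = q ∧ τ.reg 6 = r ∧ τ.reg 7 = w) ∨
      (τ.reg 3 = 0 ∧ ∀ p q r w : Fin t, ((p * t + q) * t + r) * t + w < k →
        ¬ IsEvenWalk D p q r w)) ?_ ?_
  · refine this.imp_right fun h => ⟨h.1, fun p q r w => h.2 p q r w ?_⟩
    simp only [eval_mul, eval_reg, ht]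
    have hstep : ∀ {a b c : ℕ}, a < b → c < t → a * t + c < b * t := fun {a b c} hab hc => by
      have := Nat.mul_le_mul_right t (Nat.succ_le_of_lt hab)
      rw [Nat.succ_mul] at this
      omega
    exact hstep (hstep (hstep p.2 q.2) r.2) w.2
  · refine .inr ⟨by simp [h3], fun p q r w h => absurd h (by omega)⟩
  · intro k τ hk hτ hreg harr h
    simp only [eval_mul, eval_reg, ht] at hk
    have ht0 : 0 < t := Nat.pos_of_ne_zero fun h0 => by simp [h0] at hk
    have hτ0 : τ.reg 0 = t := by rw [hreg 0 (by decide), ht]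
    have hp : k / t / t / t < t := by
      rwa [Nat.div_lt_iff_lt_mul ht0, Nat.div_lt_iff_lt_mul ht0, Nat.div_lt_iff_lt_mul ht0]
    obtain ⟨ρ, hρ⟩ : ∃ ρ, ρ = decodeWalk.run τ := ⟨_, rfl⟩
    have h17 : ρ.reg 17 = k / t / t / t := by simp [hρ, decodeWalk, LoopProg.run, hτ, hτ0]
    have h18 : ρ.reg 18 = k / t / t % t := by simp [hρ, decodeWalk, LoopProg.run, hτ, hτ0]
    have h19 : ρ.reg 19 = k / t % t := by simp [hρ, decodeWalk, LoopProg.run, hτ, hτ0]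
    have h20 : ρ.reg 20 = k % t := by simp [hρ, decodeWalk, LoopProg.run, hτ, hτ0]
    have hkeep : ∀ r ∉ decodeWalk.assigns, ρ.reg r = τ.reg r := fun r hr => by
      rw [hρ, run_reg_of_notMem _ _ hr]
    have hiff := walkTest_iff (D := D) (σ := ρ) (p := ⟨_, hp⟩)
      (q := ⟨_, Nat.mod_lt (k / t / t) ht0⟩) (r := ⟨_, Nat.mod_lt (k / t) ht0⟩)
      (w := ⟨_, Nat.mod_lt k ht0⟩) (by rw [hkeep 0 (by decide), hτ0])
      (fun i j => by
        rw [hρ, run_arr_of_notMem _ _ (by decide), harr 1 (by decide)]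
        exact hD i j) h17 h18 h19 h20
    simp only [LoopProg.run, ← hρ, hiff]
    split_ifs with hw <;> rw [← hρ, hiff] at hw
    · exact .inl ⟨by simp [storeWalk, LoopProg.run], _, _, _, _, hw,
        by simp [storeWalk, LoopProg.run, h17, h18, h19, h20]⟩
    · simp only [State.setReg_reg, Nat.reduceEqDiff, if_false, hkeep 3 (by decide),
        hkeep 4 (by decide), hkeep 5 (by decide), hkeep 6 (by decide), hkeep 7 (by decide)]
      refine h.imp_right fun h => ⟨h.1, fun p q r w hlt => ?_⟩
      rcases Nat.lt_succ_iff_lt_or_eq.mp hlt with h' | rfl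
      · exact h.2 p q r w h'
      · simp only [mul_add_div q.2, mul_add_div r.2, mul_add_div w.2,
          mul_add_mod q.2, mul_add_mod r.2, mul_add_mod w.2] at hw
        exact hw

end Correctness

section Correctness

open StrongPacking.Expr StrongPacking.LoopProg

variable {t : ℕ} {n : Fin t → ℕ} {D : Digraph (Fin t)} {H : ∀ i, Digraph (Fin (n i))} {m : ℕ}

/-- The state holds the composition and the number of subgraphs. -/
structure IsLoaded (D : Digraph (Fin t)) (H : ∀ i, Digraph (Fin (n i))) (m : ℕ) (σ : State) :
    Prop where
  reg_zero : σ.reg 0 = t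
  reg_one : σ.reg 1 = order n
  reg_two : σ.reg 2 = m
  arc : ∀ i j : Fin t, IsBit (σ.arr 1 (i * t + j)) (D.Adj i j)
  partArc : ∀ x y : Σ i : Fin t, Fin (n i),
    IsBit (σ.arr 2 (num x * order n + num y)) (PartArc H x y)
  part : ∀ x : Σ i : Fin t, Fin (n i), σ.arr 6 (num x) = x.1

theorem IsLoaded.congr {σ τ : State} (h : IsLoaded D H m σ) (h0 : τ.reg 0 = σ.reg 0)
    (h1 : τ.reg 1 = σ.reg 1) (h2 : τ.reg 2 = σ.reg 2) (a1 : τ.arr 1 = σ.arr 1)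
    (a2 : τ.arr 2 = σ.arr 2) (a6 : τ.arr 6 = σ.arr 6) : IsLoaded D H m τ where
  reg_zero := h0.trans h.reg_zero
  reg_one := h1.trans h.reg_one
  reg_two := h2.trans h.reg_two
  arc := a1 ▸ h.arc
  partArc := a2 ▸ h.partArc
  part := a6 ▸ h.part

theorem IsLoaded.run {σ : State} (h : IsLoaded D H m σ) (p : LoopProg)
    (hr : ∀ r ∈ [0, 1, 2], r ∉ p.assigns) (ha : ∀ a ∈ [1, 2, 6], a ∉ p.writes) :
    IsLoaded D H m (p.run σ) :=
  h.congr (run_reg_of_notMem p 0 (hr 0 (by decide)) σ) (run_reg_of_notMem p 1 (hr 1 (by decide)) σ)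
    (run_reg_of_notMem p 2 (hr 2 (by decide)) σ) (run_arr_of_notMem p 1 (ha 1 (by decide)) σ)
    (run_arr_of_notMem p 2 (ha 2 (by decide)) σ) (run_arr_of_notMem p 6 (ha 6 (by decide)) σ)

/-- The contents of array `7`. -/
def State.label (n : Fin t → ℕ) (σ : State) (z : Σ i : Fin t, Fin (n i)) : ℕ := σ.arr 7 (num z)

/-! ### The labels for two subgraphs and the 3-cycle -/

theorem run_findPair {σ : State} {test : Expr} {r r' : ℕ}
    {T : (Σ i : Fin t, Fin (n i)) → (Σ i : Fin t, Fin (n i)) → Prop} (h1 : σ.reg 1 = order n)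
    (hr : r ∉ [1, 13, 14]) (hr' : r' ∉ [1, 13, 14]) (hrr : r ≠ r')
    (htest : ∀ τ : State, ∀ x y, τ.reg 13 = num x * order n + num y →
      (∀ q ∉ [13, 14, r, r'], τ.reg q = σ.reg q) → τ.arr = σ.arr → (test.eval τ ≠ 0 ↔ T x y))
    (hT : ∃ x y, T x y) :
    ∃ x y, T x y ∧ ((findPair test r r').run σ).reg r = num x ∧
      ((findPair test r r').run σ).reg r' = num y := by
  simp only [List.mem_cons, List.not_mem_nil, or_false, not_or] at hr hr'
  have := run_loop_induct (i := 13) (b := 14) (σ := σ) (e := .op .mul (reg 1) (reg 1))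
    (p := .ite test (.seq (assign r (.op .div (reg 13) (reg 1)))
      (assign r' (.op .mod (reg 13) (reg 1)))) skip)
    (fun k τ => (∃ x y, T x y ∧ τ.reg r = num x ∧ τ.reg r' = num y) ∨
      ∀ x y : Σ i : Fin t, Fin (n i), num x * order n + num y < k → ¬ T x y) ?_ ?_
  · refine this.resolve_right fun h => ?_
    obtain ⟨x, y, hxy⟩ := hT
    refine h x y ?_ hxy
    have := Nat.mul_le_mul_right (order n) (Nat.succ_le_of_lt (num_lt x))
    have := num_lt y
    rw [Nat.succ_mul] at *
    simp only [eval_mul, eval_reg, h1]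
    omega
  · exact .inr fun x y h => absurd h (by omega)
  · intro k τ hk hτ hreg harr h
    simp only [eval_mul, eval_reg, h1] at hk
    have hN : 0 < order n := Nat.pos_of_ne_zero fun h0 => by simp [h0] at hk
    have hτ1 : τ.reg 1 = order n := by
      rw [hreg 1, h1]
      simpa [assigns, eq_comm] using ⟨hr.1, hr'.1⟩
    obtain ⟨x, hx⟩ := exists_num_eq (n := n) ((Nat.div_lt_iff_lt_mul hN).mpr hk)
    obtain ⟨y, hy⟩ := exists_num_eq (n := n) (Nat.mod_lt k hN)
    have hiff := htest τ x y (by rw [hx, hy, div_mul_add_mod, hτ])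
      (fun q hq => hreg q (by simpa [assigns] using hq))
      (funext fun a => harr a (by simp [writes]))
    by_cases hw : T x y
    · refine .inl ⟨x, y, hw, ?_⟩
      rw [LoopProg.run, if_pos (hiff.mpr hw)]
      simp [LoopProg.run, hr, hr', hrr, hx, hy, Ne.symm hr.1, Ne.symm hr.2.1, hτ, hτ1]
    · rw [LoopProg.run, if_neg (mt hiff.mp hw)]
      simp only [LoopProg.run, State.setReg_reg, hr.2.1, hr'.2.1, if_false]
      refine h.imp_right fun h => fun x' y' hlt => ?_
      rcases Nat.lt_succ_iff_lt_or_eq.mp hlt with h' | h'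
      · exact h x' y' h'
      · rw [← h', mul_add_div (num_lt _)] at hx
        rw [← h', mul_add_mod (num_lt _)] at hy
        rwa [num_injective hx, num_injective hy] at hw

theorem run_clearLabels {σ : State} (h : IsLoaded D H m σ) {x : Σ i : Fin t, Fin (n i)}
    (h9 : σ.reg 9 = num x) (z : Σ i : Fin t, Fin (n i)) :
    (clearLabels.run σ).label n z = if z.1 = x.1 then 2 else σ.label n z := by
  have := run_loop_induct (i := 13) (b := 14) (σ := σ) (e := reg 1)
    (p := .ite (.op .eq (read 6 (reg 13)) (read 6 (reg 9))) (write 7 (reg 13) (const 2)) skip)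
    (fun k τ => ∀ z : Σ i : Fin t, Fin (n i),
      τ.arr 7 (num z) = if num z < k ∧ z.1 = x.1 then 2 else σ.arr 7 (num z)) ?_ ?_
  · have := this z
    simp only [eval_reg, h.reg_one, num_lt, true_and] at this
    exact this
  · simp
  · intro k τ hk hτ hreg harr hz z
    simp only [eval_reg, h.reg_one] at hk
    obtain ⟨v, hv⟩ := exists_num_eq (n := n) hk
    have h9' : τ.reg 9 = num x := by rw [hreg 9 (by decide), h9]
    simp only [LoopProg.run, ne_eq, eval_eq_eq_zero, eval_read, eval_reg, hτ, h9',
      harr 6 (by decide), not_not, ← hv, h.part, Fin.val_inj]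
    by_cases hzv : z = v
    · subst hzv
      split_ifs with h1 h2 h2
      · simp [hv]
      · exact absurd ⟨by omega, h1⟩ h2
      · exact absurd h2.2 h1
      · simp only [State.setReg_arr]
        rw [hz z, if_neg (fun h => h1 h.2)]
    · have hne : num z ≠ num v := fun h => hzv (num_injective h)
      have hlt : num z < num v + 1 ↔ num z < k := by omega
      have : ((if v.1 = x.1 then τ.setArr 7 (τ.reg 13) ((const 2).eval τ) else τ).setReg 13
          (num v + 1)).arr 7 (num z) = τ.arr 7 (num z) := by
        split_ifs
        · simp [hτ, ← hv, hne]
        · simp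
      simp only [hlt, ← hz z]
      rw [← this, hτ, hv]

theorem isLabelling_relabel {σ : State} (h : IsLoaded D H m σ)
    (hσ : ∀ z : Σ i : Fin t, Fin (n i), σ.label n z = z.2) (h67 : order n = 6 ∨ order n = 7)
    (hex : ∃ x y, PartArc H x y ∧
      (order n = 6 → ∃ x' y', PartArc H x' y' ∧ ¬ (x' = x ∧ y' = y))) :
    IsLabelling H ((relabel.run σ).label n) := by
  obtain ⟨σ₁, hσ₁⟩ : ∃ ρ, ρ = (findPair (read 2 (reg 13)) 9 10).run σ := ⟨_, rfl⟩
  obtain ⟨σ₂, hσ₂⟩ : ∃ ρ, ρ = (findPair (.op .mul (read 2 (reg 13)) (.op .sub (const 1)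
    (.op .eq (reg 13) (.op .add (.op .mul (reg 9) (reg 1)) (reg 10))))) 11 12).run σ₁ := ⟨_, rfl⟩
  obtain ⟨σ₃, hσ₃⟩ : ∃ ρ, ρ = clearLabels.run σ₂ := ⟨_, rfl⟩
  have l₁ : IsLoaded D H m σ₁ := hσ₁ ▸ h.run _ (by decide) (by decide)
  have l₂ : IsLoaded D H m σ₂ := hσ₂ ▸ l₁.run _ (by decide) (by decide)
  obtain ⟨x, y, hxy, h9, h10⟩ := run_findPair (n := n) (T := PartArc H) (r := 9) (r' := 10)
    (test := read 2 (reg 13)) h.reg_one (by decide) (by decide) (by decide)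
    (fun τ x y h13 _ harr => by
      rw [eval_read, eval_reg, h13, harr, ne_eq, (h.partArc x y).eq_zero_iff, not_not])
    (by
      obtain ⟨x, y, hxy, -⟩ := hex
      exact ⟨x, y, hxy⟩)
  rw [← hσ₁] at h9 h10
  have hsecond : order n = 6 → ∃ x' y', (PartArc H x' y' ∧ ¬ (x' = x ∧ y' = y)) ∧
      σ₂.reg 11 = num x' ∧ σ₂.reg 12 = num y' := by
    intro h6
    rw [hσ₂]
    refine run_findPair (n := n) (T := fun x' y' => PartArc H x' y' ∧ ¬ (x' = x ∧ y' = y))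
      l₁.reg_one (by decide) (by decide) (by decide) (fun τ x' y' h13 hreg harr => ?_) ?_
    · have e1 : τ.reg 9 = num x := by rw [hreg 9 (by decide), h9]
      have e2 : τ.reg 10 = num y := by rw [hreg 10 (by decide), h10]
      have e3 : τ.reg 1 = order n := by rw [hreg 1 (by decide), l₁.reg_one]
      have hnum : num x' * order n + num y' = num x * order n + num y ↔ x' = x ∧ y' = y := by
        constructor
        · intro he
          have h1 := congrArg (· / order n) he
          have h2 := congrArg (· % order n) he
          simp only [mul_add_div (num_lt _), mul_add_mod (num_lt _)] at h1 h2
          exact ⟨num_injective h1, num_injective h2⟩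
        · rintro ⟨rfl, rfl⟩
          rfl
      simp only [eval_mul, eval_read, eval_reg, eval_sub, eval_const, ne_eq, Nat.mul_eq_zero,
        one_sub_eval_eq_eq_zero, eval_add, h13, harr, (l₁.partArc x' y').eq_zero_iff, e1, e2, e3,
        hnum]
      tauto
    · obtain ⟨u, v, huv, hex⟩ := hex
      obtain ⟨u', v', huv', hne⟩ := hex h6
      by_cases he : u = x ∧ v = y
      · exact ⟨u', v', huv', by rwa [← he.1, ← he.2]⟩
      · exact ⟨u, v, huv, he⟩
  have hlab₂ : ∀ z, σ₂.label n z = z.2 := fun z => by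
    rw [State.label, hσ₂, run_arr_of_notMem _ _ (by decide), hσ₁, run_arr_of_notMem _ _ (by decide)]
    exact hσ z
  have r9 : σ₃.reg 9 = num x := by
    rw [hσ₃, run_reg_of_notMem _ _ (by decide), hσ₂, run_reg_of_notMem _ _ (by decide), h9]
  have r10 : σ₃.reg 10 = num y := by
    rw [hσ₃, run_reg_of_notMem _ _ (by decide), hσ₂, run_reg_of_notMem _ _ (by decide), h10]
  have hlab₃ : ∀ z, σ₃.label n z = if z.1 = x.1 then 2 else (z.2 : ℕ) := fun z => by
    rw [hσ₃, run_clearLabels l₂ (x := x), hlab₂]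
    rw [← r9, hσ₃, run_reg_of_notMem _ _ (by decide)]
  obtain ⟨σ₄, hσ₄⟩ : ∃ ρ, ρ = (σ₃.setArr 7 (σ₃.reg 10) 0).setArr 7 (σ₃.reg 9) 1 := ⟨_, rfl⟩
  have hlab₄ : ∀ z, σ₄.label n z = arcLabel x y z := fun z => by
    have := hlab₃ z
    simp only [State.label] at this
    simp [State.label, hσ₄, r9, r10, num_injective.eq_iff, this, arcLabel]
  have r11 : σ₄.reg 11 = σ₂.reg 11 := by
    rw [hσ₄, State.setArr_reg, State.setArr_reg, hσ₃, run_reg_of_notMem _ _ (by decide)]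
  have r12 : σ₄.reg 12 = σ₂.reg 12 := by
    rw [hσ₄, State.setArr_reg, State.setArr_reg, hσ₃, run_reg_of_notMem _ _ (by decide)]
  have r1 : σ₄.reg 1 = order n := by
    rw [hσ₄, State.setArr_reg, State.setArr_reg, hσ₃, run_reg_of_notMem _ _ (by decide), l₂.reg_one]
  have hrun : relabel.run σ = if order n = 6 then
      (σ₄.setArr 7 (σ₂.reg 12) 1).setArr 7 (σ₂.reg 11) 0 else σ₄ := by
    have : relabel.run σ = (LoopProg.ite (.op .eq (reg 1) (const 6))
        (.seq (write 7 (reg 12) (const 1)) (write 7 (reg 11) (const 0))) skip).run σ₄ := by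
      rw [hσ₄, hσ₃, hσ₂, hσ₁]
      rfl
    rw [this]
    simp only [LoopProg.run, ne_eq, eval_eq_eq_zero, eval_reg, eval_const, r1, not_not,
      State.setArr_reg, r11, r12]
  rw [hrun]
  rcases h67 with h6 | h7
  · obtain ⟨x', y', ⟨hxy', hne⟩, h11, h12⟩ := hsecond h6
    refine .inr (.inr ⟨h6, x, y, x', y', hxy, hxy', hne, fun z => ?_⟩)
    rw [if_pos h6, ← hlab₄]
    simp [State.label, h11, h12, num_injective.eq_iff]
  · refine .inr (.inl ⟨h7, x, y, hxy, fun z => ?_⟩)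
    rw [if_neg (by omega), hlab₄]

theorem run_markVertex {σ : State} (h : IsLoaded D H m σ) (hex : ∃ v, m ≤ σ.label n v) :
    ∃ v, m ≤ σ.label n v ∧ (markVertex.run σ).reg 8 = num v := by
  have := run_loop_induct (i := 13) (b := 14) (σ := σ) (e := reg 1)
    (p := .ite (.op .lt (read 7 (reg 13)) (reg 2)) skip (assign 8 (reg 13)))
    (fun k τ => (∃ v : Σ i : Fin t, Fin (n i), m ≤ σ.label n v ∧ τ.reg 8 = num v) ∨
      ∀ v : Σ i : Fin t, Fin (n i), num v < k → σ.label n v < m) ?_ ?_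
  · refine this.resolve_right fun h' => ?_
    obtain ⟨v, hv⟩ := hex
    have := h' v (by simpa [h.reg_one] using num_lt v)
    omega
  · exact .inr fun v hv => absurd hv (by omega)
  · intro k τ hk hτ hreg harr hv
    simp only [eval_reg, h.reg_one] at hk
    obtain ⟨v, rfl⟩ := exists_num_eq (n := n) hk
    simp only [LoopProg.run, ne_eq, eval_lt_eq_zero, eval_read, eval_reg, hτ, harr 7 (by decide),
      hreg 2 (by decide), h.reg_two, not_not]
    split_ifs with hlt
    · refine hv.imp (fun h => by simpa using h) fun h w hw => ?_
      rcases Nat.lt_succ_iff_lt_or_eq.mp hw with h' | h'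
      · exact h w h'
      · rw [num_injective h']
        exact hlt
    · exact .inl ⟨v, not_lt.mp hlt, by simp⟩

end Correctness

/-! ### The output -/

section Output

open StrongPacking.Expr StrongPacking.LoopProg

variable {t : ℕ} {n : Fin t → ℕ} {D : Digraph (Fin t)} {H : ∀ i, Digraph (Fin (n i))} {m : ℕ}

/-- The values of `τ` given by the number of the marked vertex. -/
def State.mark (n : Fin t → ℕ) (σ : State) (z : Σ i : Fin t, Fin (n i)) : ℕ :=
  if num z = σ.reg 8 then 0 else 1

/-- The rule given by the registers `3` to `7`. -/
def State.rule (m : ℕ) (σ : State) : ℕ → ℕ → ℕ → ℕ → ℕ → Prop :=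
  planRule (σ.reg 3) (σ.reg 4) (σ.reg 5) (σ.reg 6) (σ.reg 7) m

theorem plan_congr {σ τ : State} (hr : ∀ r ∈ [3, 4, 5, 6, 7, 8], τ.reg r = σ.reg r)
    (ha : τ.arr 7 = σ.arr 7) :
    τ.rule m = σ.rule m ∧ τ.label n = σ.label n ∧ τ.mark n = σ.mark n := by
  refine ⟨?_, funext fun z => ?_, funext fun z => ?_⟩
  · simp [State.rule, hr]
  · simp [State.label, ha]
  · simp [State.mark, hr]

theorem run_decodeEntry {σ : State} (h : IsLoaded D H m σ) {s : ℕ}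
    {x y : Σ i : Fin t, Fin (n i)} (h13 : σ.reg 13 = (s * order n + num x) * order n + num y) :
    (decodeEntry.run σ).reg 17 = s ∧ (decodeEntry.run σ).reg 18 = num x ∧
      (decodeEntry.run σ).reg 19 = num y ∧ (decodeEntry.run σ).reg 20 = x.1 ∧
      (decodeEntry.run σ).reg 21 = y.1 ∧ (decodeEntry.run σ).reg 22 = σ.label n x ∧
      (decodeEntry.run σ).reg 23 = σ.label n y := by
  simp [decodeEntry, LoopProg.run, h13, h.reg_one, mul_add_div (num_lt y), mul_add_div (num_lt x),
    mul_add_mod (num_lt y), mul_add_mod (num_lt x), h.part, State.label]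

theorem isBit_assign {σ : State} {e e' : Expr} {P : Prop} (h : e.eval σ = e'.eval σ ↔ P) :
    IsBit (((assign 24 (.op .eq e e')).run σ).reg 24) P := by
  rw [LoopProg.run, State.setReg_reg, if_pos rfl, eval_eq]
  exact ⟨fun hP => if_pos (h.mpr hP), fun hP => if_neg (mt h.mp hP)⟩

theorem isBit_run_crossEntry {σ : State} (h : IsLoaded D H m σ) (hm : 0 < m)
    {x y : Σ i : Fin t, Fin (n i)} (h18 : σ.reg 18 = num x) (h19 : σ.reg 19 = num y)
    (h20 : σ.reg 20 = x.1) (h21 : σ.reg 21 = y.1) (h22 : σ.reg 22 = σ.label n x)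
    (h23 : σ.reg 23 = σ.label n y) :
    IsBit ((crossEntry.run σ).reg 24) (D.Adj x.1 y.1 ∧
      ((σ.label n x < m ∧ σ.label n y < m ∧
          σ.rule m (σ.reg 17) x.1 y.1 (σ.label n x) (σ.label n y)) ∨
        (m ≤ σ.label n x ∧ σ.label n y = (σ.reg 17 + σ.mark n x + 1) % m) ∨
        (m ≤ σ.label n y ∧ σ.label n x = (σ.reg 17 + σ.mark n y) % m))) := by
  have hlt : ∀ u, u % m < m := fun u => Nat.mod_lt _ hm
  have hmark : ∀ (r : ℕ) z, σ.reg r = num z →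
      1 - (Expr.op Op.eq (reg r) (reg 8)).eval σ = σ.mark n z := by
    intro r z hr
    rw [eval_eq, eval_reg, eval_reg, hr, State.mark]
    split_ifs <;> rfl
  have ite' : ∀ (e : Expr) (p q : LoopProg) (P : Prop),
      (e.eval σ ≠ 0 → IsBit ((p.run σ).reg 24) P) → (e.eval σ = 0 → IsBit ((q.run σ).reg 24) P) →
      IsBit (((LoopProg.ite e p q).run σ).reg 24) P := by
    intro e p q P hp hq
    rw [LoopProg.run]
    split_ifs with he
    exacts [hp he, hq (not_not.mp he)]
  refine ite' _ _ _ _ (fun hD => ?_) fun hD => ?_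
  · have hD' : D.Adj x.1 y.1 := by
      rw [arcEntry, eval_read, eval_add, eval_mul, eval_reg, eval_reg, eval_reg, h20, h21,
        h.reg_zero, ne_eq, (h.arc _ _).eq_zero_iff, not_not] at hD
      exact hD
    refine ite' _ _ _ _ (fun hx => ?_) fun hx => ?_
    · rw [ne_eq, eval_lt_eq_zero, eval_reg, eval_reg, h22, h.reg_two, not_not] at hx
      refine ite' _ _ _ _ (fun hy => ?_) fun hy => ?_
      · rw [ne_eq, eval_lt_eq_zero, eval_reg, eval_reg, h23, h.reg_two, not_not] at hy
        have := isBit_run_ruleProg σ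
        rw [h20, h21, h22, h23, h.reg_two] at this
        simpa [State.rule, hD', hx, hy, hx.not_ge, hy.not_ge] using this
      · rw [eval_lt_eq_zero, eval_reg, eval_reg, h23, h.reg_two] at hy
        refine isBit_assign ?_
        simp only [eval_reg, eval_mod, eval_add, eval_sub, eval_const, hmark 19 y h19, h22,
          h.reg_two]
        simp [hD', hy, not_lt.mp hy, hx.not_ge]
    · rw [eval_lt_eq_zero, eval_reg, eval_reg, h22, h.reg_two] at hx
      refine isBit_assign ?_
      simp only [eval_reg, eval_mod, eval_add, eval_sub, eval_const, hmark 18 x h18, h23,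
        h.reg_two]
      have hne : ∀ u, σ.label n x ≠ u % m := fun u hu => hx (hu ▸ hlt u)
      simp [hD', hx, not_lt.mp hx, hne]
  · have hD' : ¬ D.Adj x.1 y.1 := by
      rw [arcEntry, eval_read, eval_add, eval_mul, eval_reg, eval_reg, eval_reg, h20, h21,
        h.reg_zero, (h.arc _ _).eq_zero_iff] at hD
      exact hD
    refine ⟨fun h => (hD' h.1).elim, fun _ => ?_⟩
    rw [LoopProg.run, State.setReg_reg, if_pos rfl, eval_const]

theorem isBit_run_entryProg {σ : State} (h : IsLoaded D H m σ) (hm : 0 < m) {s : ℕ}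
    {x y : Σ i : Fin t, Fin (n i)} (h13 : σ.reg 13 = (s * order n + num x) * order n + num y) :
    IsBit ((entryProg.run σ).arr 5 (σ.reg 13))
        (LayerAdj D H m (σ.rule m) (σ.label n) (σ.mark n) s x y) ∧
      ∀ k ≠ σ.reg 13, (entryProg.run σ).arr 5 k = σ.arr 5 k := by
  obtain ⟨σ₁, hσ₁⟩ : ∃ ρ, ρ = decodeEntry.run σ := ⟨_, rfl⟩
  obtain ⟨σ₂, hσ₂⟩ : ∃ ρ, ρ = crossEntry.run σ₁ := ⟨_, rfl⟩
  obtain ⟨h17, h18, h19, h20, h21, h22, h23⟩ := run_decodeEntry h h13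
  rw [← hσ₁] at h17 h18 h19 h20 h21 h22 h23
  have l₁ : IsLoaded D H m σ₁ := hσ₁ ▸ h.run _ (by decide) (by decide)
  have l₂ : IsLoaded D H m σ₂ := hσ₂ ▸ l₁.run _ (by decide) (by decide)
  obtain ⟨hrule, hlab, hmark⟩ := plan_congr (m := m) (n := n) (σ := σ) (τ := σ₁)
    (fun r hr => hσ₁ ▸ run_reg_of_notMem _ _
      ((by decide : ∀ r ∈ [3, 4, 5, 6, 7, 8], r ∉ decodeEntry.assigns) r hr) _)
    (hσ₁ ▸ run_arr_of_notMem _ _ (by decide) _)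
  have hbit := isBit_run_crossEntry l₁ hm h18 h19 h20 h21 (by rw [h22, hlab]) (by rw [h23, hlab])
  rw [← hσ₂, hrule, hlab, hmark, h17] at hbit
  have k13 : σ₂.reg 13 = σ.reg 13 := by
    rw [hσ₂, run_reg_of_notMem _ _ (by decide), hσ₁,
      run_reg_of_notMem _ _ (by decide)]
  have k17 : σ₂.reg 17 = s := by rw [hσ₂, run_reg_of_notMem _ _ (by decide), h17]
  have k18 : σ₂.reg 18 = num x := by rw [hσ₂, run_reg_of_notMem _ _ (by decide), h18]
  have k19 : σ₂.reg 19 = num y := by rw [hσ₂, run_reg_of_notMem _ _ (by decide), h19]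
  have k5 : σ₂.arr 5 = σ.arr 5 := by rw [hσ₂, run_arr_of_notMem _ _ (by decide), hσ₁,
      run_arr_of_notMem _ _ (by decide)]
  have htest : (Expr.op .mul (.op .eq (reg 17) (const 0))
      (read 2 (.op .add (.op .mul (reg 18) (reg 1)) (reg 19)))).eval σ₂ ≠ 0 ↔
        s = 0 ∧ PartArc H x y := by
    simp only [eval_mul, ne_eq, Nat.mul_eq_zero, eval_eq_eq_zero, eval_reg, eval_const, eval_read,
      eval_add, k17, k18, k19, l₂.reg_one, (l₂.partArc x y).eq_zero_iff]
    tauto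
  obtain ⟨σ₃, hσ₃⟩ : ∃ ρ, ρ = (LoopProg.ite (Expr.op .mul (.op .eq (reg 17) (const 0))
    (read 2 (.op .add (.op .mul (reg 18) (reg 1)) (reg 19)))) (assign 24 (const 1)) skip).run σ₂ :=
      ⟨_, rfl⟩
  have hrun : entryProg.run σ = (write 5 (reg 13) (reg 24)).run σ₃ := by
    rw [hσ₃, hσ₂, hσ₁]
    rfl
  have m13 : σ₃.reg 13 = σ.reg 13 := by rw [hσ₃, run_reg_of_notMem _ _ (by decide), k13]
  have m5 : σ₃.arr 5 = σ.arr 5 := by rw [hσ₃, run_arr_of_notMem _ _ (by decide), k5]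
  have m24 : IsBit (σ₃.reg 24) (LayerAdj D H m (σ.rule m) (σ.label n) (σ.mark n) s x y) := by
    by_cases hp : s = 0 ∧ PartArc H x y
    · rw [hσ₃, LoopProg.run, if_pos (htest.mpr hp)]
      exact ⟨fun _ => by simp [LoopProg.run], fun hn => (hn (.inl hp)).elim⟩
    · rw [hσ₃, LoopProg.run, if_neg (mt htest.mp hp)]
      simpa [LoopProg.run, LayerAdj, hp] using hbit
  rw [hrun]
  refine ⟨?_, fun k hk => ?_⟩
  · simpa [LoopProg.run, m13] using m24
  · simp [LoopProg.run, m13, m5, hk]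

theorem outputs_run_writePacking {σ : State} (h : IsLoaded D H m σ) (hm : 0 < m) :
    Outputs (writePacking.run σ)
      (fun s : Fin m => layer D H m (σ.rule m) (σ.label n) (σ.mark n) s) := by
  obtain ⟨σ₁, hσ₁⟩ : ∃ ρ, ρ = (loop 13 14 (.op .mul (reg 2) (reg 1))
    (write 4 (reg 13) (const 1))).run σ := ⟨_, rfl⟩
  have l₁ : IsLoaded D H m σ₁ := hσ₁ ▸ h.run _ (by decide) (by decide)
  have hverts : ∀ k < m * order n, σ₁.arr 4 k = 1 := by
    have := run_loop_induct (i := 13) (b := 14) (σ := σ) (e := .op .mul (reg 2) (reg 1))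
      (p := write 4 (reg 13) (const 1)) (fun k τ => ∀ k' < k, τ.arr 4 k' = 1)
      (fun k' hk' => absurd hk' (Nat.not_lt_zero _)) ?_
    · rw [eval_mul, eval_reg, eval_reg, h.reg_one, h.reg_two, ← hσ₁] at this
      exact this
    · intro k τ _ hτ _ _ hk k' hk'
      simp only [LoopProg.run, State.setReg_arr, State.setArr_arr, eval_reg, eval_const, hτ,
        true_and]
      split_ifs with he
      · rfl
      · exact hk k' (by omega)
  have hadj : ∀ s < m, ∀ x y : Σ i : Fin t, Fin (n i), IsBit
      ((writePacking.run σ).arr 5 ((s * order n + num x) * order n + num y))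
      (LayerAdj D H m (σ.rule m) (σ.label n) (σ.mark n) s x y) := by
    have hrun : writePacking.run σ =
        (loop 13 14 (.op .mul (.op .mul (reg 2) (reg 1)) (reg 1)) entryProg).run σ₁ := by
      rw [hσ₁]
      rfl
    obtain ⟨hrule, hlab, hmark⟩ := plan_congr (m := m) (n := n) (σ := σ) (τ := σ₁)
      (fun r hr => hσ₁ ▸ run_reg_of_notMem _ _ ((by decide : ∀ r ∈ [3, 4, 5, 6, 7, 8],
        r ∉ (loop 13 14 (.op .mul (reg 2) (reg 1)) (write 4 (reg 13) (const 1))).assigns) r hr) _)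
      (hσ₁ ▸ run_arr_of_notMem _ _ (by decide) _)
    have := run_loop_induct (i := 13) (b := 14) (σ := σ₁)
      (e := .op .mul (.op .mul (reg 2) (reg 1)) (reg 1)) (p := entryProg)
      (fun k τ => ∀ s < m, ∀ x y : Σ i : Fin t, Fin (n i),
        (s * order n + num x) * order n + num y < k →
        IsBit (τ.arr 5 ((s * order n + num x) * order n + num y))
          (LayerAdj D H m (σ.rule m) (σ.label n) (σ.mark n) s x y))
      (fun s _ x y hk => absurd hk (by omega)) ?_
    · rw [hrun]
      refine fun s hs x y => this s hs x y ?_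
      simp only [eval_mul, eval_reg, l₁.reg_one, l₁.reg_two]
      have h1 : s * order n + num x + 1 ≤ m * order n := by
        have := Nat.mul_le_mul_right (order n) (Nat.succ_le_of_lt hs)
        have := num_lt x
        rw [Nat.succ_mul] at *
        omega
      have := Nat.mul_le_mul_right (order n) h1
      have := num_lt y
      rw [Nat.succ_mul] at *
      omega
    · intro k τ hk hτ hreg harr hbit s hs x y hlt
      have lτ : IsLoaded D H m τ := l₁.congr (hreg 0 (by decide)) (hreg 1 (by decide))
        (hreg 2 (by decide)) (harr 1 (by decide)) (harr 2 (by decide)) (harr 6 (by decide))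
      obtain ⟨hrule', hlab', hmark'⟩ := plan_congr (m := m) (n := n) (σ := σ₁) (τ := τ)
        (fun r hr => hreg r ((by decide : ∀ r ∈ [3, 4, 5, 6, 7, 8],
          r ∉ (loop 13 14 (.op .mul (.op .mul (reg 2) (reg 1)) (reg 1)) entryProg).assigns) r hr))
        (harr 7 (by decide))
      rw [State.setReg_arr]
      rcases Nat.lt_succ_iff_lt_or_eq.mp hlt with h' | h'
      · -- every earlier entry lies at another position
        obtain ⟨s', x', y', he⟩ : ∃ (s' : ℕ) (x' y' : Σ i : Fin t, Fin (n i)),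
            k = (s' * order n + num x') * order n + num y' := by
          have hN : 0 < order n := (Nat.zero_le _).trans_lt (num_lt x)
          obtain ⟨x', hx'⟩ := exists_num_eq (n := n) (Nat.mod_lt (k / order n) hN)
          obtain ⟨y', hy'⟩ := exists_num_eq (n := n) (Nat.mod_lt k hN)
          exact ⟨k / order n / order n, x', y', by
            rw [hx', hy', div_mul_add_mod, div_mul_add_mod]⟩
        rw [(isBit_run_entryProg lτ hm (hτ.trans he)).2 _ (by omega)]
        exact hbit s hs x y h'
      · have := (isBit_run_entryProg lτ hm (hτ.trans h'.symm)).1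
        rwa [hrule', hlab', hmark', hrule, hlab, hmark, hτ, ← h'] at this
  intro s
  constructor
  · intro x
    refine iff_of_true ?_ trivial
    change ((loop 13 14 (.op .mul (.op .mul (reg 2) (reg 1)) (reg 1)) entryProg).run _).arr 4 _ = 1
    rw [run_arr_of_notMem _ _ (by decide), ← hσ₁]
    refine hverts _ ?_
    have := Nat.mul_le_mul_right (order n) (Nat.succ_le_of_lt s.2)
    have := num_lt x
    rw [Nat.succ_mul] at *
    omega
  · intro x y
    have he : (s : ℕ) * order n ^ 2 + num x * order n + num y =
        (s * order n + num x) * order n + num y := by ring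
    rw [he]
    exact (hadj s s.2 x y).eq_one_iff

end Output

/-! ### The packing and the running time -/

section Final

open StrongPacking.Expr StrongPacking.LoopProg

variable {t : ℕ} {n : Fin t → ℕ} {D : Digraph (Fin t)} {H : ∀ i, Digraph (Fin (n i))} {m : ℕ}

/-- After the first part of the program the labels are the numbers of the vertices in their
parts. -/
theorem run_readOrders (D : Digraph (Fin t)) (H : ∀ i, Digraph (Fin (n i)))
    (S : Finset (Σ i : Fin t, Fin (n i))) (ht : 2 ≤ t) :
    IsLoaded D H (⨅ i, n i) (readOrders.run (input D H S)) ∧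
      (∀ z, (readOrders.run (input D H S)).label n z = z.2) ∧
      (readOrders.run (input D H S)).reg 3 = 0 := by
  obtain ⟨σ, hσ⟩ : ∃ σ, σ = fillParts.run (input D H S) := ⟨_, rfl⟩
  obtain ⟨h1, h67⟩ := run_fillParts (σ := input D H S) input_arr_zero rfl rfl
  rw [← hσ] at h1 h67
  have h0 : σ.reg 0 = t := by
    rw [hσ, run_reg_of_notMem _ _ (by decide)]
    rfl
  have hrun : readOrders.run (input D H S) = leastPart.run σ := by
    rw [hσ]
    rfl
  have harr : (leastPart.run σ).arr = σ.arr :=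
    funext fun a => run_arr_of_notMem _ _ (by simp [leastPart, writes]) _
  have hin : ∀ a ∈ [0, 1, 2], σ.arr a = (input D H S).arr a := fun a ha => by
    rw [hσ]
    exact run_arr_of_notMem _ _
      ((by decide : ∀ a ∈ [0, 1, 2], a ∉ fillParts.writes) a ha) _
  rw [hrun]
  refine ⟨⟨?_, ?_, ?_, ?_, ?_, ?_⟩, fun z => ?_, ?_⟩
  · rw [run_reg_of_notMem _ _ (by decide), h0]
  · rw [run_reg_of_notMem _ _ (by decide), h1]
  · exact run_leastPart (fun i => by rw [hin 0 (by decide), input_arr_zero]) h0 ht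
  · rw [harr, hin 1 (by decide)]
    exact input_arr_one
  · rw [harr, hin 2 (by decide)]
    exact input_arr_two
  · rw [harr]
    exact fun x => (h67 x).1
  · rw [State.label, harr]
    exact (h67 z).2
  · rw [run_reg_of_notMem _ _ (by decide), hσ, run_reg_of_notMem _ _ (by decide)]
    rfl

theorem run_adjustLabels {σ : State} (h : IsLoaded D H m σ) :
    (σ.reg 3 = 0 ∧ m = 2 ∧ order n < 8 → adjustLabels.run σ = relabel.run σ) ∧
      (¬ (σ.reg 3 = 0 ∧ m = 2 ∧ order n < 8) → adjustLabels.run σ = σ) := by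
  have htest : (Expr.op .mul (.op .mul (.op .eq (reg 3) (const 0))
      (.op .eq (reg 2) (const 2))) (.op .lt (reg 1) (const 8))).eval σ ≠ 0 ↔
        σ.reg 3 = 0 ∧ m = 2 ∧ order n < 8 := by
    simp only [eval_mul, ne_eq, Nat.mul_eq_zero, eval_eq_eq_zero, eval_lt_eq_zero, eval_reg,
      eval_const, h.reg_one, h.reg_two, not_or, not_not, and_assoc]
  exact ⟨fun hc => if_pos (htest.mpr hc), fun hc => if_neg (mt htest.mp hc)⟩

/-- The hypotheses on `Q` enter only if `D` is a 3-cycle and `m = 2`. -/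
theorem exists_packing_run_findPacking {σ : State} (h : IsLoaded D H m σ)
    (hσ : ∀ z : Σ i : Fin t, Fin (n i), σ.label n z = z.2) (h3 : σ.reg 3 = 0) (ht : 2 ≤ t)
    (hm : 0 < m) (hn : ∀ i, m ≤ n i) (hlD : Loopless D) (hl : ∀ i, Loopless (H i))
    (hD : (Strong D ∧ Symmetric D) ∨ (Strong D ∧ Semicomplete D ∧ ¬ InQ0 (comp D H)))
    (S : Set (Σ i : Fin t, Fin (n i))) :
    ∃ F : Fin m → Subdigraph (comp D H), Outputs (findPacking.run σ) F ∧ IsPacking S F := by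
  obtain ⟨σ₁, hσ₁⟩ : ∃ ρ, ρ = findWalk.run σ := ⟨_, rfl⟩
  obtain ⟨σ₂, hσ₂⟩ : ∃ ρ, ρ = adjustLabels.run σ₁ := ⟨_, rfl⟩
  obtain ⟨σ₃, hσ₃⟩ : ∃ ρ, ρ = markVertex.run σ₂ := ⟨_, rfl⟩
  have hrun : findPacking.run σ = writePacking.run σ₃ := by
    rw [hσ₃, hσ₂, hσ₁]
    rfl
  have l₁ : IsLoaded D H m σ₁ := hσ₁ ▸ h.run _ (by decide) (by decide)
  have l₂ : IsLoaded D H m σ₂ := hσ₂ ▸ l₁.run _ (by decide) (by decide)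
  have l₃ : IsLoaded D H m σ₃ := hσ₃ ▸ l₂.run _ (by decide) (by decide)
  have hlab₁ : ∀ z, σ₁.label n z = z.2 := fun z => by
    rw [State.label, hσ₁, run_arr_of_notMem _ _ (by decide)]
    exact hσ z
  obtain ⟨hpos, hneg⟩ := run_adjustLabels l₁
  rw [← hσ₂] at hpos hneg
  have hlab₂ : ¬ (σ₁.reg 3 = 0 ∧ m = 2 ∧ order n < 8) → ∀ z, σ₂.label n z = z.2 := fun hc z => by
    rw [hneg hc]
    exact hlab₁ z
  have hlab₃ : σ₃.label n = σ₂.label n := funext fun z => by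
    rw [State.label, hσ₃, run_arr_of_notMem _ _ (by decide)]
    rfl
  have hreg : ∀ r ∈ [3, 4, 5, 6, 7], σ₃.reg r = σ₁.reg r := fun r hr => by
    rw [hσ₃, run_reg_of_notMem _ _
        ((by decide : ∀ r ∈ [3, 4, 5, 6, 7], r ∉ markVertex.assigns) r hr),
      hσ₂, run_reg_of_notMem _ _
        ((by decide : ∀ r ∈ [3, 4, 5, 6, 7], r ∉ adjustLabels.assigns) r hr)]
  have hstrong : Strong D := hD.elim (·.1) (·.1)
  have hs : Symmetric D ∨ Semicomplete D := hD.imp (·.2) (·.2.1)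
  have hmark : IsMarking m (σ₃.label n) (σ₃.mark n) := by
    rw [hlab₃]
    intro hex
    obtain ⟨v, hv, h8⟩ := run_markVertex l₂ hex
    rw [← hσ₃] at h8
    exact ⟨v, hv, by simp [State.mark, h8], fun z hz => by
      simp [State.mark, h8, num_injective.ne hz]⟩
  have hplan : IsPlan D H m (σ₃.rule m) (σ₃.label n) := by
    rw [hlab₃]
    have hw := run_findWalk h.reg_zero h3 h.arc
    rw [← hσ₁] at hw
    rcases hw with ⟨hne, p, q, r, w, hw, hp, hq, hr, hw'⟩ | ⟨h0, hw⟩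
    · refine .inl ⟨p, q, r, w, hw, ?_, hlab₂ fun hc => hne hc.1⟩
      simp [State.rule, planRule, hreg, hne, hp, hq, hr, hw']
    · refine .inr ⟨hw, ?_⟩
      have hrule : σ₃.rule m = if m < 3 then shiftRule m else triangleRule m := by
        simp [State.rule, planRule, hreg, h0]
      rw [hrule]
      rcases lt_trichotomy m 2 with hm2 | rfl | hm2
      · exact .inr (.inl ⟨by omega, if_pos (by omega), hlab₂ (by omega)⟩)
      · refine .inr (.inr ⟨rfl, if_pos (by omega), ?_⟩)
        obtain ⟨ht3, h2, hsc⟩ := eq_three_of_not_isEvenWalk ht hstrong hs hw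
        by_cases h8 : order n < 8
        · have hQ : ¬ InQ0 (comp D H) := by
            rcases hD with ⟨-, hsym⟩ | ⟨-, -, hQ⟩
            · have : Nontrivial (Fin t) := Fin.nontrivial_iff_two_le.mpr ht
              obtain ⟨y, hy⟩ := hstrong.exists_out ⟨0, by omega⟩
              exact absurd (hsym _ _ hy) (h2 _ _ hy)
            · exact hQ
          have h6 : 6 ≤ order n := by
            obtain ⟨i, j, k, -, -, -, he, -⟩ := order_eq_of_three (n := n) ht3
            have := hn i
            have := hn j
            have := hn k
            omega
          rw [hpos ⟨h0, rfl, h8⟩]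
          exact isLabelling_relabel l₁ hlab₁ (by omega)
            (exists_partArc ht3 hstrong hsc h2 hl hn hQ (by omega))
        · exact .inl ⟨by omega, hlab₂ fun hc => h8 hc.2.2⟩
      · exact .inl ⟨hm2, if_neg (by omega), hlab₂ (by omega)⟩
  refine ⟨_, ?_, hplan.isPacking hmark ht hm hn hstrong hlD hl hs S⟩
  rw [hrun]
  exact outputs_run_writePacking l₃ hm

/-- The two parts of the program run in time `O(N ^ 4)` for inputs of order `N`, on words that hold
numbers polynomial in `N`. -/
theorem exists_exec_findPacking :
    ∃ C c : ℕ, ∀ (t : ℕ) (n : Fin t → ℕ) (D : Digraph (Fin t)) (H : ∀ i, Digraph (Fin (n i)))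
      (S : Finset (Σ i : Fin t, Fin (n i))), 2 ≤ t → (∀ i, 1 ≤ n i) →
      ∃ T ≤ C * order n ^ 4,
        Exec (order n ^ c) (.seq readOrders.compile findPacking.compile) (input D H S) T
          (findPacking.run (readOrders.run (input D H S))) := by
  obtain ⟨A, hA⟩ : ∃ A, A = readOrders.time 1 := ⟨_, rfl⟩
  obtain ⟨B, hB⟩ : ∃ B, B = findPacking.time 1 := ⟨_, rfl⟩
  obtain ⟨w, hw⟩ : ∃ w, w = readOrders.weight + findPacking.weight := ⟨_, rfl⟩
  refine ⟨A + B, (1 + A + B + 4) * w + 1, fun t n D H S ht hn => ?_⟩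
  obtain ⟨htN, h0, hb⟩ := bounded_input (D := D) (H := H) (S := S) ht hn
  obtain ⟨N, hN⟩ : ∃ N, N = order n := ⟨_, rfl⟩
  rw [← hN] at htN h0 hb ⊢
  have hN2 : 2 ≤ N := ht.trans htN
  have hpow : ∀ {a b : ℕ}, a ≤ b → N ^ a ≤ N ^ b := fun h => Nat.pow_le_pow_right (by omega) h
  have hN4 : N ≤ N ^ 4 := by simpa using hpow (show 1 ≤ 4 by omega)
  have hA' : readOrders.time N ≤ A * N ^ 4 := by
    refine (time_le (by omega) _).trans ?_
    rw [← hA, depth_readOrders]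
    exact Nat.mul_le_mul_left _ (hpow (by omega))
  have hB' : findPacking.time N ≤ B * N ^ 4 := by
    rw [hB, ← depth_findPacking]
    exact time_le (by omega) _
  have hK : N ^ 4 + readOrders.time N + findPacking.time N ≤ N ^ (1 + A + B + 4) := by
    calc N ^ 4 + readOrders.time N + findPacking.time N ≤ (1 + A + B) * N ^ 4 := by linarith
      _ ≤ N ^ (1 + A + B) * N ^ 4 := Nat.mul_le_mul_right _ (Nat.lt_pow_self (by omega)).le
      _ = N ^ (1 + A + B + 4) := (pow_add _ _ _).symm
  have hW : ∀ a b, a ≤ N ^ 4 + readOrders.time N + findPacking.time N → b ≤ w →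
      a ^ b < N ^ ((1 + A + B + 4) * w + 1) := fun a b ha hbw => by
    calc a ^ b ≤ (N ^ (1 + A + B + 4)) ^ b := Nat.pow_le_pow_left (ha.trans hK) _
      _ = N ^ ((1 + A + B + 4) * b) := (pow_mul _ _ _).symm
      _ ≤ N ^ ((1 + A + B + 4) * w) := hpow (Nat.mul_le_mul_left _ hbw)
      _ < N ^ ((1 + A + B + 4) * w + 1) := Nat.pow_lt_pow_right (by omega) (Nat.lt_succ_self _)
  obtain ⟨T₁, hT₁, he₁, hb₁⟩ := exec_compile hN2 readOrders (N ^ 4) (input D H S)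
    wellFormed_readOrders notMem_readOrders.1 notMem_readOrders.2
    (fun r hr => by
      rw [List.mem_singleton.mp hr]
      exact htN)
    h0 (hb.mono hN4) (depth_readOrders ▸ hpow (by omega)) (hN2.trans hN4)
    (hW _ _ (by omega) (by omega))
  obtain ⟨hl, -, -⟩ := run_readOrders D H S ht
  have hmin : ⨅ i, n i ≤ N := by
    refine (ciInf_le' n (⟨0, by omega⟩ : Fin t)).trans ?_
    rw [hN, order]
    exact Finset.single_le_sum (f := n) (fun i _ => Nat.zero_le _) (Finset.mem_univ _)
  obtain ⟨T₂, hT₂, he₂, -⟩ := exec_compile hN2 findPacking (N ^ 4 + readOrders.time N) _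
    wellFormed_findPacking notMem_findPacking.1 notMem_findPacking.2
    (fun r hr => by
      rcases List.mem_cons.mp hr with rfl | hr
      · rw [hl.reg_zero]
        exact htN
      rcases List.mem_cons.mp hr with rfl | hr
      · rw [hl.reg_one, hN]
      · rw [List.mem_singleton.mp hr, hl.reg_two]
        exact hmin)
    (fun i => by
      rw [run_arr_of_notMem _ _ notMem_readOrders.2]
      exact h0 i)
    hb₁ (by rw [depth_findPacking]; omega) (by omega) (hW _ _ le_rfl (by omega))
  exact ⟨T₁ + T₂, by linarith, .seq he₁ he₂⟩

end Final

end StrongPacking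

theorem theorem4p6 :
    (∀ (t : ℕ) (n : Fin t → ℕ) (D : Digraph (Fin t)) (H : ∀ i, Digraph (Fin (n i)))
        (S : Finset (Σ i : Fin t, Fin (n i))),
      2 ≤ t → (∀ i, 1 ≤ n i) →
      StrongPacking.Loopless D → (∀ i, StrongPacking.Loopless (H i)) →
      ((StrongPacking.Strong D ∧ StrongPacking.Symmetric D) ∨
        (StrongPacking.Strong D ∧ StrongPacking.Semicomplete D ∧
          ¬ StrongPacking.InQ0 (StrongPacking.comp D H))) →
      2 ≤ S.card → S.card ≤ StrongPacking.order n →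
      ∃ F : Fin (⨅ i, n i) → StrongPacking.Subdigraph (StrongPacking.comp D H),
        StrongPacking.IsPacking (S : Set (Σ i : Fin t, Fin (n i))) F) ∧
    (∃ (P : StrongPacking.Prog) (C c : ℕ),
      ∀ (t : ℕ) (n : Fin t → ℕ) (D : Digraph (Fin t)) (H : ∀ i, Digraph (Fin (n i)))
        (S : Finset (Σ i : Fin t, Fin (n i))),
      2 ≤ t → (∀ i, 1 ≤ n i) →
      StrongPacking.Loopless D → (∀ i, StrongPacking.Loopless (H i)) →
      ((StrongPacking.Strong D ∧ StrongPacking.Symmetric D) ∨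
        (StrongPacking.Strong D ∧ StrongPacking.Semicomplete D ∧
          ¬ StrongPacking.InQ0 (StrongPacking.comp D H))) →
      2 ≤ S.card → S.card ≤ StrongPacking.order n →
      ∃ (T : ℕ) (σ : StrongPacking.State)
        (F : Fin (⨅ i, n i) → StrongPacking.Subdigraph (StrongPacking.comp D H)),
        StrongPacking.Exec (StrongPacking.order n ^ c) P (StrongPacking.input D H S) T σ ∧
        T ≤ C * StrongPacking.order n ^ 4 ∧
        StrongPacking.Outputs σ F ∧
        StrongPacking.IsPacking (S : Set (Σ i : Fin t, Fin (n i))) F) := by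
  refine (and_iff_right_of_imp ?_).mpr ?_
  · rintro ⟨P, C, c, h⟩ t n D H S ht hn hlD hl hD h2 hS
    obtain ⟨T, σ, F, -, -, -, hP⟩ := h t n D H S ht hn hlD hl hD h2 hS
    exact ⟨F, hP⟩
  · obtain ⟨C, c, hexec⟩ := StrongPacking.exists_exec_findPacking
    refine ⟨StrongPacking.readOrders.compile.seq StrongPacking.findPacking.compile, C, c,
      fun t n D H S ht hn hlD hl hD _ _ => ?_⟩
    have : Nonempty (Fin t) := ⟨⟨0, by omega⟩⟩
    obtain ⟨T, hT, he⟩ := hexec t n D H S ht hn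
    obtain ⟨h, hlab, h3⟩ := StrongPacking.run_readOrders D H S ht
    obtain ⟨F, hF, hP⟩ := StrongPacking.exists_packing_run_findPacking h hlab h3 ht
      (le_ciInf hn) (ciInf_le' n) hlD hl hD S
    exact ⟨T, _, F, he, hT, hF, hP⟩
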